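/- Let $n\ge 1$ and let $\mathcal D=\bigcup_{k\in\mathbb Z}\mathcal D_k$ be a dyadic system on $\mathbb R^n$: each $\mathcal D_k$ is a partition of $\mathbb R^n$ into half-open cubes $\prod_i[a_i,a_i+2^{-k})$, and any two cubes of $\mathcal D$ are disjoint or nested. For $Q\in\mathcal D_k$ let $\mathcal D_r(Q)$ be the set of $R\in\mathcal D_{k+r}$ with $R\subseteq Q$. Let $\mu$ be a Borel measure on $\mathbb R^n$ with $0<\mu(Q)<\infty$ for all $Q\in\mathcal D$ and such that all dyadic quadrants $\bigcup\{R\in\mathcal D: R\supseteq Q\}$, $Q\in\mathcal D$, have infinite measure. (All functions are real-valued.) Let $\{h_Q^j\}_{Q\in\mathcal D,\,1\le j<2^n}$ be a Haar system for $\mu$: $h_Q^j$ vanishes off $Q$, is constant on each $R\in\mathcal D_1(Q)$, $\int h_Q^j\,d\mu=0$, and all these functions form an orthonormal basis of $L^2(\mu)$. (For $n=1$ it is unique up to signs.) Assume that $\mu$ is balanced: $$\sup_{Q\in\mathcal D}\ \sup_{R\in\mathcal D_1(Q)}\ \sup_{i,j}\Big[\|h_Q^i\|_{L^1(\mu)}\|h_R^j\|_{L^\infty(\mu)}+\|h_Q^i\|_{L^\infty(\mu)}\|h_R^j\|_{L^1(\mu)}\Big]<\infty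 .$$ Let $r,s\in\mathbb N=\{0,1,\dots\}$ and let $T$ be a Haar shift of complexity $(r,s)$ that is bounded on $L^2(\mu)$, that is, a bounded linear operator on $L^2(\mu)$ such that for some real coefficients $\alpha$ and all $f\in L^2(\mu)$ $$Tf=\sum_{Q\in\mathcal D}\ \sum_{R\in\mathcal D_r(Q),\,S\in\mathcal D_s(Q)}\ \sum_{i,j}\alpha^{Q,i,j}_{R,S}\,\langle f,h_R^i\rangle\,h_S^j ,$$ with unconditional convergence in $L^2(\mu)$. Write $\mathsf E_kf=\sum_{Q\in\mathcal D_k}\langle f\rangle_Q1_Q$, where $\langle f\rangle_Q=\mu(Q)^{-1}\int_Qf\,d\mu$, and $\mathsf D_kf=\mathsf E_kf-\mathsf E_{k-1}f$. Let $\mathrm H^1(\mu)$ be the space of $f\in L^1(\mu)$ with $\|f\|_{\mathrm H^1}=\big\|(\sum_{k\in\mathbb Z}|\mathsf D_kf|^2)^{1/2}\big\|_{L^1(\mu)}<\infty$. Let $\mathrm{BMO}(\mu)$ be the space of functions $f$, integrable on every $Q\in\mathcal D$, with $\|f\|_{\mathrm{BMO}}=\sup_{k\in\mathbb Z}\big\|\mathsf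 E_k|f-\mathsf E_{k-1}f|\big\|_{L^\infty(\mu)}<\infty$, modulo those with $\|f\|_{\mathrm{BMO}}=0$. Then: (i) there is a bounded linear operator on $\mathrm H^1(\mu)$ that coincides with $T$ on $\mathrm H^1(\mu)\cap L^2(\mu)$; (ii) there is a bounded linear operator $\widetilde T$ on $\mathrm{BMO}(\mu)$ that coincides with $T$ on $\mathrm{BMO}(\mu)\cap L^2(\mu)$ (as classes in $\mathrm{BMO}(\mu)$). Moreover, for every $f\in\mathrm{BMO}(\mu)$, every $P\in\mathcal D$ and every $Q\in\mathcal D_{r+s}(P)$, the function $f1_P$ lies in $L^2(\mu)$, and any representative of $\widetilde Tf$ equals $T(f1_P)$ plus a constant $\mu$-a.e. on $Q$. -/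

import Mathlib

open MeasureTheory Set
open scoped ENNReal NNReal

/-- A dyadic system on `ℝⁿ`: `gen k` is the family of cubes of side length `2 ^ (-k)`. -/
structure DyadicSystem (n : ℕ) where
  gen : ℤ → Set (Set (Fin n → ℝ))
  isCube : ∀ k, ∀ Q ∈ gen k, ∃ a : Fin n → ℝ,
    Q = Set.univ.pi fun i => Set.Ico (a i) (a i + (2 : ℝ) ^ (-k))
  partition : ∀ k, ∀ x : Fin n → ℝ, ∃! Q, Q ∈ gen k ∧ x ∈ Q
  nested : ∀ k l, ∀ Q ∈ gen k, ∀ R ∈ gen l, Disjoint Q R ∨ Q ⊆ R ∨ R ⊆ Q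

namespace DyadicSystem

variable {n : ℕ}

/-- All the cubes of the system. -/
def cubes (D : DyadicSystem n) : Set (Set (Fin n → ℝ)) := {Q | ∃ k, Q ∈ D.gen k}

/-- The cubes `R ⊆ Q` of the system with `ℓ(Q) = 2 ^ r * ℓ(R)`. -/
def desc (D : DyadicSystem n) (r : ℕ) (Q : Set (Fin n → ℝ)) : Set (Set (Fin n → ℝ)) :=
  {R | ∃ k : ℤ, Q ∈ D.gen k ∧ R ∈ D.gen (k + r) ∧ R ⊆ Q}

/-- The quadrant of `Q`: the union of all cubes of the system that contain `Q`. For the standard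
dyadic intervals of `ℝ` the quadrants are `[0, ∞)` and `(-∞, 0)`. -/
def quadrant (D : DyadicSystem n) (Q : Set (Fin n → ℝ)) : Set (Fin n → ℝ) :=
  ⋃₀ {R | R ∈ D.cubes ∧ Q ⊆ R}

/-- The cube of generation `k` that contains `x`. -/
def cell (D : DyadicSystem n) (k : ℤ) (x : Fin n → ℝ) : Set (Fin n → ℝ) :=
  ⋃₀ {Q | Q ∈ D.gen k ∧ x ∈ Q}

/-- The conditional expectation `E_k f = ∑_{Q ∈ D_k} ⟨f⟩_Q 1_Q`. -/
noncomputable def expect (D : DyadicSystem n) (μ : Measure (Fin n → ℝ)) (k : ℤ)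
    (f : (Fin n → ℝ) → ℝ) (x : Fin n → ℝ) : ℝ :=
  ⨍ y in D.cell k x, f y ∂μ

/-- The martingale difference `D_k f = E_k f - E_{k-1} f`. -/
noncomputable def mdiff (D : DyadicSystem n) (μ : Measure (Fin n → ℝ)) (k : ℤ)
    (f : (Fin n → ℝ) → ℝ) (x : Fin n → ℝ) : ℝ :=
  D.expect μ k f x - D.expect μ (k - 1) f x

/-- The martingale square function `(∑_k |D_k f|²)^{1/2}`, with values in `[0, ∞]`. -/
noncomputable def squareFn (D : DyadicSystem n) (μ : Measure (Fin n → ℝ))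
    (f : (Fin n → ℝ) → ℝ) (x : Fin n → ℝ) : ℝ≥0∞ :=
  (∑' k : ℤ, ‖D.mdiff μ k f x‖ₑ ^ (2 : ℝ)) ^ (1 / 2 : ℝ)

/-- The martingale Hardy norm `‖S f‖₁`, with values in `[0, ∞]`. -/
noncomputable def h1Norm (D : DyadicSystem n) (μ : Measure (Fin n → ℝ))
    (f : (Fin n → ℝ) → ℝ) : ℝ≥0∞ :=
  ∫⁻ x, D.squareFn μ f x ∂μ

/-- The martingale BMO seminorm `sup_k ‖E_k |f - E_{k-1} f|‖_∞`, with values in `[0, ∞]`. -/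
noncomputable def bmoNorm (D : DyadicSystem n) (μ : Measure (Fin n → ℝ))
    (f : (Fin n → ℝ) → ℝ) : ℝ≥0∞ :=
  ⨆ k : ℤ, essSup (fun x => ⨍⁻ y in D.cell k x, ‖f y - D.expect μ (k - 1) f y‖ₑ ∂μ) μ

theorem cell_eq (D : DyadicSystem n) {k : ℤ} {Q : Set (Fin n → ℝ)} (hQ : Q ∈ D.gen k)
    {x : Fin n → ℝ} (hx : x ∈ Q) : D.cell k x = Q := by
  have h : {Q' | Q' ∈ D.gen k ∧ x ∈ Q'} = {Q} := by
    ext Q'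
    exact ⟨fun h' => (D.partition k x).unique h' ⟨hQ, hx⟩, fun h' => h' ▸ ⟨hQ, hx⟩⟩
  rw [cell, h, sUnion_singleton]

theorem cell_mem (D : DyadicSystem n) (k : ℤ) (x : Fin n → ℝ) : D.cell k x ∈ D.gen k := by
  obtain ⟨Q, ⟨hQ, hx⟩, -⟩ := D.partition k x
  rwa [D.cell_eq hQ hx]

theorem countable_gen (D : DyadicSystem n) (k : ℤ) : (D.gen k).Countable := by
  apply PairwiseDisjoint.countable_of_nonempty_interior (s := id)
  · intro Q hQ R hR hne
    refine Set.disjoint_left.2 fun x hx hx' => hne ?_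
    exact (D.partition k x).unique ⟨hQ, hx⟩ ⟨hR, hx'⟩
  · intro Q hQ
    obtain ⟨a, rfl⟩ := D.isCube k Q hQ
    have h2 : (0 : ℝ) < (2 : ℝ) ^ (-k) := by positivity
    rw [id, interior_pi_set Set.finite_univ]
    refine ⟨fun i => a i + (2 : ℝ) ^ (-k) / 2, fun i _ => ?_⟩
    simp only [interior_Ico, mem_Ioo]
    constructor <;> linarith

theorem measurableSet_of_gen (D : DyadicSystem n) {k : ℤ} {Q : Set (Fin n → ℝ)}
    (hQ : Q ∈ D.gen k) : MeasurableSet Q := by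
  obtain ⟨a, rfl⟩ := D.isCube k Q hQ
  exact MeasurableSet.univ_pi fun i => measurableSet_Ico

/-- A function of the cell of `x` is measurable. -/
theorem measurable_comp_cell (D : DyadicSystem n) {β : Type*} [MeasurableSpace β] (k : ℤ)
    (F : Set (Fin n → ℝ) → β) : Measurable fun x => F (D.cell k x) := by
  intro s _
  have h : (fun x => F (D.cell k x)) ⁻¹' s = ⋃ Q ∈ {Q | Q ∈ D.gen k ∧ F Q ∈ s}, Q := by
    ext x
    simp only [mem_preimage, mem_iUnion, mem_ofPred_eq, exists_prop]
    constructor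
    · intro hx
      obtain ⟨Q, ⟨hQ, hxQ⟩, -⟩ := D.partition k x
      rw [D.cell_eq hQ hxQ] at hx
      exact ⟨Q, ⟨hQ, hx⟩, hxQ⟩
    · rintro ⟨Q, ⟨hQ, hs⟩, hxQ⟩
      rwa [D.cell_eq hQ hxQ]
  rw [h]
  exact MeasurableSet.biUnion ((D.countable_gen k).mono fun Q hQ => hQ.1)
    fun Q hQ => D.measurableSet_of_gen hQ.1

theorem measurable_expect (D : DyadicSystem n) (μ : Measure (Fin n → ℝ)) (k : ℤ)
    (f : (Fin n → ℝ) → ℝ) : Measurable (D.expect μ k f) :=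
  D.measurable_comp_cell k fun Q => ⨍ y in Q, f y ∂μ

theorem measurable_squareFn (D : DyadicSystem n) (μ : Measure (Fin n → ℝ))
    (f : (Fin n → ℝ) → ℝ) : Measurable (D.squareFn μ f) := by
  refine Measurable.pow_const (Measurable.tsum fun k => ?_) _
  exact (((D.measurable_expect μ k f).sub
    (D.measurable_expect μ (k - 1) f)).enorm).pow_const _

theorem expect_congr (D : DyadicSystem n) {μ : Measure (Fin n → ℝ)} {f g : (Fin n → ℝ) → ℝ}
    (h : f =ᵐ[μ] g) (k : ℤ) : D.expect μ k f = D.expect μ k g := by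
  funext x
  simp only [expect, setAverage_eq]
  rw [integral_congr_ae (ae_restrict_of_ae h)]

theorem expect_add (D : DyadicSystem n) {μ : Measure (Fin n → ℝ)} {f g : (Fin n → ℝ) → ℝ}
    (hf : ∀ Q ∈ D.cubes, IntegrableOn f Q μ) (hg : ∀ Q ∈ D.cubes, IntegrableOn g Q μ) (k : ℤ) :
    D.expect μ k (f + g) = D.expect μ k f + D.expect μ k g := by
  funext x
  have hc : D.cell k x ∈ D.cubes := ⟨k, D.cell_mem k x⟩
  simp only [expect, setAverage_eq, Pi.add_apply]
  rw [integral_add (hf _ hc) (hg _ hc), smul_add]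

theorem expect_smul (D : DyadicSystem n) (μ : Measure (Fin n → ℝ)) (c : ℝ)
    (f : (Fin n → ℝ) → ℝ) (k : ℤ) : D.expect μ k (c • f) = c • D.expect μ k f := by
  funext x
  simp only [expect, setAverage_eq, Pi.smul_apply]
  rw [integral_smul, smul_comm]

theorem h1Norm_congr (D : DyadicSystem n) {μ : Measure (Fin n → ℝ)} {f g : (Fin n → ℝ) → ℝ}
    (h : f =ᵐ[μ] g) : D.h1Norm μ f = D.h1Norm μ g := by
  simp only [h1Norm, squareFn, mdiff, D.expect_congr h]

theorem h1Norm_zero (D : DyadicSystem n) (μ : Measure (Fin n → ℝ)) :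
    D.h1Norm μ 0 = 0 := by
  simp [h1Norm, squareFn, mdiff, expect]

theorem h1Norm_add_le (D : DyadicSystem n) {μ : Measure (Fin n → ℝ)} {f g : (Fin n → ℝ) → ℝ}
    (hf : ∀ Q ∈ D.cubes, IntegrableOn f Q μ) (hg : ∀ Q ∈ D.cubes, IntegrableOn g Q μ) :
    D.h1Norm μ (f + g) ≤ D.h1Norm μ f + D.h1Norm μ g := by
  rw [h1Norm, h1Norm, h1Norm, ← lintegral_add_left (D.measurable_squareFn μ f)]
  refine lintegral_mono fun x => ?_
  have key := ENNReal.lintegral_Lp_add_le (μ := (Measure.count : Measure ℤ)) (p := 2)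
    (f := fun k => ‖D.mdiff μ k f x‖ₑ) (g := fun k => ‖D.mdiff μ k g x‖ₑ)
    (measurable_of_countable _).aemeasurable (measurable_of_countable _).aemeasurable one_le_two
  simp only [lintegral_count, Pi.add_apply] at key
  refine le_trans ?_ key
  refine ENNReal.rpow_le_rpow (ENNReal.tsum_le_tsum fun k => ?_) (by norm_num)
  refine ENNReal.rpow_le_rpow ?_ (by norm_num)
  refine le_trans (le_of_eq ?_) (enorm_add_le _ _)
  congr 1
  simp only [mdiff, D.expect_add hf hg, Pi.add_apply]
  ring

theorem h1Norm_smul (D : DyadicSystem n) (μ : Measure (Fin n → ℝ)) (c : ℝ)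
    (f : (Fin n → ℝ) → ℝ) : D.h1Norm μ (c • f) = ‖c‖ₑ * D.h1Norm μ f := by
  rw [h1Norm, h1Norm, ← lintegral_const_mul _ (D.measurable_squareFn μ f)]
  refine lintegral_congr fun x => ?_
  have h : ∀ k, ‖D.mdiff μ k (c • f) x‖ₑ ^ (2 : ℝ) =
      ‖c‖ₑ ^ (2 : ℝ) * ‖D.mdiff μ k f x‖ₑ ^ (2 : ℝ) := fun k => by
    rw [← ENNReal.mul_rpow_of_nonneg _ _ (by norm_num), ← enorm_mul]
    simp only [mdiff, D.expect_smul, Pi.smul_apply, smul_eq_mul, mul_sub]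
  simp only [squareFn, h]
  rw [ENNReal.tsum_mul_left, ENNReal.mul_rpow_of_nonneg _ _ (by norm_num), ← ENNReal.rpow_mul]
  norm_num

/-- The martingale Hardy space: the `f ∈ L¹(μ)` with `S f ∈ L¹(μ)`. -/
noncomputable def H1 (D : DyadicSystem n) (μ : Measure (Fin n → ℝ)) :
    Submodule ℝ (Lp ℝ 1 μ) where
  carrier := {f | D.h1Norm μ f < ∞}
  zero_mem' := by
    have h : D.h1Norm μ (0 : Lp ℝ 1 μ) = 0 := by
      rw [D.h1Norm_congr (Lp.coeFn_zero ℝ 1 μ), D.h1Norm_zero]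
    change D.h1Norm μ (0 : Lp ℝ 1 μ) < ∞
    rw [h]
    exact ENNReal.zero_lt_top
  add_mem' := by
    intro f g hf hg
    simp only [mem_ofPred_eq] at hf hg ⊢
    rw [D.h1Norm_congr (Lp.coeFn_add f g)]
    exact (D.h1Norm_add_le (fun Q _ => (L1.integrable_coeFn f).integrableOn)
      (fun Q _ => (L1.integrable_coeFn g).integrableOn)).trans_lt (ENNReal.add_lt_top.2 ⟨hf, hg⟩)
  smul_mem' := by
    intro c f hf
    simp only [mem_ofPred_eq] at hf ⊢
    rw [D.h1Norm_congr (Lp.coeFn_smul c f), D.h1Norm_smul]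
    exact ENNReal.mul_lt_top enorm_lt_top hf

theorem bmoNorm_congr (D : DyadicSystem n) {μ : Measure (Fin n → ℝ)} {f g : (Fin n → ℝ) → ℝ}
    (h : f =ᵐ[μ] g) : D.bmoNorm μ f = D.bmoNorm μ g := by
  simp only [bmoNorm, D.expect_congr h, setLAverage_eq]
  congr! 5 with k x
  refine lintegral_congr_ae ?_
  filter_upwards [ae_restrict_of_ae h] with y hy
  rw [hy]

theorem bmoNorm_zero (D : DyadicSystem n) (μ : Measure (Fin n → ℝ)) :
    D.bmoNorm μ 0 = 0 := by
  have h : ∀ k, D.expect μ k 0 = 0 := fun k => by funext x; simp [expect]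
  simp only [bmoNorm, h, setLAverage_eq, Pi.zero_apply, sub_zero, enorm_zero, lintegral_zero,
    ENNReal.zero_div, ENNReal.iSup_eq_zero]
  intro k
  exact nonpos_iff_eq_zero.1 (essSup_le_of_ae_le 0 (Filter.Eventually.of_forall fun x => le_rfl))

theorem bmoNorm_add_le (D : DyadicSystem n) {μ : Measure (Fin n → ℝ)} {f g : (Fin n → ℝ) → ℝ}
    (hf : ∀ Q ∈ D.cubes, IntegrableOn f Q μ) (hg : ∀ Q ∈ D.cubes, IntegrableOn g Q μ) :
    D.bmoNorm μ (f + g) ≤ D.bmoNorm μ f + D.bmoNorm μ g := by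
  refine iSup_le fun k => le_trans ?_ (add_le_add
    (le_iSup (fun k : ℤ => essSup (fun x => ⨍⁻ y in D.cell k x,
      ‖f y - D.expect μ (k - 1) f y‖ₑ ∂μ) μ) k)
    (le_iSup (fun k : ℤ => essSup (fun x => ⨍⁻ y in D.cell k x,
      ‖g y - D.expect μ (k - 1) g y‖ₑ ∂μ) μ) k))
  refine le_trans (essSup_mono_ae (Filter.Eventually.of_forall fun x => ?_))
    (ENNReal.essSup_add_le _ _)
  have hc : D.cell k x ∈ D.cubes := ⟨k, D.cell_mem k x⟩
  simp only [Pi.add_apply, setLAverage_eq]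
  have hm : AEMeasurable (fun y => ‖f y - D.expect μ (k - 1) f y‖ₑ) (μ.restrict (D.cell k x)) :=
    ((hf _ hc).aestronglyMeasurable.aemeasurable.sub
      (D.measurable_expect μ (k - 1) f).aemeasurable).enorm
  rw [← ENNReal.add_div, ← lintegral_add_left' hm]
  refine ENNReal.div_le_div_right (lintegral_mono fun y => ?_) _
  refine le_trans (le_of_eq ?_) (enorm_add_le _ _)
  congr 1
  simp only [D.expect_add hf hg, Pi.add_apply]
  ring

theorem bmoNorm_smul_le (D : DyadicSystem n) (μ : Measure (Fin n → ℝ)) (c : ℝ)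
    (f : (Fin n → ℝ) → ℝ) : D.bmoNorm μ (c • f) ≤ ‖c‖ₑ * D.bmoNorm μ f := by
  refine iSup_le fun k => le_trans ?_ (mul_le_mul_right
    (le_iSup (fun k : ℤ => essSup (fun x => ⨍⁻ y in D.cell k x,
      ‖f y - D.expect μ (k - 1) f y‖ₑ ∂μ) μ) k) _)
  rw [← ENNReal.essSup_const_mul]
  refine essSup_mono_ae (Filter.Eventually.of_forall fun x => ?_)
  simp only [setLAverage_eq]
  rw [← mul_div_assoc, ← lintegral_const_mul' _ _ enorm_ne_top]
  refine ENNReal.div_le_div_right (lintegral_mono fun y => le_of_eq ?_) _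
  rw [← enorm_mul]
  simp only [D.expect_smul, Pi.smul_apply, smul_eq_mul, mul_sub]

/-- The (classes of) functions, integrable on every dyadic cube, with finite martingale BMO
seminorm. -/
noncomputable def BMO (D : DyadicSystem n) (μ : Measure (Fin n → ℝ)) :
    Submodule ℝ ((Fin n → ℝ) →ₘ[μ] ℝ) where
  carrier := {f | (∀ Q ∈ D.cubes, IntegrableOn f Q μ) ∧ D.bmoNorm μ f < ∞}
  zero_mem' := by
    have h0 : ((0 : (Fin n → ℝ) →ₘ[μ] ℝ) : (Fin n → ℝ) → ℝ) =ᵐ[μ] 0 := AEEqFun.coeFn_zero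
    refine ⟨fun Q _ => ?_, ?_⟩
    · exact ((integrable_zero _ _ _).congr h0.symm).integrableOn
    · rw [D.bmoNorm_congr h0, D.bmoNorm_zero]
      exact ENNReal.zero_lt_top
  add_mem' := by
    rintro f g ⟨hf, hf'⟩ ⟨hg, hg'⟩
    refine ⟨fun Q hQ => ?_, ?_⟩
    · exact ((hf Q hQ).add (hg Q hQ)).congr (ae_restrict_of_ae (AEEqFun.coeFn_add f g).symm)
    · rw [D.bmoNorm_congr (AEEqFun.coeFn_add f g)]
      exact (D.bmoNorm_add_le hf hg).trans_lt (ENNReal.add_lt_top.2 ⟨hf', hg'⟩)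
  smul_mem' := by
    rintro c f ⟨hf, hf'⟩
    refine ⟨fun Q hQ => ?_, ?_⟩
    · exact ((hf Q hQ).smul c).congr (ae_restrict_of_ae (AEEqFun.coeFn_smul c f).symm)
    · rw [D.bmoNorm_congr (AEEqFun.coeFn_smul c f)]
      exact (D.bmoNorm_smul_le μ c f).trans_lt (ENNReal.mul_lt_top enorm_lt_top hf')

/-- The elements of `BMO` whose seminorm vanishes. -/
noncomputable def BMONull (D : DyadicSystem n) (μ : Measure (Fin n → ℝ)) :
    Submodule ℝ (D.BMO μ) where
  carrier := {f | D.bmoNorm μ f.1 = 0}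
  zero_mem' := by
    have h0 : ((0 : (Fin n → ℝ) →ₘ[μ] ℝ) : (Fin n → ℝ) → ℝ) =ᵐ[μ] 0 := AEEqFun.coeFn_zero
    change D.bmoNorm μ (0 : (Fin n → ℝ) →ₘ[μ] ℝ) = 0
    rw [D.bmoNorm_congr h0, D.bmoNorm_zero]
  add_mem' := by
    intro f g hf hg
    change D.bmoNorm μ (f.1 + g.1 : (Fin n → ℝ) →ₘ[μ] ℝ) = 0
    rw [mem_ofPred_eq] at hf hg
    rw [D.bmoNorm_congr (AEEqFun.coeFn_add f.1 g.1), ← nonpos_iff_eq_zero]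
    exact (D.bmoNorm_add_le f.2.1 g.2.1).trans (by rw [hf, hg, add_zero])
  smul_mem' := by
    intro c f hf
    change D.bmoNorm μ (c • f.1 : (Fin n → ℝ) →ₘ[μ] ℝ) = 0
    rw [mem_ofPred_eq] at hf
    rw [D.bmoNorm_congr (AEEqFun.coeFn_smul c f.1), ← nonpos_iff_eq_zero]
    exact (D.bmoNorm_smul_le μ c f.1).trans (by rw [hf, mul_zero])

/-- The normed space `BMO(μ)`: functions of finite seminorm modulo those of seminorm zero. -/
abbrev BMOSpace (D : DyadicSystem n) (μ : Measure (Fin n → ℝ)) : Type :=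
  D.BMO μ ⧸ D.BMONull μ

/-- The class in `BMO(μ)` of a function. -/
noncomputable abbrev toBMO (D : DyadicSystem n) (μ : Measure (Fin n → ℝ)) (f : D.BMO μ) :
    D.BMOSpace μ :=
  (D.BMONull μ).mkQ f

end DyadicSystem

/-- A Haar system for `μ`: to each cube `Q` are attached `2 ^ n - 1` functions that vanish off `Q`,
are constant on the dyadic children of `Q` and have integral `0`; all of them together form an
orthonormal basis of `L²(μ)`. -/
structure HaarSystem {n : ℕ} (D : DyadicSystem n) (μ : Measure (Fin n → ℝ)) where
  fn : D.cubes → Fin (2 ^ n - 1) → (Fin n → ℝ) → ℝ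
  support_subset : ∀ Q j, Function.support (fn Q j) ⊆ Q
  const_on_children : ∀ (Q : D.cubes) (j), ∀ R ∈ D.desc 1 Q, ∀ x ∈ R, ∀ y ∈ R,
    fn Q j x = fn Q j y
  memLp : ∀ Q j, MemLp (fn Q j) 2 μ
  integral_eq_zero : ∀ Q j, ∫ x, fn Q j x ∂μ = 0
  orthonormal : Orthonormal ℝ
    fun p : D.cubes × Fin (2 ^ n - 1) => (memLp p.1 p.2).toLp (fn p.1 p.2)
  dense_span : (Submodule.span ℝ (Set.range
    fun p : D.cubes × Fin (2 ^ n - 1) =>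
      (memLp p.1 p.2).toLp (fn p.1 p.2))).topologicalClosure = ⊤

namespace HaarSystem

variable {n : ℕ} {D : DyadicSystem n} {μ : Measure (Fin n → ℝ)}

/-- The Haar function as an element of `L²(μ)`. -/
noncomputable def vec (h : HaarSystem D μ) (Q : D.cubes) (j : Fin (2 ^ n - 1)) : Lp ℝ 2 μ :=
  (h.memLp Q j).toLp (h.fn Q j)

/-- `μ` is balanced: for cubes `Q` and children `R` of `Q`,
`‖h_Q‖₁ ‖h_R‖_∞ + ‖h_Q‖_∞ ‖h_R‖₁` is bounded. -/
def Balanced (h : HaarSystem D μ) : Prop :=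
  ∃ C : ℝ≥0, ∀ Q R : D.cubes, R.1 ∈ D.desc 1 Q → ∀ i j : Fin (2 ^ n - 1),
    eLpNorm (h.fn Q i) 1 μ * eLpNorm (h.fn R j) ∞ μ +
      eLpNorm (h.fn Q i) ∞ μ * eLpNorm (h.fn R j) 1 μ ≤ C

/-- The triples `(Q, R, S)` of cubes with `R` in the `r`-th and `S` in the `s`-th generation of
descendants of `Q`. -/
def Triple (D : DyadicSystem n) (r s : ℕ) : Type :=
  {p : D.cubes × D.cubes × D.cubes // p.2.1.1 ∈ D.desc r p.1 ∧ p.2.2.1 ∈ D.desc s p.1}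

/-- The bounded operator `T` on `L²(μ)` is a Haar shift of complexity `(r, s)`:
`T f = ∑_Q ∑_{R, S} ∑_{i, j} α ⟨f, h_R^i⟩ h_S^j`, the coefficient `α` depending on `Q, R, S, i, j`
and the series converging unconditionally in `L²(μ)`. -/
def IsHaarShift (h : HaarSystem D μ) (r s : ℕ) (T : Lp ℝ 2 μ →L[ℝ] Lp ℝ 2 μ) : Prop :=
  ∃ α : Triple D r s → Fin (2 ^ n - 1) → Fin (2 ^ n - 1) → ℝ, ∀ f : Lp ℝ 2 μ,
    HasSum (fun p : Triple D r s × Fin (2 ^ n - 1) × Fin (2 ^ n - 1) =>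
      (α p.1 p.2.1 p.2.2 * inner ℝ (h.vec p.1.1.2.1 p.2.1) f) • h.vec p.1.1.2.2 p.2.2) (T f)

end HaarSystem

/-!
Everything is expressed through Haar coefficients. A Haar shift acts on sequences of coefficients
by a matrix that is locally finite: the entry at `(S, R)` vanishes unless `R` and `S` have a common
ancestor `r` and `s` generations above them. So the action makes sense for every sequence.

The `H¹` norm is the `L¹` norm of the square function of the coefficients. For a balanced measure,
`BMO(μ)` corresponds to the coefficients `b` with `|b_Q^j| ≲ ‖h_Q^j‖₁` and
`∑_{R ⊆ Q} |b_R|² ≲ μ(Q)`; one direction is the John–Nirenberg inequality, in its `L²` form.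
Below the first `s` generations under `Q` the action is local, and there the second condition
follows from the boundedness on `L²`; on these generations it follows from the first condition,
which the action preserves because balance makes the masses `‖h_R^i‖₁` and `‖h_S^j‖₁` comparable.
This gives the bound on `BMO(μ)`. The bound on `H¹(μ)` follows by duality from the one for the
adjoint shift: Fefferman's inequality bounds the pairing of the two kinds of sequences, and
normalizing the blocks of a finite Haar sum by its square function gives a sequence that attains
its `H¹` norm.

It remains to return from coefficients to functions. A sequence of finite Hardy norm is summed in
`L¹(μ)` by Davis' inequality, and the quadrants having infinite measure, a function in `L¹ + L²`
is determined by its coefficients. In `BMO(μ)` the functions with given coefficients under each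
cube are unique up to constants, and are glued along the quadrants.
-/

namespace DyadicSystem

open Filter Topology

variable {n : ℕ}

section Geometry

variable (D : DyadicSystem n)

theorem mem_cell (k : ℤ) (x : Fin n → ℝ) : x ∈ D.cell k x := by
  obtain ⟨Q, ⟨hQ, hx⟩, -⟩ := D.partition k x
  rwa [D.cell_eq hQ hx]

theorem cell_eq_of_mem {k : ℤ} {x y : Fin n → ℝ} (h : y ∈ D.cell k x) :
    D.cell k y = D.cell k x :=
  D.cell_eq (D.cell_mem k x) h

theorem measurableSet_cell (k : ℤ) (x : Fin n → ℝ) : MeasurableSet (D.cell k x) :=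
  D.measurableSet_of_gen (D.cell_mem k x)

theorem cell_mem_cubes (k : ℤ) (x : Fin n → ℝ) : D.cell k x ∈ D.cubes :=
  ⟨k, D.cell_mem k x⟩

theorem nonempty_of_gen {k : ℤ} {Q : Set (Fin n → ℝ)} (hQ : Q ∈ D.gen k) : Q.Nonempty := by
  obtain ⟨a, rfl⟩ := D.isCube k Q hQ
  have side_pos : (0 : ℝ) < 2 ^ (-k) := by positivity
  exact ⟨a, fun i _ => ⟨le_rfl, by linarith⟩⟩

theorem pairwiseDisjoint_gen (k : ℤ) : (D.gen k).PairwiseDisjoint id := fun _ hQ _ hR hne =>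
  Set.disjoint_left.2 fun x hx hx' => hne ((D.partition k x).unique ⟨hQ, hx⟩ ⟨hR, hx'⟩)

theorem dist_le_of_mem_cell {k : ℤ} {x y : Fin n → ℝ} (h : y ∈ D.cell k x) :
    dist y x ≤ 2 ^ (-k) := by
  have hx := D.mem_cell k x
  obtain ⟨a, ha⟩ := D.isCube k _ (D.cell_mem k x)
  rw [ha] at h hx
  rw [dist_pi_le_iff (by positivity)]
  intro i
  obtain ⟨hy₁, hy₂⟩ := h i trivial
  obtain ⟨hx₁, hx₂⟩ := hx i trivial
  rw [Real.dist_eq, abs_le]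
  constructor <;> linarith

theorem volume_of_gen {k : ℤ} {Q : Set (Fin n → ℝ)} (hQ : Q ∈ D.gen k) :
    volume Q = ENNReal.ofReal (2 ^ (-k)) ^ n := by
  obtain ⟨a, rfl⟩ := D.isCube k Q hQ
  rw [volume_pi_pi]
  simp

theorem volume_eq_mul_of_mem_desc {r : ℕ} {Q R : Set (Fin n → ℝ)} (hR : R ∈ D.desc r Q) :
    volume Q = (2 ^ (n * r) : ℕ) * volume R := by
  obtain ⟨k, hQ, hR, -⟩ := hR
  have side_eq : (2 : ℝ) ^ (-k) = 2 ^ r * 2 ^ (-(k + r)) := by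
    rw [← zpow_natCast, ← zpow_add₀ two_ne_zero]
    congr 1
    ring
  rw [D.volume_of_gen hQ, D.volume_of_gen hR, side_eq, ENNReal.ofReal_mul (by positivity),
    mul_pow, ENNReal.ofReal_pow zero_le_two, ← pow_mul, mul_comm r n]
  norm_num

theorem volume_ne_zero_of_gen {k : ℤ} {Q : Set (Fin n → ℝ)} (hQ : Q ∈ D.gen k) :
    volume Q ≠ 0 := by
  rw [D.volume_of_gen hQ]
  exact pow_ne_zero n (ENNReal.ofReal_pos.2 (by positivity)).ne'

theorem volume_ne_top_of_gen {k : ℤ} {Q : Set (Fin n → ℝ)} (hQ : Q ∈ D.gen k) :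
    volume Q ≠ ∞ := by
  rw [D.volume_of_gen hQ]
  exact ENNReal.pow_ne_top ENNReal.ofReal_ne_top

theorem countable_cubes : D.cubes.Countable := by
  have cubes_eq : D.cubes = ⋃ k, D.gen k := by
    ext Q
    simp [cubes]
  rw [cubes_eq]
  exact countable_iUnion D.countable_gen

instance : Countable D.cubes := D.countable_cubes.to_subtype

/-- The generation of a cube: the cubes of generation `k` have side length `2 ^ (-k)`. -/
noncomputable def level (Q : D.cubes) : ℤ := Q.2.choose

theorem mem_gen_level (Q : D.cubes) : Q.1 ∈ D.gen (D.level Q) :=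
  Q.2.choose_spec

/-- The cube of generation `k` that contains `x`, as an element of the type of cubes. -/
def cellCube (k : ℤ) (x : Fin n → ℝ) : D.cubes :=
  ⟨D.cell k x, D.cell_mem_cubes k x⟩

theorem cellCube_eq_of_mem {k : ℤ} {x y : Fin n → ℝ} (h : y ∈ D.cell k x) :
    D.cellCube k y = D.cellCube k x :=
  Subtype.ext (D.cell_eq_of_mem h)

theorem cellCube_level {Q : D.cubes} {x : Fin n → ℝ} (hx : x ∈ Q.1) :
    D.cellCube (D.level Q) x = Q :=
  Subtype.ext (D.cell_eq (D.mem_gen_level Q) hx)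

theorem measurableSet_of_mem_desc {r : ℕ} {Q R : Set (Fin n → ℝ)} (hR : R ∈ D.desc r Q) :
    MeasurableSet R := by
  obtain ⟨k, -, hR, -⟩ := hR
  exact D.measurableSet_of_gen hR

theorem countable_desc (r : ℕ) (Q : Set (Fin n → ℝ)) : (D.desc r Q).Countable := by
  refine D.countable_cubes.mono ?_
  rintro R ⟨k, -, hR, -⟩
  exact ⟨_, hR⟩

variable [NeZero n]

theorem le_of_gen_subset {k l : ℤ} {Q R : Set (Fin n → ℝ)}
    (hQ : Q ∈ D.gen k) (hR : R ∈ D.gen l) (h : R ⊆ Q) : k ≤ l := by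
  have volume_le := measure_mono (μ := volume) h
  rw [D.volume_of_gen hQ, D.volume_of_gen hR, ENNReal.pow_le_pow_left_iff (NeZero.ne n),
    ENNReal.ofReal_le_ofReal_iff (by positivity),
    zpow_le_zpow_iff_right₀ (one_lt_two : (1 : ℝ) < 2)] at volume_le
  exact neg_le_neg_iff.1 volume_le

theorem gen_unique {k l : ℤ} {Q : Set (Fin n → ℝ)} (hk : Q ∈ D.gen k) (hl : Q ∈ D.gen l) :
    k = l :=
  le_antisymm (D.le_of_gen_subset hk hl subset_rfl) (D.le_of_gen_subset hl hk subset_rfl)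

theorem cell_subset {k l : ℤ} (hkl : k ≤ l) (x : Fin n → ℝ) : D.cell l x ⊆ D.cell k x := by
  rcases D.nested l k _ (D.cell_mem l x) _ (D.cell_mem k x) with h | h | h
  · exact absurd (D.mem_cell k x) (Set.disjoint_left.1 h (D.mem_cell l x))
  · exact h
  · obtain rfl := le_antisymm hkl (D.le_of_gen_subset (D.cell_mem l x) (D.cell_mem k x) h)
    exact subset_rfl

theorem cell_eq_of_le {k l : ℤ} (hkl : k ≤ l) {x y : Fin n → ℝ} (h : D.cell l x = D.cell l y) :
    D.cell k x = D.cell k y :=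
  D.cell_eq_of_mem (D.cell_subset hkl y (h ▸ D.mem_cell l x))

theorem cell_subset_of_mem_gen {k l : ℤ} (hkl : k ≤ l) {Q : Set (Fin n → ℝ)} (hQ : Q ∈ D.gen k)
    {x : Fin n → ℝ} (hx : x ∈ Q) : D.cell l x ⊆ Q :=
  D.cell_eq hQ hx ▸ D.cell_subset hkl x

theorem subset_or_disjoint {k l : ℤ} (hkl : k ≤ l) {Q R : Set (Fin n → ℝ)} (hQ : Q ∈ D.gen k)
    (hR : R ∈ D.gen l) : R ⊆ Q ∨ Disjoint R Q := by
  by_cases h : Disjoint R Q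
  · exact Or.inr h
  · obtain ⟨x, hxR, hxQ⟩ := Set.not_disjoint_iff.1 h
    rw [← D.cell_eq hR hxR]
    exact Or.inl (D.cell_subset_of_mem_gen hkl hQ hxQ)

theorem level_eq {Q : D.cubes} {k : ℤ} (h : Q.1 ∈ D.gen k) : D.level Q = k :=
  D.gen_unique (D.mem_gen_level Q) h

theorem level_cellCube (k : ℤ) (x : Fin n → ℝ) : D.level (D.cellCube k x) = k :=
  D.level_eq (D.cell_mem k x)

theorem cellCube_injective (x : Fin n → ℝ) : Function.Injective fun k => D.cellCube k x :=
  Function.LeftInverse.injective (g := D.level) fun k => D.level_cellCube k x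

theorem mem_desc_iff {k : ℤ} {r : ℕ} {Q R : Set (Fin n → ℝ)} (hQ : Q ∈ D.gen k) :
    R ∈ D.desc r Q ↔ R ∈ D.gen (k + r) ∧ R ⊆ Q := by
  refine ⟨?_, fun h => ⟨k, hQ, h⟩⟩
  rintro ⟨l, hl, h⟩
  obtain rfl := D.gen_unique hQ hl
  exact h

theorem cell_mem_desc (k : ℤ) (r : ℕ) (x : Fin n → ℝ) :
    D.cell (k + r) x ∈ D.desc r (D.cell k x) :=
  ⟨k, D.cell_mem k x, D.cell_mem _ x, D.cell_subset (by omega) x⟩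

theorem biUnion_desc {k : ℤ} {Q : Set (Fin n → ℝ)} (hQ : Q ∈ D.gen k) (r : ℕ) :
    ⋃ R ∈ D.desc r Q, R = Q := by
  refine Set.Subset.antisymm (iUnion₂_subset fun R hR => ((D.mem_desc_iff hQ).1 hR).2) ?_
  intro x hx
  refine mem_biUnion ?_ (D.mem_cell (k + r) x)
  have h := D.cell_mem_desc k r x
  rwa [D.cell_eq hQ hx] at h

theorem pairwiseDisjoint_desc (r : ℕ) (Q : Set (Fin n → ℝ)) :
    (D.desc r Q).PairwiseDisjoint id := by
  rintro R ⟨k, hQ, hR, -⟩ S hS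
  exact D.pairwiseDisjoint_gen _ hR ((D.mem_desc_iff hQ).1 hS).1

theorem encard_desc_le (r : ℕ) (Q : Set (Fin n → ℝ)) :
    (D.desc r Q).encard ≤ (2 ^ (n * r) : ℕ) := by
  rcases (D.desc r Q).eq_empty_or_nonempty with hempty | ⟨R₀, hR₀⟩
  · simp [hempty]
  obtain ⟨k, hQ, hR₀k, -⟩ := id hR₀
  have volume_eq : ∀ R : D.desc r Q, volume R.1 = volume R₀ := fun R => by
    rw [D.volume_of_gen ((D.mem_desc_iff hQ).1 R.2).1, D.volume_of_gen hR₀k]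
  have sum_volume_eq : (D.desc r Q).encard * volume R₀ = (2 ^ (n * r) : ℕ) * volume R₀ :=
    calc (D.desc r Q).encard * volume R₀ = ∑' R : D.desc r Q, volume R.1 := by
          simp only [volume_eq, ENNReal.tsum_set_const]
      _ = volume Q := by
          rw [← congrArg volume (D.biUnion_desc hQ r)]
          exact (measure_biUnion (D.countable_desc r Q) (D.pairwiseDisjoint_desc r Q)
            fun R => D.measurableSet_of_mem_desc).symm
      _ = (2 ^ (n * r) : ℕ) * volume R₀ := D.volume_eq_mul_of_mem_desc hR₀
  have h := (ENNReal.mul_le_mul_iff_left (D.volume_ne_zero_of_gen hR₀k)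
    (D.volume_ne_top_of_gen hR₀k)).1 sum_volume_eq.le
  exact_mod_cast h

theorem finite_desc (r : ℕ) (Q : Set (Fin n → ℝ)) : (D.desc r Q).Finite :=
  Set.finite_of_encard_le_coe (D.encard_desc_le r Q)

end Geometry

/-- `θ` is constant on the cubes of generation `k`: it is measurable with respect to the
`σ`-algebra generated by `D.gen k`. -/
def Adapted (D : DyadicSystem n) {β : Type*} (k : ℤ) (θ : (Fin n → ℝ) → β) : Prop :=
  ∀ x y, y ∈ D.cell k x → θ y = θ x

/-- Every dyadic cube has positive and finite mass, so that averages over cubes are not junk. -/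
class PosFinite (D : DyadicSystem n) (μ : Measure (Fin n → ℝ)) : Prop where
  measure_pos : ∀ Q ∈ D.cubes, 0 < μ Q
  measure_lt_top : ∀ Q ∈ D.cubes, μ Q < ∞

section Expectation

variable {D : DyadicSystem n} {μ : Measure (Fin n → ℝ)}

variable (D) in
theorem measure_pos_of_gen [D.PosFinite μ] {k : ℤ} {Q : Set (Fin n → ℝ)} (hQ : Q ∈ D.gen k) :
    0 < μ Q :=
  PosFinite.measure_pos Q ⟨k, hQ⟩

variable (D) in
theorem measure_lt_top_of_gen [D.PosFinite μ] {k : ℤ} {Q : Set (Fin n → ℝ)} (hQ : Q ∈ D.gen k) :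
    μ Q < ∞ :=
  PosFinite.measure_lt_top Q ⟨k, hQ⟩

namespace Adapted

theorem measurable {β : Type*} [MeasurableSpace β] {k : ℤ} {θ : (Fin n → ℝ) → β}
    (h : D.Adapted k θ) : Measurable θ := by
  have factors : Function.FactorsThrough θ (D.cell k) := fun x y hxy =>
    h y x (hxy ▸ D.mem_cell k x)
  convert D.measurable_comp_cell k (Function.extend (D.cell k) θ fun _ => θ 0) using 1
  funext x
  exact (factors.extend_apply _ x).symm

theorem mono {β : Type*} [NeZero n] {k l : ℤ} (hkl : k ≤ l) {θ : (Fin n → ℝ) → β}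
    (h : D.Adapted k θ) : D.Adapted l θ :=
  fun x y hy => h x y (D.cell_subset hkl x hy)

theorem comp {β γ : Type*} {k : ℤ} {θ : (Fin n → ℝ) → β} (h : D.Adapted k θ) (g : β → γ) :
    D.Adapted k fun x => g (θ x) :=
  fun x y hy => congrArg g (h x y hy)

theorem finite_image {β : Type*} [NeZero n] {k l : ℤ} {θ : (Fin n → ℝ) → β} (h : D.Adapted k θ)
    {Q : Set (Fin n → ℝ)} (hQ : Q ∈ D.gen l) : (θ '' Q).Finite := by
  rw [← D.biUnion_desc hQ (k - l).toNat, image_iUnion₂]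
  refine (D.finite_desc _ Q).biUnion fun R hR => Set.Subsingleton.finite ?_
  rintro _ ⟨x, hx, rfl⟩ _ ⟨y, hy, rfl⟩
  have hRgen := ((D.mem_desc_iff hQ).1 hR).1
  exact h.mono (by omega) y x (D.cell_eq hRgen hy ▸ hx)

theorem exists_norm_le [NeZero n] {k l : ℤ} {θ : (Fin n → ℝ) → ℝ} (h : D.Adapted k θ)
    {Q : Set (Fin n → ℝ)} (hQ : Q ∈ D.gen l) : ∃ C, ∀ x ∈ Q, ‖θ x‖ ≤ C := by
  obtain ⟨C, hC⟩ := (h.finite_image hQ).isBounded.exists_norm_le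
  exact ⟨C, fun x hx => hC _ ⟨x, hx, rfl⟩⟩

theorem integrableOn_mul [NeZero n] {k l : ℤ} {θ : (Fin n → ℝ) → ℝ} (h : D.Adapted k θ)
    {Q : Set (Fin n → ℝ)} (hQ : Q ∈ D.gen l) {f : (Fin n → ℝ) → ℝ} (hf : IntegrableOn f Q μ) :
    IntegrableOn (fun x => θ x * f x) Q μ := by
  obtain ⟨C, hC⟩ := h.exists_norm_le hQ
  exact Integrable.bdd_mul (c := C) hf h.measurable.aestronglyMeasurable
    ((ae_restrict_iff' (D.measurableSet_of_gen hQ)).2 (Eventually.of_forall hC))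

theorem integrableOn [NeZero n] [D.PosFinite μ] {k l : ℤ} {θ : (Fin n → ℝ) → ℝ}
    (h : D.Adapted k θ) {Q : Set (Fin n → ℝ)} (hQ : Q ∈ D.gen l) : IntegrableOn θ Q μ := by
  simpa using h.integrableOn_mul hQ (f := fun _ => 1) (μ := μ)
    (integrableOn_const (D.measure_lt_top_of_gen hQ).ne)

end Adapted

variable (D)

theorem adapted_expect (μ : Measure (Fin n → ℝ)) (k : ℤ) (f : (Fin n → ℝ) → ℝ) :
    D.Adapted k (D.expect μ k f) := fun x y hy => by
  rw [expect, expect, D.cell_eq_of_mem hy]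

theorem expect_eq_of_mem (μ : Measure (Fin n → ℝ)) {k : ℤ} {Q : Set (Fin n → ℝ)}
    (hQ : Q ∈ D.gen k) (f : (Fin n → ℝ) → ℝ) {x : Fin n → ℝ} (hx : x ∈ Q) :
    D.expect μ k f x = ⨍ y in Q, f y ∂μ := by
  rw [expect, D.cell_eq hQ hx]

theorem expect_adapted_mul (μ : Measure (Fin n → ℝ)) {k : ℤ} {θ : (Fin n → ℝ) → ℝ}
    (h : D.Adapted k θ) (f : (Fin n → ℝ) → ℝ) (x : Fin n → ℝ) :
    D.expect μ k (fun y => θ y * f y) x = θ x * D.expect μ k f x := by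
  have integral_eq : ∫ y in D.cell k x, θ y * f y ∂μ = ∫ y in D.cell k x, θ x * f y ∂μ :=
    setIntegral_congr_fun (D.measurableSet_cell k x) fun y hy => by simp only [h x y hy]
  simp only [expect, setAverage_eq, smul_eq_mul]
  rw [integral_eq, integral_const_mul]
  ring

theorem expect_of_adapted [D.PosFinite μ] {k : ℤ} {θ : (Fin n → ℝ) → ℝ} (h : D.Adapted k θ)
    (x : Fin n → ℝ) : D.expect μ k θ x = θ x := by
  have expect_one : D.expect μ k (fun _ => 1) x = 1 :=
    setAverage_const (D.measure_pos_of_gen (D.cell_mem k x)).ne'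
      (D.measure_lt_top_of_gen (D.cell_mem k x)).ne 1
  simpa [expect_one] using D.expect_adapted_mul μ h (fun _ => 1) x

theorem setIntegral_eq_expect_mul [D.PosFinite μ] (k : ℤ) (f : (Fin n → ℝ) → ℝ)
    (x : Fin n → ℝ) : ∫ y in D.cell k x, f y ∂μ = D.expect μ k f x * μ.real (D.cell k x) := by
  have measure_ne_zero : μ.real (D.cell k x) ≠ 0 :=
    (ENNReal.toReal_pos (D.measure_pos_of_gen (D.cell_mem k x)).ne'
      (D.measure_lt_top_of_gen (D.cell_mem k x)).ne).ne'
  rw [expect, setAverage_eq, smul_eq_mul]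
  field_simp

theorem setIntegral_congr_of_gen [NeZero n] {k l : ℤ} (hlk : l ≤ k) {Q : Set (Fin n → ℝ)}
    (hQ : Q ∈ D.gen l) {f g : (Fin n → ℝ) → ℝ} (hf : IntegrableOn f Q μ)
    (hg : IntegrableOn g Q μ) (h : ∀ R ∈ D.gen k, R ⊆ Q → ∫ x in R, f x ∂μ = ∫ x in R, g x ∂μ) :
    ∫ x in Q, f x ∂μ = ∫ x in Q, g x ∂μ := by
  obtain ⟨r, rfl⟩ : ∃ r : ℕ, k = l + r := ⟨(k - l).toNat, by omega⟩
  have : Countable (D.desc r Q) := (D.countable_desc r Q).to_subtype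
  have measurable_desc : ∀ R : D.desc r Q, MeasurableSet R.1 := fun R =>
    D.measurableSet_of_mem_desc R.2
  have disjoint_desc : Pairwise (Function.onFun Disjoint fun R : D.desc r Q => R.1) :=
    (D.pairwiseDisjoint_desc r Q).subtype _ _
  rw [← D.biUnion_desc hQ r, biUnion_eq_iUnion] at hf hg ⊢
  rw [integral_iUnion measurable_desc disjoint_desc hf,
    integral_iUnion measurable_desc disjoint_desc hg]
  exact tsum_congr fun R => (and_imp.2 (h R)) ((D.mem_desc_iff hQ).1 R.2)

theorem setIntegral_expect [NeZero n] [D.PosFinite μ] {k l : ℤ} (hlk : l ≤ k)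
    {Q : Set (Fin n → ℝ)} (hQ : Q ∈ D.gen l) {f : (Fin n → ℝ) → ℝ} (hf : IntegrableOn f Q μ) :
    ∫ x in Q, D.expect μ k f x ∂μ = ∫ x in Q, f x ∂μ := by
  refine D.setIntegral_congr_of_gen hlk hQ ((D.adapted_expect μ k f).integrableOn hQ) hf
    fun R hR _ => ?_
  obtain ⟨x, hx⟩ := D.nonempty_of_gen hR
  rw [← D.cell_eq hR hx, D.setIntegral_eq_expect_mul, D.setIntegral_eq_expect_mul,
    D.expect_of_adapted (D.adapted_expect μ k f)]

end Expectation

section LebesgueDifferentiation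

variable (D : DyadicSystem n)

theorem exists_cell_subset_of_isOpen (k : ℤ) {U : Set (Fin n → ℝ)} (hU : IsOpen U)
    {x : Fin n → ℝ} (hx : x ∈ U) : ∃ m : ℕ, D.cell (k + m) x ⊆ U := by
  obtain ⟨ε, hε, ball_subset⟩ := Metric.isOpen_iff.1 hU x hx
  have side_tendsto : Tendsto (fun m : ℕ => (2 : ℝ) ^ (-k) * (1 / 2) ^ m) atTop (𝓝 0) := by
    simpa using (tendsto_pow_atTop_nhds_zero_of_lt_one (r := (1 / 2 : ℝ))
      (by norm_num) (by norm_num)).const_mul ((2 : ℝ) ^ (-k))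
  obtain ⟨m, hm⟩ := (side_tendsto.eventually (gt_mem_nhds hε)).exists
  refine ⟨m, fun y hy => ball_subset ((D.dist_le_of_mem_cell hy).trans_lt (lt_of_eq_of_lt ?_ hm))⟩
  rw [neg_add, zpow_add₀ two_ne_zero, zpow_neg _ (m : ℤ), zpow_natCast, one_div, inv_pow]

variable [NeZero n]

/-- The filtration of the `σ`-algebras generated by the cubes of generation `k + m`, `m ∈ ℕ`. -/
noncomputable def filtration (k : ℤ) :
    Filtration ℕ (MeasurableSpace.pi : MeasurableSpace (Fin n → ℝ)) where
  seq m := MeasurableSpace.comap (D.cell (k + m)) ⊤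
  mono' := by
    rintro i j hij _ ⟨s, -, rfl⟩
    refine ⟨{R | ∃ x ∈ D.cell (k + i) ⁻¹' s, R = D.cell (k + j) x}, trivial, ?_⟩
    ext y
    refine ⟨?_, fun hy => ⟨y, hy, rfl⟩⟩
    rintro ⟨x, hx, hxy⟩
    rwa [mem_preimage, D.cell_eq_of_le (by omega : k + (i : ℤ) ≤ k + j) hxy]
  le' := by
    rintro i _ ⟨s, -, rfl⟩
    exact @measurable_comp_cell n D _ ⊤ (k + i) (fun Q => Q) s trivial

theorem iSup_filtration (k : ℤ) :
    ⨆ m, (D.filtration k m : MeasurableSpace (Fin n → ℝ)) = MeasurableSpace.pi := by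
  refine le_antisymm (iSup_le (D.filtration k).le) ?_
  refine (BorelSpace.measurable_eq (α := Fin n → ℝ)).le.trans
    (MeasurableSpace.generateFrom_le fun U (hU : IsOpen U) => ?_)
  have eq_iUnion : U = ⋃ m : ℕ, {x | D.cell (k + m) x ⊆ U} := by
    ext x
    rw [mem_iUnion]
    exact ⟨D.exists_cell_subset_of_isOpen k hU, fun ⟨m, hm⟩ => hm (D.mem_cell _ x)⟩
  rw [eq_iUnion]
  refine MeasurableSet.iUnion fun m => ?_
  have measurable_m : MeasurableSet[D.filtration k m] {x | D.cell (k + m) x ⊆ U} :=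
    ⟨{R | R ⊆ U}, trivial, rfl⟩
  exact le_iSup (fun m => (D.filtration k m : MeasurableSpace (Fin n → ℝ))) m _ measurable_m

theorem expect_ae_eq_condExp {μ : Measure (Fin n → ℝ)} [D.PosFinite μ] {k : ℤ}
    {Q : Set (Fin n → ℝ)} (hQ : Q ∈ D.gen k) {f : (Fin n → ℝ) → ℝ} (hf : IntegrableOn f Q μ)
    (m : ℕ) : D.expect μ (k + m) f =ᵐ[μ.restrict Q] (μ.restrict Q)[f | D.filtration k m] := by
  have : IsFiniteMeasure (μ.restrict Q) := ⟨by simpa using D.measure_lt_top_of_gen hQ⟩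
  have integrable_expect : IntegrableOn (D.expect μ (k + m) f) Q μ :=
    (D.adapted_expect μ _ f).integrableOn hQ
  refine ae_eq_condExp_of_forall_setIntegral_eq ((D.filtration k).le m) hf
    (fun s _ _ => Integrable.integrableOn integrable_expect) ?_ ?_
  · rintro A hA -
    have measurableSet_A : MeasurableSet A := (D.filtration k).le m _ hA
    obtain ⟨s, -, rfl⟩ := hA
    set A := D.cell (k + m) ⁻¹' s
    have adapted_A : D.Adapted (k + m) (A.indicator fun _ => (1 : ℝ)) := by
      intro x y hy
      have mem_iff : y ∈ A ↔ x ∈ A := by simp only [A, mem_preimage, D.cell_eq_of_mem hy]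
      by_cases hx : x ∈ A <;> simp [hx, mem_iff]
    have setIntegral_A (g : (Fin n → ℝ) → ℝ) : ∫ x in A, g x ∂(μ.restrict Q) =
        ∫ x in Q, A.indicator (fun _ => (1 : ℝ)) x * g x ∂μ := by
      simp only [← integral_indicator measurableSet_A, ← indicator_mul_left, one_mul]
    rw [setIntegral_A, setIntegral_A, ← D.setIntegral_expect (by omega : k ≤ k + m) hQ
      (adapted_A.integrableOn_mul hQ hf)]
    simp only [D.expect_adapted_mul μ adapted_A]
  · have measurable_cell : Measurable[D.filtration k m, ⊤] (D.cell (k + m)) :=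
      fun s hs => ⟨s, hs, rfl⟩
    exact ((measurable_from_top (f := fun R => ⨍ y in R, f y ∂μ)).comp
      measurable_cell).stronglyMeasurable.aestronglyMeasurable

theorem ae_tendsto_expect {μ : Measure (Fin n → ℝ)} [D.PosFinite μ] {k : ℤ}
    {Q : Set (Fin n → ℝ)} (hQ : Q ∈ D.gen k) {f : (Fin n → ℝ) → ℝ} (hf : IntegrableOn f Q μ) :
    ∀ᵐ x ∂μ.restrict Q, Tendsto (fun m : ℕ => D.expect μ (k + m) f x) atTop (𝓝 (f x)) := by
  have : IsFiniteMeasure (μ.restrict Q) := ⟨by simpa using D.measure_lt_top_of_gen hQ⟩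
  have condExp_limit : (μ.restrict Q)[f | ⨆ m, D.filtration k m] =ᵐ[μ.restrict Q] f := by
    rw [D.iSup_filtration k]
    exact condExp_of_aestronglyMeasurable' le_rfl hf.aestronglyMeasurable hf
  filter_upwards [tendsto_ae_condExp f, condExp_limit,
    ae_all_iff.2 (D.expect_ae_eq_condExp hQ hf)] with x hlim hlimit hexpect
  rw [hlimit] at hlim
  exact hlim.congr fun m => (hexpect m).symm

end LebesgueDifferentiation

end DyadicSystem

/-- The indices `(Q, j)` of the functions of a Haar system. -/
abbrev DyadicSystem.HaarIndex {n : ℕ} (D : DyadicSystem n) : Type :=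
  D.cubes × Fin (2 ^ n - 1)

/-- The indices of the Haar functions attached to the cubes contained in `Q`. -/
def DyadicSystem.below {n : ℕ} (D : DyadicSystem n) (Q : Set (Fin n → ℝ)) : Set D.HaarIndex :=
  {p | p.1.1 ⊆ Q}

namespace HaarSystem

variable {n : ℕ} {D : DyadicSystem n} {μ : Measure (Fin n → ℝ)}

/-- The Haar function with index `p = (Q, j)`. -/
def haar (h : HaarSystem D μ) (p : D.HaarIndex) : (Fin n → ℝ) → ℝ :=
  h.fn p.1 p.2

/-- The Haar coefficient of `f`, with the junk value `0` if `f` is not integrable on the cube. -/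
noncomputable def coef (h : HaarSystem D μ) (f : (Fin n → ℝ) → ℝ) (p : D.HaarIndex) : ℝ :=
  ∫ x, f x * h.haar p x ∂μ

section Haar

variable (h : HaarSystem D μ)

theorem haar_eq_zero {p : D.HaarIndex} {x : Fin n → ℝ} (hx : x ∉ p.1.1) : h.haar p x = 0 :=
  Function.notMem_support.1 fun hx' => hx (h.support_subset p.1 p.2 hx')

theorem support_mul_haar_subset (f : (Fin n → ℝ) → ℝ) (p : D.HaarIndex) :
    Function.support (fun x => f x * h.haar p x) ⊆ p.1.1 :=
  (Function.support_mul_subset_right _ _).trans (h.support_subset p.1 p.2)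

theorem coef_eq_setIntegral (f : (Fin n → ℝ) → ℝ) (p : D.HaarIndex) :
    h.coef f p = ∫ x in p.1.1, f x * h.haar p x ∂μ :=
  (setIntegral_eq_integral_of_forall_compl_eq_zero fun _ hx => by
    rw [h.haar_eq_zero hx, mul_zero]).symm

theorem coef_smul (c : ℝ) (f : (Fin n → ℝ) → ℝ) (p : D.HaarIndex) :
    h.coef (c • f) p = c * h.coef f p := by
  simp only [coef, Pi.smul_apply, smul_eq_mul, mul_assoc]
  exact integral_const_mul _ _

theorem coef_const (c : ℝ) (p : D.HaarIndex) : h.coef (fun _ => c) p = 0 := by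
  rw [coef, integral_const_mul, show ∫ x, h.haar p x ∂μ = 0 from h.integral_eq_zero p.1 p.2,
    mul_zero]

theorem coef_congr_restrict {f g : (Fin n → ℝ) → ℝ} {p : D.HaarIndex}
    (hfg : f =ᵐ[μ.restrict p.1.1] g) : h.coef f p = h.coef g p := by
  rw [h.coef_eq_setIntegral, h.coef_eq_setIntegral]
  exact integral_congr_ae (hfg.mono fun x hx => congrArg (· * h.haar p x) hx)

theorem coef_congr {f g : (Fin n → ℝ) → ℝ} (hfg : f =ᵐ[μ] g) : h.coef f = h.coef g :=
  funext fun _ => h.coef_congr_restrict (ae_restrict_of_ae hfg)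

theorem inner_vec (p : D.HaarIndex) (F : Lp ℝ 2 μ) :
    inner ℝ (h.vec p.1 p.2) F = h.coef F p := by
  rw [L2.inner_def, coef]
  refine integral_congr_ae ?_
  filter_upwards [(h.memLp p.1 p.2).coeFn_toLp] with x hx
  rw [vec, hx]
  simp [haar]

/-- The Haar system as a Hilbert basis. -/
noncomputable def basis : HilbertBasis D.HaarIndex ℝ (Lp ℝ 2 μ) :=
  HilbertBasis.mk h.orthonormal h.dense_span.ge

theorem basis_apply (p : D.HaarIndex) : h.basis p = h.vec p.1 p.2 := by
  simp [basis, vec]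

theorem ext_coef {F G : Lp ℝ 2 μ} (hFG : ∀ p, h.coef F p = h.coef G p) : F = G := by
  refine h.basis.repr.injective (lp.ext (funext fun p => ?_))
  rw [h.basis.repr_apply_apply, h.basis.repr_apply_apply, h.basis_apply, h.inner_vec,
    h.inner_vec, hFG]

theorem ae_eq_of_memLp_of_coef_eq {f g : (Fin n → ℝ) → ℝ} (hf : MemLp f 2 μ) (hg : MemLp g 2 μ)
    (hfg : ∀ p, h.coef f p = h.coef g p) : f =ᵐ[μ] g := by
  refine (hf.toLp_eq_toLp_iff hg).1 (h.ext_coef fun p => ?_)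
  rw [h.coef_congr hf.coeFn_toLp, h.coef_congr hg.coeFn_toLp, hfg]

theorem coef_haar [DecidableEq D.HaarIndex] (p q : D.HaarIndex) :
    h.coef (h.haar q) p = if p = q then 1 else 0 := by
  rw [← orthonormal_iff_ite.1 h.orthonormal p q]
  change _ = inner ℝ (h.vec p.1 p.2) _
  rw [h.inner_vec]
  exact congrFun (h.coef_congr (h.memLp q.1 q.2).coeFn_toLp.symm) p

theorem tsum_coef_sq {v : (Fin n → ℝ) → ℝ} (hv : MemLp v 2 μ) :
    ∑' p, ‖h.coef v p‖ₑ ^ 2 = ∫⁻ x, ‖v x‖ₑ ^ 2 ∂μ := by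
  have inner_eq : ∀ p, inner ℝ (hv.toLp v) (h.basis p) * inner ℝ (h.basis p) (hv.toLp v) =
      ‖h.coef v p‖ ^ 2 := fun p => by
    rw [real_inner_comm, h.basis_apply, h.inner_vec, h.coef_congr hv.coeFn_toLp, ← sq,
      Real.norm_eq_abs, sq_abs]
  have parseval : HasSum (fun p => ‖h.coef v p‖ ^ 2) (‖hv.toLp v‖ ^ 2) := by
    simpa only [inner_eq, real_inner_self_eq_norm_sq] using
      h.basis.hasSum_inner_mul_inner (hv.toLp v) (hv.toLp v)
  calc ∑' p, ‖h.coef v p‖ₑ ^ 2 = ENNReal.ofReal (‖hv.toLp v‖ ^ 2) := by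
        rw [← parseval.tsum_eq, ENNReal.ofReal_tsum_of_nonneg (fun p => by positivity)
          parseval.summable]
        exact tsum_congr fun p => by rw [ENNReal.ofReal_pow (norm_nonneg _), ofReal_norm]
    _ = eLpNorm v 2 μ ^ 2 := by
        rw [ENNReal.ofReal_pow (norm_nonneg _), Lp.norm_toLp,
          ENNReal.ofReal_toReal hv.eLpNorm_ne_top]
    _ = ∫⁻ x, ‖v x‖ₑ ^ 2 ∂μ := by
        simpa using eLpNorm_nnreal_pow_eq_lintegral (f := v) (μ := μ) (two_ne_zero' ℝ≥0)

variable [NeZero n]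

theorem adapted_haar (p : D.HaarIndex) : D.Adapted (D.level p.1 + 1) (h.haar p) := by
  intro x y hy
  have mem_iff : y ∈ p.1.1 ↔ x ∈ p.1.1 := by
    have cell_eq : D.cell (D.level p.1) y = D.cell (D.level p.1) x :=
      D.cell_eq_of_mem (D.cell_subset (by omega) x hy)
    refine ⟨fun hy => ?_, fun hx => ?_⟩
    · rw [← D.cell_eq (D.mem_gen_level p.1) hy, cell_eq]
      exact D.mem_cell _ x
    · rw [← D.cell_eq (D.mem_gen_level p.1) hx, ← cell_eq]
      exact D.mem_cell _ y
  by_cases hx : x ∈ p.1.1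
  · have cell_mem_desc := D.cell_mem_desc (D.level p.1) 1 x
    rw [D.cell_eq (D.mem_gen_level p.1) hx] at cell_mem_desc
    exact h.const_on_children p.1 p.2 _ cell_mem_desc y hy x (D.mem_cell _ x)
  · rw [h.haar_eq_zero hx, h.haar_eq_zero (mt mem_iff.1 hx)]

theorem exists_norm_haar_le (p : D.HaarIndex) : ∃ C, ∀ x, ‖h.haar p x‖ ≤ C := by
  obtain ⟨C, hC⟩ := (h.adapted_haar p).exists_norm_le (D.mem_gen_level p.1)
  refine ⟨max C 0, fun x => ?_⟩
  by_cases hx : x ∈ p.1.1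
  · exact (hC x hx).trans (le_max_left _ _)
  · rw [h.haar_eq_zero hx, norm_zero]
    exact le_max_right _ _

theorem integrable_mul_haar {f : (Fin n → ℝ) → ℝ} {p : D.HaarIndex}
    (hf : IntegrableOn f p.1.1 μ) : Integrable (fun x => f x * h.haar p x) μ := by
  rw [← integrableOn_iff_integrable_of_support_subset (h.support_mul_haar_subset f p)]
  simpa only [mul_comm] using (h.adapted_haar p).integrableOn_mul (D.mem_gen_level p.1) hf

theorem coef_add {f g : (Fin n → ℝ) → ℝ} {p : D.HaarIndex} (hf : IntegrableOn f p.1.1 μ)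
    (hg : IntegrableOn g p.1.1 μ) : h.coef (f + g) p = h.coef f p + h.coef g p := by
  simp only [coef, Pi.add_apply, add_mul]
  exact integral_add (h.integrable_mul_haar hf) (h.integrable_mul_haar hg)

theorem coef_sub {f g : (Fin n → ℝ) → ℝ} {p : D.HaarIndex} (hf : IntegrableOn f p.1.1 μ)
    (hg : IntegrableOn g p.1.1 μ) : h.coef (f - g) p = h.coef f p - h.coef g p := by
  simp only [coef, Pi.sub_apply, sub_mul]
  exact integral_sub (h.integrable_mul_haar hf) (h.integrable_mul_haar hg)

theorem coef_finsetSum {ι : Type*} (s : Finset ι) {f : ι → (Fin n → ℝ) → ℝ} {p : D.HaarIndex}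
    (hf : ∀ i ∈ s, IntegrableOn (f i) p.1.1 μ) :
    h.coef (fun x => ∑ i ∈ s, f i x) p = ∑ i ∈ s, h.coef (f i) p := by
  simp only [coef, Finset.sum_mul]
  exact integral_finsetSum s fun i hi => h.integrable_mul_haar (hf i hi)

theorem coef_indicator_of_not_subset {k : ℤ} {Q : Set (Fin n → ℝ)} (hQ : Q ∈ D.gen k)
    {g : (Fin n → ℝ) → ℝ} (hg : ∫ x in Q, g x ∂μ = 0) {p : D.HaarIndex} (hp : ¬p.1.1 ⊆ Q) :
    h.coef (Q.indicator g) p = 0 := by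
  simp only [coef, ← indicator_mul_left, integral_indicator (D.measurableSet_of_gen hQ)]
  rcases le_or_gt k (D.level p.1) with hk | hk
  · have disjoint := (D.subset_or_disjoint hk hQ (D.mem_gen_level p.1)).resolve_left hp
    refine setIntegral_eq_zero_of_forall_eq_zero fun x hx => ?_
    rw [h.haar_eq_zero (Set.disjoint_right.1 disjoint hx), mul_zero]
  · obtain ⟨x₀, hx₀⟩ := D.nonempty_of_gen hQ
    have haar_eq : ∀ x ∈ Q, h.haar p x = h.haar p x₀ := fun x hx =>
      (h.adapted_haar p).mono (Int.add_one_le_of_lt hk) x₀ x (by rwa [D.cell_eq hQ hx₀])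
    rw [setIntegral_congr_fun (D.measurableSet_of_gen hQ) fun x hx =>
      congrArg (g x * ·) (haar_eq x hx), integral_mul_const, hg, zero_mul]

variable [D.PosFinite μ]

theorem integrable_haar (p : D.HaarIndex) : Integrable (h.haar p) μ := by
  simpa using h.integrable_mul_haar (f := fun _ => 1) (p := p)
    (integrableOn_const (D.measure_lt_top_of_gen (D.mem_gen_level p.1)).ne)

theorem coef_sum_mul_haar [DecidableEq D.cubes] (Q : D.cubes) (a : Fin (2 ^ n - 1) → ℝ)
    (p : D.HaarIndex) :
    h.coef (fun x => ∑ j, a j * h.haar (Q, j) x) p = if p.1 = Q then a p.2 else 0 := by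
  have coef_term : ∀ j, h.coef (fun x => a j * h.haar (Q, j) x) p =
      if p.1 = Q ∧ p.2 = j then a j else 0 := fun j => by
    rw [show (fun x => a j * h.haar (Q, j) x) = a j • h.haar (Q, j) from rfl, coef_smul,
      coef_haar]
    simp [Prod.ext_iff]
  rw [h.coef_finsetSum _ fun j _ => ((h.integrable_haar _).const_mul _).integrableOn]
  simp only [coef_term, ite_and, Finset.sum_ite_irrel, Finset.sum_ite_eq, Finset.mem_univ,
    Finset.sum_const_zero, if_true]

theorem expect_haar (k : ℤ) (p : D.HaarIndex) (x : Fin n → ℝ) :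
    D.expect μ k (h.haar p) x = if D.level p.1 < k then h.haar p x else 0 := by
  split_ifs with hk
  · exact D.expect_of_adapted ((h.adapted_haar p).mono (by omega)) x
  have setIntegral_eq_zero : ∫ y in D.cell k x, h.haar p y ∂μ = 0 := by
    rcases D.subset_or_disjoint (not_lt.1 hk) (D.cell_mem k x) (D.mem_gen_level p.1) with
      hs | hs
    · rw [setIntegral_eq_integral_of_forall_compl_eq_zero fun y hy =>
        h.haar_eq_zero (notMem_subset hs hy)]
      exact h.integral_eq_zero p.1 p.2
    · exact setIntegral_eq_zero_of_forall_eq_zero fun y hy =>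
        h.haar_eq_zero (Set.disjoint_right.1 hs hy)
  rw [DyadicSystem.expect, setAverage_eq, setIntegral_eq_zero, smul_zero]

end Haar

end HaarSystem

namespace DyadicSystem

variable {n : ℕ} (D : DyadicSystem n) (μ : Measure (Fin n → ℝ))

/-- The kernel `1_Q / μ(Q)`, where `Q` is the cell of `x`, of the conditional expectation `E_k` at
the point `x`. -/
noncomputable def expectKernel (k : ℤ) (x : Fin n → ℝ) : (Fin n → ℝ) → ℝ :=
  (D.cell k x).indicator fun _ => (μ.real (D.cell k x))⁻¹

theorem expectKernel_mul (k : ℤ) (x : Fin n → ℝ) (f : (Fin n → ℝ) → ℝ) :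
    (fun y => D.expectKernel μ k x y * f y) =
      (D.cell k x).indicator fun y => (μ.real (D.cell k x))⁻¹ * f y := by
  funext y
  by_cases hy : y ∈ D.cell k x <;> simp [expectKernel, hy]

theorem integral_expectKernel_mul (k : ℤ) (x : Fin n → ℝ) (f : (Fin n → ℝ) → ℝ) :
    ∫ y, D.expectKernel μ k x y * f y ∂μ = D.expect μ k f x := by
  rw [expectKernel_mul, integral_indicator (D.measurableSet_cell k x), integral_const_mul, expect,
    setAverage_eq, smul_eq_mul]

variable {μ}

theorem integrable_expectKernel_mul {k : ℤ} {x : Fin n → ℝ} {f : (Fin n → ℝ) → ℝ}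
    (hf : IntegrableOn f (D.cell k x) μ) :
    Integrable (fun y => D.expectKernel μ k x y * f y) μ := by
  rw [expectKernel_mul, integrable_indicator_iff (D.measurableSet_cell k x)]
  exact hf.const_mul _

theorem memLp_expectKernel [D.PosFinite μ] (p : ℝ≥0∞) (k : ℤ) (x : Fin n → ℝ) :
    MemLp (D.expectKernel μ k x) p μ :=
  memLp_indicator_const p (D.measurableSet_cell k x) _
    (Or.inr (D.measure_lt_top_of_gen (D.cell_mem k x)).ne)

end DyadicSystem

namespace HaarSystem

variable {n : ℕ} [NeZero n] {D : DyadicSystem n} {μ : Measure (Fin n → ℝ)} [D.PosFinite μ]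
  (h : HaarSystem D μ)

theorem coef_expectKernel_sub [DecidableEq D.cubes] (k : ℤ) (x : Fin n → ℝ) (p : D.HaarIndex) :
    h.coef (D.expectKernel μ (k + 1) x - D.expectKernel μ k x) p =
      if p.1 = D.cellCube k x then h.haar p x else 0 := by
  have integrableOn_kernel : ∀ l, IntegrableOn (D.expectKernel μ l x) p.1.1 μ := fun l =>
    (memLp_one_iff_integrable.1 (D.memLp_expectKernel 1 l x)).integrableOn
  rw [h.coef_sub (integrableOn_kernel _) (integrableOn_kernel _)]
  simp only [coef, D.integral_expectKernel_mul, h.expect_haar]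
  by_cases hp : p.1 = D.cellCube k x
  · simp [hp, D.level_cellCube]
  rcases lt_trichotomy (D.level p.1) k with hk | hk | hk
  · simp [hp, hk, hk.trans (lt_add_one k)]
  · have haar_eq_zero : h.haar p x = 0 := h.haar_eq_zero fun hx => hp <| by
      rw [← hk, D.cellCube_level hx]
    simp [haar_eq_zero]
  · simp [hp, hk.not_gt, not_lt.2 (Int.add_one_le_of_lt hk)]

theorem expectKernel_sub_ae_eq (k : ℤ) (x : Fin n → ℝ) :
    D.expectKernel μ (k + 1) x - D.expectKernel μ k x =ᵐ[μ]
      fun y => ∑ j, h.haar (D.cellCube k x, j) x * h.haar (D.cellCube k x, j) y := by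
  classical
  refine h.ae_eq_of_memLp_of_coef_eq
    ((D.memLp_expectKernel 2 _ x).sub (D.memLp_expectKernel 2 k x))
    (memLp_finsetSum _ fun j _ => (h.memLp (D.cellCube k x) j).const_mul _) fun p => ?_
  rw [coef_expectKernel_sub, coef_sum_mul_haar]
  split_ifs with hp
  · rw [← hp]
  · rfl

theorem expect_add_one_sub_expect (k : ℤ) (x : Fin n → ℝ) {f : (Fin n → ℝ) → ℝ}
    (hf : IntegrableOn f (D.cell k x) μ) :
    D.expect μ (k + 1) f x - D.expect μ k f x =
      ∑ j, h.coef f (D.cellCube k x, j) * h.haar (D.cellCube k x, j) x := by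
  set Q := D.cellCube k x
  have hf_succ : IntegrableOn f (D.cell (k + 1) x) μ :=
    hf.mono_set (D.cell_subset (by omega) x)
  calc D.expect μ (k + 1) f x - D.expect μ k f x
    _ = ∫ y, (D.expectKernel μ (k + 1) x y * f y - D.expectKernel μ k x y * f y) ∂μ := by
        rw [integral_sub (D.integrable_expectKernel_mul hf_succ)
          (D.integrable_expectKernel_mul hf), D.integral_expectKernel_mul,
          D.integral_expectKernel_mul]
    _ = ∫ y, ∑ j, h.haar (Q, j) x * (f y * h.haar (Q, j) y) ∂μ := by
        refine integral_congr_ae ((h.expectKernel_sub_ae_eq k x).mono fun y hy => ?_)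
        simp only [Pi.sub_apply] at hy
        simp only [← sub_mul, hy, Finset.sum_mul]
        exact Finset.sum_congr rfl fun j _ => by ring
    _ = ∑ j, h.coef f (Q, j) * h.haar (Q, j) x := by
        rw [integral_finsetSum _ fun j _ =>
          (h.integrable_mul_haar (p := (Q, j)) hf).const_mul _]
        exact Finset.sum_congr rfl fun j _ => by rw [integral_const_mul, coef, mul_comm]

theorem ae_eq_setAverage_of_coef_eq_zero {k : ℤ} {Q : Set (Fin n → ℝ)} (hQ : Q ∈ D.gen k)
    {f : (Fin n → ℝ) → ℝ} (hf : IntegrableOn f Q μ) (h0 : ∀ p ∈ D.below Q, h.coef f p = 0) :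
    ∀ᵐ x ∂μ.restrict Q, f x = ⨍ y in Q, f y ∂μ := by
  have expect_eq : ∀ x ∈ Q, ∀ m : ℕ, D.expect μ (k + m) f x = ⨍ y in Q, f y ∂μ := by
    intro x hx m
    induction m with
    | zero => simpa using D.expect_eq_of_mem μ hQ f hx
    | succ m ih =>
      have cell_subset : D.cell (k + m) x ⊆ Q := D.cell_subset_of_mem_gen (by omega) hQ hx
      have expect_sub := h.expect_add_one_sub_expect (k + m) x (hf.mono_set cell_subset)
      rw [Finset.sum_eq_zero fun j _ => by
        rw [h0 (D.cellCube (k + m) x, j) cell_subset, zero_mul], sub_eq_zero] at expect_sub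
      push_cast
      rw [← add_assoc, expect_sub, ih]
  filter_upwards [D.ae_tendsto_expect hQ hf,
    ae_restrict_mem (D.measurableSet_of_gen hQ)] with x hx hxQ
  refine tendsto_nhds_unique hx ?_
  simp only [expect_eq x hxQ]
  exact tendsto_const_nhds

theorem coef_indicator_sub_setAverage {k : ℤ} {Q : Set (Fin n → ℝ)} (hQ : Q ∈ D.gen k)
    {f : (Fin n → ℝ) → ℝ} (hf : IntegrableOn f Q μ) :
    h.coef (Q.indicator fun x => f x - ⨍ y in Q, f y ∂μ) = (D.below Q).indicator (h.coef f) := by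
  funext p
  by_cases hp : p.1.1 ⊆ Q
  · have integrableOn_const : IntegrableOn (fun _ => ⨍ y in Q, f y ∂μ) p.1.1 μ :=
      integrableOn_const (D.measure_lt_top_of_gen (D.mem_gen_level p.1)).ne
    rw [indicator_of_mem (show p ∈ D.below Q from hp),
      h.coef_congr_restrict (g := f - fun _ => ⨍ y in Q, f y ∂μ),
      h.coef_sub (hf.mono_set hp) integrableOn_const, h.coef_const, sub_zero]
    filter_upwards [ae_restrict_mem (D.measurableSet_of_gen (D.mem_gen_level p.1))] with x hx
    simp [hp hx]
  · rw [indicator_of_notMem (show p ∉ D.below Q from hp)]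
    exact h.coef_indicator_of_not_subset hQ
      (setAverage_sub_setAverage (D.measure_lt_top_of_gen hQ).ne f) hp

theorem tsum_indicator_below_coef_sq {k : ℤ} {Q : Set (Fin n → ℝ)} (hQ : Q ∈ D.gen k)
    {f : (Fin n → ℝ) → ℝ} (hf : IntegrableOn f Q μ)
    (hv : MemLp (Q.indicator fun x => f x - ⨍ y in Q, f y ∂μ) 2 μ) :
    ∑' p, (D.below Q).indicator (fun p => ‖h.coef f p‖ₑ ^ 2) p =
      ∫⁻ x in Q, ‖f x - ⨍ y in Q, f y ∂μ‖ₑ ^ 2 ∂μ := by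
  have parseval := h.tsum_coef_sq hv
  rw [h.coef_indicator_sub_setAverage hQ hf] at parseval
  have indicator_sq {α : Type} (s : Set α) (g : α → ℝ≥0∞) (a : α) :
      s.indicator g a ^ 2 = s.indicator (fun a => g a ^ 2) a := by
    by_cases ha : a ∈ s <;> simp [ha]
  simpa only [enorm_indicator_eq_indicator_enorm, indicator_sq,
    lintegral_indicator (D.measurableSet_of_gen hQ)] using parseval

end HaarSystem

section RunningMaximum

open Finset

variable {X : ℕ → ℝ} {b y : ℝ}

theorem partialSups_le_partialSups_add_one (X : ℕ → ℝ) (m : ℕ) :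
    partialSups X m ≤ partialSups X (m + 1) :=
  (partialSups X).monotone m.le_succ

theorem sq_sub_sq_posPart_le_sum_partialSups (hX : X 0 = 0) (hy : 0 ≤ y) (N : ℕ) :
    y ^ 2 - max (y - partialSups X N) 0 ^ 2 ≤
      2 * ∑ m ∈ range N, (partialSups X (m + 1) - partialSups X m) * |y - X m| := by
  have step : ∀ a a' t : ℝ, a ≤ a' → max (y - a) 0 ≤ t →
      max (y - a) 0 ^ 2 - max (y - a') 0 ^ 2 ≤ 2 * ((a' - a) * t) := fun a a' t ha ht => by
    refine le_trans ?_ (mul_le_mul_of_nonneg_left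
      (mul_le_mul_of_nonneg_left ht (sub_nonneg.2 ha)) zero_le_two)
    rcases le_total (y - a) 0 with h | h <;> rcases le_total (y - a') 0 with h' | h' <;>
      simp only [h, h', max_eq_left, max_eq_right] <;> nlinarith
  induction N with
  | zero => simp [hX, hy]
  | succ m ih =>
    have posPart_le : max (y - partialSups X m) 0 ≤ |y - X m| :=
      max_le ((sub_le_sub_left (le_partialSups X m) y).trans (le_abs_self _)) (abs_nonneg _)
    rw [sum_range_succ, mul_add]
    linarith [step _ _ _ (partialSups_le_partialSups_add_one X m) posPart_le]

theorem sq_partialSups_sub_le_sum (hX : X 0 = 0) (hb : ∀ m, |X (m + 1) - X m| ≤ b) (N : ℕ) :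
    partialSups X N ^ 2 - 2 * (b + y) * partialSups X N ≤
      2 * ∑ m ∈ range N, (partialSups X (m + 1) - partialSups X m) * |y - X m| := by
  induction N with
  | zero => simp [hX]
  | succ m ih =>
    rw [sum_range_succ, partialSups_add_one]
    rcases le_total (X (m + 1)) (partialSups X m) with hm | hm
    · simpa only [sup_eq_left.2 hm, sub_self, zero_mul, add_zero] using ih
    · rw [sup_eq_right.2 hm]
      have le_abs : X (m + 1) - b - y ≤ |y - X m| := by
        linarith [(abs_le.1 (hb m)).2, neg_le_abs (y - X m)]
      nlinarith [mul_le_mul_of_nonneg_left le_abs (sub_nonneg.2 hm)]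

/-- When the running maximum increases, its value is within `b` of the current value of `X`, so
the increments of its square are controlled by its increments weighted with the distance of `X`
from any fixed target `y`. -/
theorem sq_partialSups_le (hX : X 0 = 0) (hb : ∀ m, |X (m + 1) - X m| ≤ b) (hy : 0 ≤ y) (N : ℕ) :
    partialSups X N ^ 2 ≤ 4 * b * partialSups X N +
      12 * ∑ m ∈ range N, (partialSups X (m + 1) - partialSups X m) * |y - X m| := by
  have lower := sq_sub_sq_posPart_le_sum_partialSups hX hy N
  have upper := sq_partialSups_sub_le_sum (y := y) hX hb N
  have hM : 0 ≤ partialSups X N := by simpa [hX] using (partialSups X).monotone N.zero_le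
  have hbM : 0 ≤ b * partialSups X N := mul_nonneg ((abs_nonneg _).trans (hb 0)) hM
  rcases le_total (y - partialSups X N) 0 with hyM | hyM
  · rw [max_eq_right hyM] at lower
    nlinarith [sq_nonneg (partialSups X N - 2 * y)]
  · rw [max_eq_left hyM] at lower
    nlinarith

end RunningMaximum

namespace DyadicSystem

open Filter

variable {n : ℕ} {D : DyadicSystem n} {μ : Measure (Fin n → ℝ)} {f : (Fin n → ℝ) → ℝ} {b : ℝ}
  {k : ℤ} {Q : Set (Fin n → ℝ)}

/-- The maximal function `max_{m ≤ N} |E_{k + m} f - E_k f|`. -/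
noncomputable def maxDeviation (D : DyadicSystem n) (μ : Measure (Fin n → ℝ)) (k : ℤ)
    (f : (Fin n → ℝ) → ℝ) (N : ℕ) (x : Fin n → ℝ) : ℝ :=
  partialSups (fun m : ℕ => |D.expect μ (k + m) f x - D.expect μ k f x|) N

theorem adapted_maxDeviation [NeZero n] (N : ℕ) :
    D.Adapted (k + N) (D.maxDeviation μ k f N) := by
  intro x y hy
  simp only [maxDeviation, partialSups_apply]
  refine Finset.sup'_congr _ rfl fun m hm => ?_
  have hm : m ≤ N := Finset.mem_Iic.1 hm
  rw [(D.adapted_expect μ (k + m) f).mono (by omega) x y hy,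
    (D.adapted_expect μ k f).mono (by omega) x y hy]

theorem adapted_maxDeviation_sub [NeZero n] (m : ℕ) : D.Adapted (k + m + 1) fun x =>
    D.maxDeviation μ k f (m + 1) x - D.maxDeviation μ k f m x := by
  intro x y hy
  have succ_eq := adapted_maxDeviation (μ := μ) (f := f) (k := k) (m + 1) x y
    (by push_cast; rwa [← add_assoc])
  have eq := (adapted_maxDeviation (μ := μ) (f := f) (k := k) m).mono
    (le_add_of_nonneg_right zero_le_one : k + m ≤ k + m + 1) x y hy
  simp only [succ_eq, eq]

/-- `⟨|f - ⟨f⟩_P|⟩_Q ≤ b` for all cubes `Q` with parent `P`: the `BMO` condition in terms of real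
integrals. -/
structure MeanOscLE (D : DyadicSystem n) (μ : Measure (Fin n → ℝ)) (f : (Fin n → ℝ) → ℝ)
    (b : ℝ) : Prop where
  integrableOn : ∀ Q ∈ D.cubes, IntegrableOn f Q μ
  osc_le : ∀ k x, ∫ y in D.cell (k + 1) x, |f y - D.expect μ k f y| ∂μ ≤
    b * μ.real (D.cell (k + 1) x)

namespace MeanOscLE

variable [D.PosFinite μ]

theorem expect_abs_sub_le (hf : D.MeanOscLE μ f b) (k : ℤ) (x : Fin n → ℝ) :
    D.expect μ (k + 1) (fun y => |f y - D.expect μ k f y|) x ≤ b := by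
  have measure_pos : 0 < μ.real (D.cell (k + 1) x) :=
    ENNReal.toReal_pos (D.measure_pos_of_gen (D.cell_mem _ x)).ne'
      (D.measure_lt_top_of_gen (D.cell_mem _ x)).ne
  have osc_le := hf.osc_le k x
  rw [D.setIntegral_eq_expect_mul] at osc_le
  exact le_of_mul_le_mul_right osc_le measure_pos

variable [NeZero n]

theorem integrableOn_sub_expect (hf : D.MeanOscLE μ f b) (hQ : Q ∈ D.gen k) (l : ℤ) :
    IntegrableOn (fun y => f y - D.expect μ l f y) Q μ :=
  (hf.integrableOn Q ⟨k, hQ⟩).sub ((D.adapted_expect μ l f).integrableOn hQ)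

theorem abs_expect_sub_le (hf : D.MeanOscLE μ f b) (k : ℤ) (x : Fin n → ℝ) :
    |D.expect μ (k + 1) f x - D.expect μ k f x| ≤ b := by
  have measure_pos : 0 < μ.real (D.cell (k + 1) x) :=
    ENNReal.toReal_pos (D.measure_pos_of_gen (D.cell_mem _ x)).ne'
      (D.measure_lt_top_of_gen (D.cell_mem _ x)).ne
  have expect_sub_mul : (D.expect μ (k + 1) f x - D.expect μ k f x) * μ.real (D.cell (k + 1) x) =
      ∫ y in D.cell (k + 1) x, (f y - D.expect μ k f y) ∂μ := by
    rw [integral_sub (hf.integrableOn _ (D.cell_mem_cubes _ x))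
        ((D.adapted_expect μ k f).integrableOn (D.cell_mem _ x)),
      D.setIntegral_eq_expect_mul, D.setIntegral_eq_expect_mul (f := D.expect μ k f),
      D.expect_of_adapted ((D.adapted_expect μ k f).mono (Int.le_add_one le_rfl)), sub_mul]
  refine le_of_mul_le_mul_right ?_ measure_pos
  rw [← abs_of_pos measure_pos, ← abs_mul, abs_of_pos measure_pos, expect_sub_mul]
  exact abs_integral_le_integral_abs.trans (hf.osc_le k x)

theorem setIntegral_mul_le (hf : D.MeanOscLE μ f b) {l : ℤ} (hlk : l ≤ k + 1) (hQ : Q ∈ D.gen l)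
    {θ : (Fin n → ℝ) → ℝ} (hθ : D.Adapted (k + 1) θ) (hθ0 : ∀ x, 0 ≤ θ x) :
    ∫ x in Q, θ x * |f x - D.expect μ k f x| ∂μ ≤ b * ∫ x in Q, θ x ∂μ := by
  rw [← D.setIntegral_expect hlk hQ
      (hθ.integrableOn_mul hQ (hf.integrableOn_sub_expect hQ k).abs), ← integral_const_mul]
  refine setIntegral_mono_on ((D.adapted_expect μ _ _).integrableOn hQ)
    ((hθ.integrableOn hQ).const_mul _) (D.measurableSet_of_gen hQ) fun x _ => ?_
  rw [D.expect_adapted_mul μ hθ, mul_comm]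
  exact mul_le_mul_of_nonneg_right (hf.expect_abs_sub_le k x) (hθ0 x)

theorem sq_maxDeviation_le (hf : D.MeanOscLE μ f b) (k : ℤ) (N : ℕ) (x : Fin n → ℝ) :
    D.maxDeviation μ k f N x ^ 2 ≤ 4 * b * D.maxDeviation μ k f N x +
      12 * ∑ m ∈ Finset.range N, (D.maxDeviation μ k f (m + 1) x - D.maxDeviation μ k f m x) *
        |f x - D.expect μ (k + m) f x| := by
  have jump_le (m : ℕ) : |(|D.expect μ (k + (m + 1 : ℕ)) f x - D.expect μ k f x| -
      |D.expect μ (k + m) f x - D.expect μ k f x|)| ≤ b := by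
    refine (abs_abs_sub_abs_le _ _).trans ?_
    rw [sub_sub_sub_cancel_right]
    push_cast
    rw [← add_assoc]
    exact hf.abs_expect_sub_le (k + m) x
  refine (sq_partialSups_le (X := fun m : ℕ => |D.expect μ (k + m) f x - D.expect μ k f x|)
    (by simp) jump_le (abs_nonneg (f x - D.expect μ k f x)) N).trans ?_
  refine add_le_add_right (mul_le_mul_of_nonneg_left (Finset.sum_le_sum fun m _ => ?_)
    (by norm_num)) _
  refine mul_le_mul_of_nonneg_left ((abs_abs_sub_abs_le _ _).trans_eq ?_)
    (sub_nonneg.2 (partialSups_le_partialSups_add_one _ m))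
  rw [sub_sub_sub_cancel_right]

theorem integrableOn_maxDeviation_sub_mul (hf : D.MeanOscLE μ f b) (hQ : Q ∈ D.gen k) (m : ℕ) :
    IntegrableOn (fun x => (D.maxDeviation μ k f (m + 1) x - D.maxDeviation μ k f m x) *
      |f x - D.expect μ (k + m) f x|) Q μ :=
  (adapted_maxDeviation_sub m).integrableOn_mul hQ (hf.integrableOn_sub_expect hQ _).abs

theorem setIntegral_sum_maxDeviation_sub_mul_le (hf : D.MeanOscLE μ f b) (hQ : Q ∈ D.gen k)
    (N : ℕ) : ∫ x in Q, ∑ m ∈ Finset.range N,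
        (D.maxDeviation μ k f (m + 1) x - D.maxDeviation μ k f m x) *
          |f x - D.expect μ (k + m) f x| ∂μ ≤
      b * ∫ x in Q, D.maxDeviation μ k f N x ∂μ := by
  rw [integral_finsetSum _ fun m _ => hf.integrableOn_maxDeviation_sub_mul hQ m]
  calc _ ≤ ∑ m ∈ Finset.range N,
          b * ∫ x in Q, (D.maxDeviation μ k f (m + 1) x - D.maxDeviation μ k f m x) ∂μ :=
        Finset.sum_le_sum fun m _ => hf.setIntegral_mul_le (by omega) hQ
          (adapted_maxDeviation_sub m) fun _ =>
            sub_nonneg.2 (partialSups_le_partialSups_add_one _ m)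
    _ = b * ∫ x in Q, D.maxDeviation μ k f N x ∂μ := by
        rw [← Finset.mul_sum, Finset.sum_congr rfl fun m _ =>
          integral_sub ((adapted_maxDeviation (m + 1)).integrableOn hQ)
            ((adapted_maxDeviation m).integrableOn hQ),
          Finset.sum_range_sub fun m => ∫ x in Q, D.maxDeviation μ k f m x ∂μ]
        simp [maxDeviation]

theorem setIntegral_sq_maxDeviation_le (hf : D.MeanOscLE μ f b) (hQ : Q ∈ D.gen k) (N : ℕ) :
    ∫ x in Q, D.maxDeviation μ k f N x ^ 2 ∂μ ≤ 256 * b ^ 2 * μ.real Q := by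
  set M := D.maxDeviation μ k f N
  have integrable_M : IntegrableOn M Q μ := (adapted_maxDeviation N).integrableOn hQ
  have integrable_sq : IntegrableOn (fun x => M x ^ 2) Q μ :=
    ((adapted_maxDeviation N).comp (· ^ 2)).integrableOn hQ
  have integrable_sum := integrable_finsetSum (Finset.range N) fun m _ =>
    hf.integrableOn_maxDeviation_sub_mul hQ m
  have integral_sq_le : ∫ x in Q, M x ^ 2 ∂μ ≤ 16 * b * ∫ x in Q, M x ∂μ := by
    refine (integral_mono integrable_sq ((integrable_M.const_mul _).add
      (integrable_sum.const_mul _)) (hf.sq_maxDeviation_le k N)).trans ?_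
    simp only [Pi.add_apply]
    rw [integral_add (integrable_M.const_mul _) (integrable_sum.const_mul _),
      integral_const_mul, integral_const_mul]
    linarith [hf.setIntegral_sum_maxDeviation_sub_mul_le hQ N]
  have young : 16 * b * ∫ x in Q, M x ∂μ ≤
      1 / 2 * ∫ x in Q, M x ^ 2 ∂μ + 128 * b ^ 2 * μ.real Q := by
    have integrable_const : IntegrableOn (fun _ => 128 * b ^ 2) Q μ :=
      integrableOn_const (D.measure_lt_top_of_gen hQ).ne
    have := integral_mono (integrable_M.const_mul (16 * b))
      ((integrable_sq.const_mul (1 / 2)).add integrable_const)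
      fun x => show 16 * b * M x ≤ 1 / 2 * M x ^ 2 + 128 * b ^ 2 by
        nlinarith [sq_nonneg (M x - 16 * b)]
    simp only [Pi.add_apply] at this
    rwa [integral_const_mul, integral_add (integrable_sq.const_mul _) integrable_const,
      integral_const_mul, setIntegral_const, smul_eq_mul, mul_comm (μ.real Q)] at this
  linarith

theorem setLIntegral_sq_expect_sub_le (hf : D.MeanOscLE μ f b) (hQ : Q ∈ D.gen k) (N : ℕ) :
    ∫⁻ x in Q, ‖D.expect μ (k + N) f x - ⨍ y in Q, f y ∂μ‖ₑ ^ 2 ∂μ ≤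
      ENNReal.ofReal (256 * b ^ 2) * μ Q := by
  have integrable_sq : IntegrableOn (fun x => D.maxDeviation μ k f N x ^ 2) Q μ :=
    ((adapted_maxDeviation N).comp (· ^ 2)).integrableOn hQ
  calc _ ≤ ∫⁻ x in Q, ENNReal.ofReal (D.maxDeviation μ k f N x ^ 2) ∂μ := by
        refine setLIntegral_mono_ae' (D.measurableSet_of_gen hQ) (Eventually.of_forall
          fun x hx => ?_)
        rw [← D.expect_eq_of_mem μ hQ f hx, ← ofReal_norm, ← ENNReal.ofReal_pow (norm_nonneg _)]
        exact ENNReal.ofReal_le_ofReal (pow_le_pow_left₀ (norm_nonneg _)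
          (le_partialSups (fun m : ℕ => |D.expect μ (k + m) f x - D.expect μ k f x|) N) 2)
    _ = ENNReal.ofReal (∫ x in Q, D.maxDeviation μ k f N x ^ 2 ∂μ) :=
        (ofReal_integral_eq_lintegral_ofReal integrable_sq
          (Eventually.of_forall fun _ => sq_nonneg _)).symm
    _ ≤ ENNReal.ofReal (256 * b ^ 2 * μ.real Q) :=
        ENNReal.ofReal_le_ofReal (hf.setIntegral_sq_maxDeviation_le hQ N)
    _ = ENNReal.ofReal (256 * b ^ 2) * μ Q := by
        rw [ENNReal.ofReal_mul (by positivity), ofReal_measureReal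
          (D.measure_lt_top_of_gen hQ).ne]

theorem setLIntegral_sq_sub_setAverage_le (hf : D.MeanOscLE μ f b) (hQ : Q ∈ D.gen k) :
    ∫⁻ x in Q, ‖f x - ⨍ y in Q, f y ∂μ‖ₑ ^ 2 ∂μ ≤ ENNReal.ofReal (256 * b ^ 2) * μ Q := by
  have ae_eq_liminf : ∀ᵐ x ∂μ.restrict Q, ‖f x - ⨍ y in Q, f y ∂μ‖ₑ ^ 2 =
      liminf (fun N : ℕ => ‖D.expect μ (k + N) f x - ⨍ y in Q, f y ∂μ‖ₑ ^ 2) atTop := by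
    filter_upwards [D.ae_tendsto_expect hQ (hf.integrableOn Q ⟨k, hQ⟩)] with x hx
    exact (ENNReal.Tendsto.pow (hx.sub_const _).enorm).liminf_eq.symm
  rw [lintegral_congr_ae ae_eq_liminf]
  refine (lintegral_liminf_le fun N =>
    ((D.measurable_expect μ _ f).sub_const _).enorm.pow_const 2).trans ?_
  exact liminf_le_of_le (by isBoundedDefault) fun _ hc =>
    let ⟨N, hN⟩ := hc.exists
    hN.trans (hf.setLIntegral_sq_expect_sub_le hQ N)

theorem memLp_indicator_sub_setAverage (hf : D.MeanOscLE μ f b) (hQ : Q ∈ D.gen k) :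
    MemLp (Q.indicator fun x => f x - ⨍ y in Q, f y ∂μ) 2 μ := by
  rw [memLp_indicator_iff_restrict (D.measurableSet_of_gen hQ)]
  refine ⟨(hf.integrableOn Q ⟨k, hQ⟩).aestronglyMeasurable.sub aestronglyMeasurable_const, ?_⟩
  rw [eLpNorm_lt_top_iff_lintegral_rpow_enorm_lt_top two_ne_zero ENNReal.ofNat_ne_top]
  simp only [ENNReal.toReal_ofNat, ENNReal.rpow_ofNat]
  exact (hf.setLIntegral_sq_sub_setAverage_le hQ).trans_lt
    (ENNReal.mul_lt_top ENNReal.ofReal_lt_top (D.measure_lt_top_of_gen hQ))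

theorem memLp_indicator (hf : D.MeanOscLE μ f b) (hQ : Q ∈ D.cubes) :
    MemLp (Q.indicator f) 2 μ := by
  obtain ⟨k, hQ⟩ := hQ
  have memLp_const : MemLp (Q.indicator fun _ => ⨍ y in Q, f y ∂μ) 2 μ :=
    memLp_indicator_const 2 (D.measurableSet_of_gen hQ) _
      (Or.inr (D.measure_lt_top_of_gen hQ).ne)
  convert (hf.memLp_indicator_sub_setAverage hQ).add memLp_const using 1
  funext x
  by_cases hx : x ∈ Q <;> simp [hx]

end MeanOscLE

end DyadicSystem

namespace DyadicSystem

variable {n : ℕ} (D : DyadicSystem n)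

theorem eq_of_mem_desc_zero {Q R : Set (Fin n → ℝ)} (h : R ∈ D.desc 0 Q) : R = Q := by
  obtain ⟨k, hQ, hR, hRQ⟩ := h
  obtain ⟨x, hx⟩ := D.nonempty_of_gen hR
  exact (D.partition k x).unique ⟨by simpa using hR, hx⟩ ⟨hQ, hRQ hx⟩

variable [NeZero n]

theorem exists_mem_desc (r : ℕ) (Q : D.cubes) : ∃ R : D.cubes, R.1 ∈ D.desc r Q.1 := by
  obtain ⟨x, hx⟩ := D.nonempty_of_gen (D.mem_gen_level Q)
  refine ⟨D.cellCube (D.level Q + r) x, ?_⟩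
  have cell_mem_desc := D.cell_mem_desc (D.level Q) r x
  rwa [D.cell_eq (D.mem_gen_level Q) hx] at cell_mem_desc

theorem exists_mem_desc_of_mem_desc_add {r s : ℕ} {Q R : Set (Fin n → ℝ)}
    (h : R ∈ D.desc (r + s) Q) : ∃ S : D.cubes, S.1 ∈ D.desc r Q ∧ R ∈ D.desc s S.1 := by
  obtain ⟨k, hQ, hR, hRQ⟩ := h
  obtain ⟨x, hx⟩ := D.nonempty_of_gen hR
  refine ⟨D.cellCube (k + r) x, ?_, ?_⟩
  · have cell_mem_desc := D.cell_mem_desc k r x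
    rwa [D.cell_eq hQ (hRQ hx)] at cell_mem_desc
  · have cell_mem_desc := D.cell_mem_desc (k + r) s x
    rwa [add_assoc, ← Nat.cast_add, D.cell_eq hR hx] at cell_mem_desc

theorem tsum_eq_tsum_cellCube (x : Fin n → ℝ) {F : D.cubes → ℝ≥0∞}
    (hF : ∀ Q : D.cubes, x ∉ Q.1 → F Q = 0) :
    ∑' Q, F Q = ∑' k : ℤ, F (D.cellCube k x) := by
  refine ((D.cellCube_injective x).tsum_eq fun Q hQ => ?_).symm
  by_cases hx : x ∈ Q.1
  · exact ⟨D.level Q, D.cellCube_level hx⟩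
  · exact absurd (hF Q hx) hQ

theorem tsum_eq_tsum_cellCube_nat (x : Fin n → ℝ) (k : ℤ) {F : D.cubes → ℝ≥0∞}
    (hF : ∀ Q : D.cubes, x ∉ Q.1 → F Q = 0) (hF_level : ∀ Q, D.level Q < k → F Q = 0) :
    ∑' Q, F Q = ∑' m : ℕ, F (D.cellCube (k + m) x) := by
  have injective : Function.Injective fun m : ℕ => D.cellCube (k + m) x :=
    (D.cellCube_injective x).comp fun i j hij => by simpa using hij
  refine (injective.tsum_eq fun Q hQ => ?_).symm
  by_cases hx : x ∈ Q.1
  · have hk : k ≤ D.level Q := le_of_not_gt fun hk => hQ (hF_level Q hk)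
    obtain ⟨m, hm⟩ := Int.le.dest hk
    exact ⟨m, by simp only [hm, D.cellCube_level hx]⟩
  · exact absurd (hF Q hx) hQ

end DyadicSystem

namespace HaarSystem

variable {n : ℕ} {D : DyadicSystem n} {μ : Measure (Fin n → ℝ)}

section Mass

/-- The `L¹` norm of a Haar function. -/
noncomputable def mass (h : HaarSystem D μ) (p : D.HaarIndex) : ℝ :=
  ∫ x, |h.haar p x| ∂μ

/-- The comparison between the norms of the Haar functions that holds for balanced measures. -/
structure MassBound (h : HaarSystem D μ) (C : ℝ≥0) : Prop where
  haar_mul_mass_le : ∀ p x, |h.haar p x| * h.mass p ≤ C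
  mass_le_child : ∀ p q : D.HaarIndex, q.1.1 ∈ D.desc 1 p.1.1 → h.mass p ≤ C * h.mass q
  mass_child_le : ∀ p q : D.HaarIndex, q.1.1 ∈ D.desc 1 p.1.1 → h.mass q ≤ C * h.mass p

variable (h : HaarSystem D μ)

theorem mass_nonneg (p : D.HaarIndex) : 0 ≤ h.mass p :=
  integral_nonneg fun _ => abs_nonneg _

theorem memLp_haar (p : D.HaarIndex) : MemLp (h.haar p) 2 μ :=
  h.memLp p.1 p.2

theorem lintegral_haar_sq (p : D.HaarIndex) : ∫⁻ x, ‖h.haar p x‖ₑ ^ 2 ∂μ = 1 := by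
  classical
  rw [← h.tsum_coef_sq (h.memLp_haar p), tsum_eq_single p]
  · simp [h.coef_haar]
  · intro q hq
    simp [h.coef_haar, hq]

theorem one_le_eLpNorm_one_mul_eLpNorm_top (p : D.HaarIndex) :
    1 ≤ eLpNorm (h.haar p) 1 μ * eLpNorm (h.haar p) ∞ μ := by
  refine (h.lintegral_haar_sq p).ge.trans ?_
  rw [eLpNorm_one_eq_lintegral_enorm, ← lintegral_mul_const'' _ (h.memLp_haar p).1.enorm]
  refine lintegral_mono_ae ?_
  filter_upwards [enorm_ae_le_eLpNormEssSup (h.haar p) μ] with x hx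
  rw [sq, eLpNorm_exponent_top]
  gcongr

variable {h}

theorem MassBound.mass_le_sq_of_fst_eq [NeZero n] {C : ℝ≥0} (hC : h.MassBound C)
    {p q : D.HaarIndex} (hpq : q.1 = p.1) : h.mass p ≤ C ^ 2 * h.mass q := by
  obtain ⟨R, hR⟩ := D.exists_mem_desc 1 p.1
  calc h.mass p ≤ C * h.mass (R, p.2) := hC.mass_le_child p (R, p.2) hR
    _ ≤ C * (C * h.mass q) := by
        gcongr
        exact hC.mass_child_le q (R, p.2) (hpq ▸ hR)
    _ = C ^ 2 * h.mass q := by ring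

theorem MassBound.mass_le_of_mem_desc [NeZero n] {C : ℝ≥0} (hC : h.MassBound C) (r : ℕ)
    (p q : D.HaarIndex) (hpq : q.1.1 ∈ D.desc r p.1.1) :
    h.mass p ≤ C ^ (r + 2) * h.mass q ∧ h.mass q ≤ C ^ (r + 2) * h.mass p := by
  induction r generalizing q with
  | zero =>
    have fst_eq : q.1 = p.1 := Subtype.ext (D.eq_of_mem_desc_zero hpq)
    exact ⟨hC.mass_le_sq_of_fst_eq fst_eq, hC.mass_le_sq_of_fst_eq fst_eq.symm⟩
  | succ r ih =>
    obtain ⟨S, hS, hq⟩ := D.exists_mem_desc_of_mem_desc_add hpq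
    obtain ⟨le_mass, mass_le⟩ := ih (S, q.2) hS
    constructor
    · calc h.mass p ≤ C ^ (r + 2) * h.mass (S, q.2) := le_mass
        _ ≤ C ^ (r + 2) * (C * h.mass q) := by
            gcongr
            exact hC.mass_le_child (S, q.2) q hq
        _ = C ^ (r + 1 + 2) * h.mass q := by ring
    · calc h.mass q ≤ C * h.mass (S, q.2) := hC.mass_child_le (S, q.2) q hq
        _ ≤ C * (C ^ (r + 2) * h.mass p) := by gcongr
        _ = C ^ (r + 1 + 2) * h.mass p := by ring

variable (h) [NeZero n] [D.PosFinite μ]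

theorem eLpNorm_one_haar (p : D.HaarIndex) :
    eLpNorm (h.haar p) 1 μ = ENNReal.ofReal (h.mass p) := by
  rw [eLpNorm_one_eq_lintegral_enorm,
    ← ofReal_integral_norm_eq_lintegral_enorm (h.integrable_haar p)]
  rfl

theorem enorm_haar_le (p : D.HaarIndex) (x : Fin n → ℝ) :
    ‖h.haar p x‖ₑ ≤ eLpNorm (h.haar p) ∞ μ := by
  rw [eLpNorm_exponent_top]
  obtain ⟨y, hy, hle⟩ : ∃ y ∈ D.cell (D.level p.1 + 1) x,
      ‖h.haar p y‖ₑ ≤ eLpNormEssSup (h.haar p) μ := by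
    by_contra! hlt
    exact (D.measure_pos_of_gen (D.cell_mem _ x)).ne' (measure_mono_null
      (fun y hy => not_le.2 (hlt y hy)) (enorm_ae_le_eLpNormEssSup (h.haar p) μ))
  rwa [h.adapted_haar p x y hy] at hle

theorem mass_le_mul_of_eLpNorm_mul_le {p q : D.HaarIndex} {C : ℝ≥0}
    (hpq : eLpNorm (h.haar p) 1 μ * eLpNorm (h.haar q) ∞ μ ≤ C) : h.mass p ≤ C * h.mass q := by
  have eLpNorm_le : eLpNorm (h.haar p) 1 μ ≤ C * eLpNorm (h.haar q) 1 μ :=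
    calc eLpNorm (h.haar p) 1 μ ≤ eLpNorm (h.haar p) 1 μ *
          (eLpNorm (h.haar q) 1 μ * eLpNorm (h.haar q) ∞ μ) :=
        le_mul_of_one_le_right' (h.one_le_eLpNorm_one_mul_eLpNorm_top q)
      _ = eLpNorm (h.haar p) 1 μ * eLpNorm (h.haar q) ∞ μ * eLpNorm (h.haar q) 1 μ := by ring
      _ ≤ C * eLpNorm (h.haar q) 1 μ := by gcongr
  rwa [eLpNorm_one_haar, eLpNorm_one_haar, ← ENNReal.ofReal_coe_nnreal,
    ← ENNReal.ofReal_mul C.coe_nonneg,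
    ENNReal.ofReal_le_ofReal_iff (mul_nonneg C.coe_nonneg (h.mass_nonneg q))] at eLpNorm_le

theorem abs_haar_mul_mass_le {p q : D.HaarIndex} {C : ℝ≥0}
    (hpq : eLpNorm (h.haar p) 1 μ * eLpNorm (h.haar q) ∞ μ ≤ C)
    (hqp : eLpNorm (h.haar q) 1 μ * eLpNorm (h.haar p) ∞ μ ≤ C) (x : Fin n → ℝ) :
    |h.haar p x| * h.mass p ≤ C * C := by
  have enorm_le : ‖h.haar p x‖ₑ * eLpNorm (h.haar p) 1 μ ≤ (C * C : ℝ≥0) :=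
    calc ‖h.haar p x‖ₑ * eLpNorm (h.haar p) 1 μ
      _ ≤ eLpNorm (h.haar p) ∞ μ * eLpNorm (h.haar p) 1 μ := by
          gcongr
          exact h.enorm_haar_le p x
      _ ≤ eLpNorm (h.haar p) ∞ μ * eLpNorm (h.haar p) 1 μ *
          (eLpNorm (h.haar q) 1 μ * eLpNorm (h.haar q) ∞ μ) :=
          le_mul_of_one_le_right' (h.one_le_eLpNorm_one_mul_eLpNorm_top q)
      _ = (eLpNorm (h.haar p) 1 μ * eLpNorm (h.haar q) ∞ μ) *
          (eLpNorm (h.haar q) 1 μ * eLpNorm (h.haar p) ∞ μ) := by ring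
      _ ≤ (C * C : ℝ≥0) := by
          push_cast
          gcongr
  rw [eLpNorm_one_haar, ← ofReal_norm, ← ENNReal.ofReal_mul (norm_nonneg _),
    ← ENNReal.ofReal_coe_nnreal, ENNReal.ofReal_le_ofReal_iff (by positivity)] at enorm_le
  exact_mod_cast enorm_le

theorem Balanced.exists_massBound {h : HaarSystem D μ} (hbal : h.Balanced) :
    ∃ C : ℝ≥0, h.MassBound C := by
  obtain ⟨C, hC⟩ := hbal
  have parent_mul_child_le : ∀ p q : D.HaarIndex, q.1.1 ∈ D.desc 1 p.1.1 →
      eLpNorm (h.haar p) 1 μ * eLpNorm (h.haar q) ∞ μ ≤ C := fun p q hpq =>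
    le_self_add.trans (hC p.1 q.1 hpq p.2 q.2)
  have child_mul_parent_le : ∀ p q : D.HaarIndex, q.1.1 ∈ D.desc 1 p.1.1 →
      eLpNorm (h.haar q) 1 μ * eLpNorm (h.haar p) ∞ μ ≤ C := fun p q hpq =>
    (mul_comm _ _).trans_le (le_add_self.trans (hC p.1 q.1 hpq p.2 q.2))
  have le_max : ∀ q, C * h.mass q ≤ (max C (C * C) : ℝ≥0) * h.mass q := fun q =>
    mul_le_mul_of_nonneg_right (NNReal.coe_le_coe.2 (le_max_left _ _)) (h.mass_nonneg q)
  refine ⟨max C (C * C), fun p x => ?_,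
    fun p q hpq => (h.mass_le_mul_of_eLpNorm_mul_le (parent_mul_child_le p q hpq)).trans (le_max q),
    fun p q hpq => (h.mass_le_mul_of_eLpNorm_mul_le (child_mul_parent_le p q hpq)).trans (le_max p)⟩
  obtain ⟨R, hR⟩ := D.exists_mem_desc 1 p.1
  exact (h.abs_haar_mul_mass_le (parent_mul_child_le p (R, p.2) hR)
    (child_mul_parent_le p (R, p.2) hR) x).trans (by exact_mod_cast le_max_right _ _)

theorem ofReal_mass_sq_le (p : D.HaarIndex) : ENNReal.ofReal (h.mass p) ^ 2 ≤ μ p.1.1 := by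
  have eLpNorm_two : eLpNorm (h.haar p) 2 μ = 1 := by
    rw [eLpNorm_eq_lintegral_rpow_enorm_toReal two_ne_zero ENNReal.ofNat_ne_top]
    simp only [ENNReal.toReal_ofNat, ENNReal.rpow_ofNat, lintegral_haar_sq, ENNReal.one_rpow]
  have holder := eLpNorm_le_eLpNorm_mul_rpow_measure_univ one_le_two
    (h.memLp_haar p).1.restrict (μ := μ.restrict p.1.1)
  have restrict_eq : ∀ r, eLpNorm (h.haar p) r (μ.restrict p.1.1) = eLpNorm (h.haar p) r μ :=
    fun _ => eLpNorm_restrict_eq_of_support_subset (h.support_subset p.1 p.2)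
  rw [restrict_eq, restrict_eq, eLpNorm_one_haar, eLpNorm_two, one_mul,
    Measure.restrict_apply_univ] at holder
  calc ENNReal.ofReal (h.mass p) ^ 2 ≤ (μ p.1.1 ^ (1 / 2 : ℝ)) ^ 2 := by
        gcongr
        norm_num at holder ⊢
        exact holder
    _ = μ p.1.1 := by
        rw [← ENNReal.rpow_natCast, ← ENNReal.rpow_mul]
        norm_num

end Mass

section Block

/-- The part `∑_j a_Q^j h_Q^j` of the Haar series with coefficients `a` that belongs to the
cube `Q`. -/
noncomputable def block (h : HaarSystem D μ) (a : D.HaarIndex → ℝ) (Q : D.cubes)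
    (x : Fin n → ℝ) : ℝ :=
  ∑ j, a (Q, j) * h.haar (Q, j) x

/-- The Hardy norm of a sequence of Haar coefficients: the `L¹` norm of the square function. -/
noncomputable def hardyNorm (h : HaarSystem D μ) (a : D.HaarIndex → ℝ) : ℝ≥0∞ :=
  ∫⁻ x, (∑' Q, ‖h.block a Q x‖ₑ ^ 2) ^ (1 / 2 : ℝ) ∂μ

/-- The restriction of a sequence of coefficients to a set of cubes. -/
noncomputable def restrictCubes (G : Set D.cubes) (a : D.HaarIndex → ℝ) : D.HaarIndex → ℝ :=
  (Prod.fst ⁻¹' G).indicator a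

variable (h : HaarSystem D μ) (a : D.HaarIndex → ℝ)

theorem block_restrictCubes_of_mem {G : Set D.cubes} {Q : D.cubes} (hQ : Q ∈ G) :
    h.block (restrictCubes G a) Q = h.block a Q := by
  funext x
  simp [block, restrictCubes, indicator, hQ]

theorem block_restrictCubes_of_notMem {G : Set D.cubes} {Q : D.cubes} (hQ : Q ∉ G) :
    h.block (restrictCubes G a) Q = 0 := by
  funext x
  simp [block, restrictCubes, indicator, hQ]

theorem block_eq_zero {Q : D.cubes} {x : Fin n → ℝ} (hx : x ∉ Q.1) : h.block a Q x = 0 :=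
  Finset.sum_eq_zero fun j _ => by rw [h.haar_eq_zero (p := (Q, j)) hx, mul_zero]

theorem memLp_block (Q : D.cubes) : MemLp (h.block a Q) 2 μ :=
  memLp_finsetSum _ fun j _ => (h.memLp_haar (Q, j)).const_mul _

theorem hardyNorm_restrictCubes_le (G : Set D.cubes) :
    h.hardyNorm (restrictCubes G a) ≤ h.hardyNorm a := by
  refine lintegral_mono fun x => ENNReal.rpow_le_rpow (ENNReal.tsum_le_tsum fun Q => ?_)
    (by norm_num)
  by_cases hQ : Q ∈ G
  · rw [h.block_restrictCubes_of_mem a hQ]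
  · simp [h.block_restrictCubes_of_notMem a hQ]

variable [NeZero n]

theorem adapted_block (Q : D.cubes) : D.Adapted (D.level Q + 1) (h.block a Q) :=
  fun x y hy => Finset.sum_congr rfl fun j _ => by rw [h.adapted_haar (Q, j) x y hy]

theorem adapted_block_cellCube (k : ℤ) :
    D.Adapted (k + 1) fun x => h.block a (D.cellCube k x) x := fun x y hy => by
  have cellCube_eq : D.cellCube k y = D.cellCube k x :=
    D.cellCube_eq_of_mem (D.cell_subset (by omega) x hy)
  simp only [cellCube_eq]
  exact h.adapted_block a (D.cellCube k x) x y (by rwa [D.level_cellCube])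

theorem measurable_block (Q : D.cubes) : Measurable (h.block a Q) :=
  (h.adapted_block a Q).measurable

theorem measurable_tsum_block :
    Measurable fun x => (∑' Q, ‖h.block a Q x‖ₑ ^ 2) ^ (1 / 2 : ℝ) :=
  (Measurable.tsum fun Q => (h.measurable_block a Q).enorm.pow_const 2).pow_const _

theorem integrable_mul_block (Q : D.cubes) {u : (Fin n → ℝ) → ℝ} (hu : IntegrableOn u Q.1 μ) :
    Integrable (fun x => u x * h.block a Q x) μ := by
  simp only [block, Finset.mul_sum, mul_left_comm (u _)]
  exact integrable_finsetSum _ fun j _ => (h.integrable_mul_haar (p := (Q, j)) hu).const_mul _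

theorem integral_mul_block (Q : D.cubes) {u : (Fin n → ℝ) → ℝ} (hu : IntegrableOn u Q.1 μ) :
    ∫ x, u x * h.block a Q x ∂μ = ∑ j, a (Q, j) * h.coef u (Q, j) := by
  simp only [block, Finset.mul_sum, mul_left_comm (u _)]
  rw [integral_finsetSum _ fun j _ => (h.integrable_mul_haar (p := (Q, j)) hu).const_mul _]
  simp only [integral_const_mul, coef]

variable [D.PosFinite μ]

theorem integrable_block (Q : D.cubes) : Integrable (h.block a Q) μ :=
  integrable_finsetSum _ fun j _ => (h.integrable_haar (Q, j)).const_mul _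

theorem coef_block [DecidableEq D.cubes] (Q : D.cubes) (p : D.HaarIndex) :
    h.coef (h.block a Q) p = if p.1 = Q then a p else 0 := by
  refine (h.coef_sum_mul_haar Q (fun j => a (Q, j)) p).trans ?_
  split_ifs with hp
  · rw [← hp]
  · rfl

theorem lintegral_block_sq (Q : D.cubes) :
    ∫⁻ x, ‖h.block a Q x‖ₑ ^ 2 ∂μ = ∑ j, ‖a (Q, j)‖ₑ ^ 2 := by
  classical
  rw [← h.tsum_coef_sq (h.memLp_block a Q), ENNReal.tsum_prod', tsum_eq_single Q]
  · simp [h.coef_block]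
  · intro R hR
    simp [h.coef_block, hR]

theorem h1Norm_eq_hardyNorm {f : (Fin n → ℝ) → ℝ} (hf : ∀ Q ∈ D.cubes, IntegrableOn f Q μ) :
    D.h1Norm μ f = h.hardyNorm (h.coef f) := by
  refine lintegral_congr fun x => ?_
  rw [DyadicSystem.squareFn,
    D.tsum_eq_tsum_cellCube x fun Q hQ => by rw [h.block_eq_zero _ hQ]; simp]
  congr 1
  rw [← (Equiv.addRight (1 : ℤ)).tsum_eq]
  refine tsum_congr fun k => ?_
  simp only [Equiv.coe_addRight, DyadicSystem.mdiff, add_sub_cancel_right, ENNReal.rpow_ofNat,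
    block, h.expect_add_one_sub_expect k x (hf _ (D.cell_mem_cubes k x))]

end Block

end HaarSystem

section PartialSq

variable (φ : ℕ → ℝ≥0)

/-- The partial square function `(∑_{i < m} φ_i²)^{1/2}`. -/
noncomputable def partialSq (m : ℕ) : ℝ≥0 :=
  NNReal.sqrt (∑ i ∈ Finset.range m, φ i ^ 2)

/-- The increments of the partial square function. -/
noncomputable def partialSqIncr (m : ℕ) : ℝ≥0 :=
  partialSq φ (m + 1) - partialSq φ m

theorem partialSq_le_partialSq_add_one (m : ℕ) : partialSq φ m ≤ partialSq φ (m + 1) := by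
  rw [partialSq, partialSq, NNReal.sqrt_le_sqrt, Finset.sum_range_succ]
  exact le_self_add

theorem partialSq_add_one_sq (m : ℕ) :
    partialSq φ (m + 1) ^ 2 = partialSq φ m ^ 2 + φ m ^ 2 := by
  simp only [partialSq, NNReal.sq_sqrt, Finset.sum_range_succ]

theorem sum_range_partialSqIncr (m : ℕ) :
    ∑ i ∈ Finset.range m, partialSqIncr φ i = partialSq φ m := by
  induction m with
  | zero => simp [partialSq]
  | succ m ih =>
    rw [Finset.sum_range_succ, ih, partialSqIncr,
      add_tsub_cancel_of_le (partialSq_le_partialSq_add_one φ m)]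

theorem tsum_partialSqIncr_le :
    ∑' m, (partialSqIncr φ m : ℝ≥0∞) ≤ (∑' m, (φ m : ℝ≥0∞) ^ 2) ^ (1 / 2 : ℝ) := by
  refine ENNReal.tsum_le_of_sum_range_le fun N => ?_
  rw [← ENNReal.ofNNReal_finsetSum, sum_range_partialSqIncr, partialSq, NNReal.sqrt_eq_rpow,
    ENNReal.coe_rpow_of_nonneg _ (by norm_num)]
  push_cast
  exact ENNReal.rpow_le_rpow (ENNReal.sum_le_tsum _) (by norm_num)

/-- With `s` and `t` consecutive partial square functions, `φ² = s² - t² ≤ 2 s (s - t)`, and the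
claim is the inequality between arithmetic and geometric means. -/
theorem two_mul_le_partialSq (m : ℕ) (B ψ : ℝ≥0) :
    2 * B * (φ m * ψ) ≤ 2 * B ^ 2 * partialSqIncr φ m + partialSq φ (m + 1) * ψ ^ 2 := by
  have key : ∀ s t u B ψ : ℝ, 0 ≤ t → t ≤ s → s ^ 2 = t ^ 2 + u ^ 2 →
      2 * B * (u * ψ) ≤ 2 * B ^ 2 * (s - t) + s * ψ ^ 2 := by
    intro s t u B ψ ht hts hs
    have u_sq_le : u ^ 2 ≤ 2 * s * (s - t) := by nlinarith
    have right_nonneg : 0 ≤ 2 * B ^ 2 * (s - t) + s * ψ ^ 2 :=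
      add_nonneg (mul_nonneg (by positivity) (sub_nonneg.2 hts))
        (mul_nonneg (ht.trans hts) (sq_nonneg ψ))
    refine (abs_le_of_sq_le_sq' ?_ right_nonneg).2
    calc (2 * B * (u * ψ)) ^ 2 = 4 * B ^ 2 * ψ ^ 2 * u ^ 2 := by ring
      _ ≤ 4 * B ^ 2 * ψ ^ 2 * (2 * s * (s - t)) := by gcongr
      _ ≤ (2 * B ^ 2 * (s - t) + s * ψ ^ 2) ^ 2 := by
          nlinarith [sq_nonneg (2 * B ^ 2 * (s - t) - s * ψ ^ 2)]
  have mono := partialSq_le_partialSq_add_one φ m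
  rw [← NNReal.coe_le_coe, partialSqIncr]
  push_cast [NNReal.coe_sub mono]
  exact key _ _ _ _ _ (NNReal.coe_nonneg _) (by exact_mod_cast mono)
    (by exact_mod_cast partialSq_add_one_sq φ m)

theorem tsum_mul_tsum_add_eq (a b : ℕ → ℝ≥0∞) :
    ∑' i, a i * ∑' m, b (i + m) = ∑' m, (∑ i ∈ Finset.range (m + 1), a i) * b m := by
  simp only [← ENNReal.tsum_mul_left]
  rw [← ENNReal.tsum_prod (f := fun i m => a i * b (i + m)),
    ← Finset.HasAntidiagonal.sigmaAntidiagonalEquivProd.tsum_eq, ENNReal.tsum_sigma']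
  refine tsum_congr fun m => ?_
  rw [tsum_fintype, Finset.sum_mul, ← Finset.Nat.sum_antidiagonal_eq_sum_range_succ
    (fun i _ => a i * b m)]
  refine (Finset.sum_congr rfl fun p _ => ?_).trans
    (Finset.sum_coe_sort (Finset.HasAntidiagonal.antidiagonal m) fun p => a p.1 * b m)
  exact congrArg (a p.1.1 * b ·) (Finset.HasAntidiagonal.mem_antidiagonal.1 p.2)

theorem two_mul_tsum_mul_le (ψ : ℕ → ℝ≥0) (B : ℝ≥0) :
    2 * (B : ℝ≥0∞) * ∑' m, (φ m * ψ m : ℝ≥0∞) ≤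
      2 * (B : ℝ≥0∞) ^ 2 * ∑' m, (partialSqIncr φ m : ℝ≥0∞) +
        ∑' i, partialSqIncr φ i * ∑' m, (ψ (i + m) : ℝ≥0∞) ^ 2 := by
  rw [tsum_mul_tsum_add_eq (fun i => (partialSqIncr φ i : ℝ≥0∞)) fun m => (ψ m : ℝ≥0∞) ^ 2,
    ← ENNReal.tsum_mul_left, ← ENNReal.tsum_mul_left, ← ENNReal.tsum_add]
  refine ENNReal.tsum_le_tsum fun m => ?_
  rw [← ENNReal.ofNNReal_finsetSum, sum_range_partialSqIncr]
  exact_mod_cast two_mul_le_partialSq φ m B (ψ m)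

end PartialSq

namespace DyadicSystem

variable {n : ℕ} {D : DyadicSystem n} {k : ℤ}

theorem Adapted.partialSqIncr [NeZero n] {φ : ℕ → (Fin n → ℝ) → ℝ≥0}
    (hφ : ∀ m : ℕ, D.Adapted (k + m + 1) (φ m)) (m : ℕ) :
    D.Adapted (k + m + 1) fun x => partialSqIncr (fun i => φ i x) m := by
  intro x y hy
  have partialSq_eq : ∀ l ≤ m + 1,
      partialSq (fun i => φ i y) l = partialSq (fun i => φ i x) l := fun l hl => by
    refine congrArg NNReal.sqrt (Finset.sum_congr rfl fun i hi => ?_)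
    have hi := Finset.mem_range.1 hi
    exact congrArg (· ^ 2) ((hφ i).mono (by omega : k + i + 1 ≤ k + m + 1) x y hy)
  simp only [_root_.partialSqIncr, partialSq_eq (m + 1) le_rfl, partialSq_eq m m.le_succ]

theorem lintegral_eq_tsum_gen (D : DyadicSystem n) (μ : Measure (Fin n → ℝ)) (k : ℤ)
    (F : (Fin n → ℝ) → ℝ≥0∞) : ∫⁻ x, F x ∂μ = ∑' Q : D.gen k, ∫⁻ x in Q.1, F x ∂μ := by
  have iUnion_gen : ⋃ Q ∈ D.gen k, Q = (univ : Set (Fin n → ℝ)) :=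
    eq_univ_of_forall fun x => mem_biUnion (D.cell_mem k x) (D.mem_cell k x)
  rw [← setLIntegral_univ, ← iUnion_gen]
  exact lintegral_biUnion (D.countable_gen k) (fun Q hQ => D.measurableSet_of_gen hQ)
    (D.pairwiseDisjoint_gen k) F

variable {μ : Measure (Fin n → ℝ)}

theorem Adapted.lintegral_mul_le {θ : (Fin n → ℝ) → ℝ≥0∞} (hθ : D.Adapted k θ)
    {F : (Fin n → ℝ) → ℝ≥0∞} (hF : Measurable F) {B : ℝ≥0∞}
    (hB : ∀ Q ∈ D.gen k, ∫⁻ x in Q, F x ∂μ ≤ B * μ Q) :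
    ∫⁻ x, θ x * F x ∂μ ≤ B * ∫⁻ x, θ x ∂μ := by
  rw [D.lintegral_eq_tsum_gen μ k, D.lintegral_eq_tsum_gen μ k, ← ENNReal.tsum_mul_left]
  refine ENNReal.tsum_le_tsum fun Q => ?_
  obtain ⟨x, hx⟩ := D.nonempty_of_gen Q.2
  have θ_eq : ∀ y ∈ Q.1, θ y = θ x := fun y hy => hθ x y (by rwa [D.cell_eq Q.2 hx])
  calc ∫⁻ y in Q.1, θ y * F y ∂μ = θ x * ∫⁻ y in Q.1, F y ∂μ := by
        rw [← lintegral_const_mul _ hF]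
        exact setLIntegral_congr_fun (D.measurableSet_of_gen Q.2) fun y hy => by
          simp only [θ_eq y hy]
    _ ≤ θ x * (B * μ Q.1) := by
        gcongr
        exact hB Q.1 Q.2
    _ = B * ∫⁻ y in Q.1, θ y ∂μ := by
        rw [setLIntegral_congr_fun (D.measurableSet_of_gen Q.2) θ_eq, setLIntegral_const]
        ring

/-- Fefferman's inequality for adapted sequences: the pairing is split by the arithmetic–geometric
mean inequality so that the increments of the partial square functions of `φ` meet the tails of the
square function of `ψ`, which the Carleson condition controls. -/
theorem lintegral_tsum_mul_le [NeZero n] {φ ψ : ℕ → (Fin n → ℝ) → ℝ≥0}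
    (hφ : ∀ m : ℕ, D.Adapted (k + m + 1) (φ m)) (hψ : ∀ m, Measurable (ψ m)) {B : ℝ≥0}
    (hB : 0 < B) (hψB : ∀ i : ℕ, ∀ Q ∈ D.gen (k + i + 1),
      ∫⁻ x in Q, ∑' m, (ψ (i + m) x : ℝ≥0∞) ^ 2 ∂μ ≤ B ^ 2 * μ Q) :
    ∫⁻ x, ∑' m, (φ m x * ψ m x : ℝ≥0∞) ∂μ ≤
      2 * B * ∫⁻ x, (∑' m, (φ m x : ℝ≥0∞) ^ 2) ^ (1 / 2 : ℝ) ∂μ := by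
  set δ : ℕ → (Fin n → ℝ) → ℝ≥0∞ := fun m x => partialSqIncr (fun i => φ i x) m
  have adapted_δ (m : ℕ) : D.Adapted (k + m + 1) (δ m) :=
    (Adapted.partialSqIncr hφ m).comp ((↑) : ℝ≥0 → ℝ≥0∞)
  have measurable_δ (m : ℕ) : Measurable (δ m) := (adapted_δ m).measurable
  have measurable_tail (i : ℕ) : Measurable fun x => ∑' m, (ψ (i + m) x : ℝ≥0∞) ^ 2 :=
    Measurable.tsum fun m => (hψ _).coe_nnreal_ennreal.pow_const 2
  have measurable_pairing : Measurable fun x => ∑' m, (φ m x * ψ m x : ℝ≥0∞) :=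
    Measurable.tsum fun m => (hφ m).measurable.coe_nnreal_ennreal.mul (hψ m).coe_nnreal_ennreal
  have two_mul_ne_zero : 2 * (B : ℝ≥0∞) ≠ 0 := by simp [hB.ne']
  have two_mul_ne_top : 2 * (B : ℝ≥0∞) ≠ ∞ := ENNReal.mul_ne_top (by simp) (by simp)
  rw [← ENNReal.mul_le_mul_iff_right two_mul_ne_zero two_mul_ne_top]
  calc 2 * (B : ℝ≥0∞) * ∫⁻ x, ∑' m, (φ m x * ψ m x : ℝ≥0∞) ∂μ
    _ ≤ ∫⁻ x, (2 * (B : ℝ≥0∞) ^ 2 * ∑' m, δ m x +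
          ∑' i, δ i x * ∑' m, (ψ (i + m) x : ℝ≥0∞) ^ 2) ∂μ := by
        rw [← lintegral_const_mul _ measurable_pairing]
        exact lintegral_mono fun x => two_mul_tsum_mul_le (fun i => φ i x) (fun i => ψ i x) B
    _ = 2 * (B : ℝ≥0∞) ^ 2 * ∫⁻ x, ∑' m, δ m x ∂μ +
          ∑' i, ∫⁻ x, δ i x * ∑' m, (ψ (i + m) x : ℝ≥0∞) ^ 2 ∂μ := by
        rw [lintegral_add_left ((Measurable.tsum measurable_δ).const_mul _),
          lintegral_const_mul _ (Measurable.tsum measurable_δ)]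
        congr 1
        exact lintegral_tsum fun i => ((measurable_δ i).mul (measurable_tail i)).aemeasurable
    _ ≤ 2 * (B : ℝ≥0∞) ^ 2 * ∫⁻ x, ∑' m, δ m x ∂μ +
          ∑' i, (B : ℝ≥0∞) ^ 2 * ∫⁻ x, δ i x ∂μ := by
        gcongr with i
        exact (adapted_δ i).lintegral_mul_le (measurable_tail i) (hψB i)
    _ = 3 * (B : ℝ≥0∞) ^ 2 * ∫⁻ x, ∑' m, δ m x ∂μ := by
        rw [ENNReal.tsum_mul_left, lintegral_tsum fun i => (measurable_δ i).aemeasurable]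
        ring
    _ ≤ 2 * B * (2 * B) * ∫⁻ x, ∑' m, δ m x ∂μ := by
        rw [show 2 * (B : ℝ≥0∞) * (2 * B) = 4 * (B : ℝ≥0∞) ^ 2 by ring]
        gcongr
        norm_num
    _ ≤ 2 * B * (2 * B * ∫⁻ x, (∑' m, (φ m x : ℝ≥0∞) ^ 2) ^ (1 / 2 : ℝ) ∂μ) := by
        rw [mul_assoc]
        gcongr with x
        exact tsum_partialSqIncr_le fun i => φ i x

end DyadicSystem

namespace HaarSystem

open Filter

variable {n : ℕ} {D : DyadicSystem n} {μ : Measure (Fin n → ℝ)}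

/-- The Carleson condition that characterizes the Haar coefficients of functions in `BMO(μ)`,
together with the bound on the individual coefficients that it does not imply for non-doubling
measures. -/
structure Carleson (h : HaarSystem D μ) (b : D.HaarIndex → ℝ) (B : ℝ≥0) : Prop where
  abs_le : ∀ p, |b p| ≤ B * h.mass p
  tsum_le : ∀ Q : D.cubes,
    ∑' p, (D.below Q.1).indicator (fun p => ‖b p‖ₑ ^ 2) p ≤ (B : ℝ≥0∞) ^ 2 * μ Q.1

section Duality

variable {h : HaarSystem D μ} {b : D.HaarIndex → ℝ} {B C : ℝ≥0}

theorem Carleson.abs_block_le (hb : h.Carleson b B) (hC : h.MassBound C) (Q : D.cubes)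
    (x : Fin n → ℝ) : |h.block b Q x| ≤ B * (2 ^ n * C) := by
  have term_le : ∀ j, |b (Q, j) * h.haar (Q, j) x| ≤ B * C := fun j => by
    calc |b (Q, j) * h.haar (Q, j) x| = |b (Q, j)| * |h.haar (Q, j) x| := abs_mul _ _
      _ ≤ B * h.mass (Q, j) * |h.haar (Q, j) x| := by
          gcongr
          exact hb.abs_le _
      _ = B * (|h.haar (Q, j) x| * h.mass (Q, j)) := by ring
      _ ≤ B * C := by
          gcongr
          exact hC.haar_mul_mass_le _ _
  calc |h.block b Q x| ≤ ∑ j, |b (Q, j) * h.haar (Q, j) x| := Finset.abs_sum_le_sum_abs _ _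
    _ ≤ ∑ _j : Fin (2 ^ n - 1), (B * C : ℝ) := Finset.sum_le_sum fun j _ => term_le j
    _ = ((2 ^ n - 1 : ℕ) : ℝ) * (B * C) := by simp
    _ ≤ 2 ^ n * (B * C) := by
        gcongr
        exact_mod_cast Nat.sub_le _ _
    _ = B * (2 ^ n * C) := by ring

variable [NeZero n]

theorem Carleson.tsum_block_cellCube_le (hb : h.Carleson b B) (hC : h.MassBound C) {k : ℤ}
    {Q : Set (Fin n → ℝ)} (hQ : Q ∈ D.gen (k + 1)) {x : Fin n → ℝ} (hx : x ∈ Q) :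
    ∑' m : ℕ, (‖h.block b (D.cellCube (k + m) x) x‖₊ : ℝ≥0∞) ^ 2 ≤
      ((B * (2 ^ n * C) : ℝ≥0) : ℝ≥0∞) ^ 2 +
        ∑' S, {S : D.cubes | S.1 ⊆ Q}.indicator (fun S => ‖h.block b S x‖ₑ ^ 2) S := by
  have injective : Function.Injective fun m : ℕ => D.cellCube (k + (m + 1 : ℕ)) x :=
    (D.cellCube_injective x).comp fun i j hij => by simpa using hij
  have subset : ∀ m : ℕ, (D.cellCube (k + (m + 1 : ℕ)) x).1 ⊆ Q := fun m =>
    D.cell_subset_of_mem_gen (by omega) hQ hx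
  rw [tsum_eq_zero_add' ENNReal.summable]
  gcongr
  · rw [← NNReal.coe_le_coe]
    push_cast
    exact hb.abs_block_le hC _ x
  · refine le_trans (le_of_eq (tsum_congr fun m => ?_))
      (ENNReal.tsum_comp_le_tsum_of_injective injective _)
    rw [indicator_of_mem (show D.cellCube (k + (m + 1 : ℕ)) x ∈ {S : D.cubes | S.1 ⊆ Q} from
      subset m)]
    rfl

variable [D.PosFinite μ]

theorem tsum_indicator_below_eq_lintegral (h : HaarSystem D μ) (b : D.HaarIndex → ℝ)
    (Q : Set (Fin n → ℝ)) :
    ∑' p, (D.below Q).indicator (fun p => ‖b p‖ₑ ^ 2) p =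
      ∫⁻ x, ∑' S, {S : D.cubes | S.1 ⊆ Q}.indicator (fun S => ‖h.block b S x‖ₑ ^ 2) S ∂μ := by
  rw [lintegral_tsum, ENNReal.tsum_prod']
  · refine tsum_congr fun S => ?_
    by_cases hS : S.1 ⊆ Q
    · simp [DyadicSystem.below, hS, h.lintegral_block_sq, indicator]
    · simp [DyadicSystem.below, hS, indicator]
  · intro S
    by_cases hS : S.1 ⊆ Q
    · simp only [indicator, mem_ofPred_eq, hS, if_true]
      exact ((h.measurable_block b S).enorm.pow_const 2).aemeasurable
    · simp only [indicator, mem_ofPred_eq, hS, if_false]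
      exact aemeasurable_const

theorem Carleson.lintegral_tail_le (hb : h.Carleson b B) (hC : h.MassBound C) {k : ℤ}
    {Q : Set (Fin n → ℝ)} (hQ : Q ∈ D.gen (k + 1)) :
    ∫⁻ x in Q, ∑' m : ℕ, (‖h.block b (D.cellCube (k + m) x) x‖₊ : ℝ≥0∞) ^ 2 ∂μ ≤
      ((B * (2 ^ n * C + 1) : ℝ≥0) : ℝ≥0∞) ^ 2 * μ Q := by
  have sq_add_sq_le : ∀ t : ℝ≥0, (B * t) ^ 2 + B ^ 2 ≤ (B * (t + 1)) ^ 2 := fun t => by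
    calc (B * t) ^ 2 + B ^ 2 ≤ (B * t) ^ 2 + B ^ 2 + 2 * B ^ 2 * t := le_self_add
      _ = (B * (t + 1)) ^ 2 := by ring
  calc ∫⁻ x in Q, ∑' m : ℕ, (‖h.block b (D.cellCube (k + m) x) x‖₊ : ℝ≥0∞) ^ 2 ∂μ
    _ ≤ ∫⁻ x in Q, (((B * (2 ^ n * C) : ℝ≥0) : ℝ≥0∞) ^ 2 +
        ∑' S, {S : D.cubes | S.1 ⊆ Q}.indicator (fun S => ‖h.block b S x‖ₑ ^ 2) S) ∂μ :=
        setLIntegral_mono' (D.measurableSet_of_gen hQ) fun x hx =>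
          hb.tsum_block_cellCube_le hC hQ hx
    _ ≤ ((B * (2 ^ n * C) : ℝ≥0) : ℝ≥0∞) ^ 2 * μ Q + (B : ℝ≥0∞) ^ 2 * μ Q := by
        rw [lintegral_add_left measurable_const, setLIntegral_const]
        gcongr
        refine (setLIntegral_le_lintegral _ _).trans ?_
        rw [← h.tsum_indicator_below_eq_lintegral b Q]
        exact hb.tsum_le ⟨Q, _, hQ⟩
    _ ≤ ((B * (2 ^ n * C + 1) : ℝ≥0) : ℝ≥0∞) ^ 2 * μ Q := by
        rw [← add_mul]
        gcongr
        exact_mod_cast sq_add_sq_le (2 ^ n * C)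

theorem ofReal_sum_mul_le (h : HaarSystem D μ) (a b : D.HaarIndex → ℝ) (Q : D.cubes) :
    ENNReal.ofReal (∑ j, a (Q, j) * b (Q, j)) ≤
      ∫⁻ x, ‖h.block a Q x‖ₑ * ‖h.block b Q x‖ₑ ∂μ := by
  classical
  have integral_eq := h.integral_mul_block a Q (h.integrable_block b Q).integrableOn
  simp only [h.coef_block, if_true] at integral_eq
  rw [← integral_eq]
  refine (ENNReal.ofReal_le_ofReal (Real.le_norm_self _)).trans ?_
  rw [ofReal_norm]
  refine (enorm_integral_le_lintegral_enorm _).trans_eq (lintegral_congr fun x => ?_)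
  rw [enorm_mul, mul_comm]

theorem Carleson.lintegral_tsum_block_mul_le (hb : h.Carleson b B) (hB : 0 < B)
    (hC : h.MassBound C) (a : D.HaarIndex → ℝ) {k : ℤ}
    (ha : ∀ Q, D.level Q < k → h.block a Q = 0) :
    ∫⁻ x, ∑' Q, ‖h.block a Q x‖ₑ * ‖h.block b Q x‖ₑ ∂μ ≤
      2 * (B * (2 ^ n * C + 1) : ℝ≥0) * h.hardyNorm a := by
  have fefferman := D.lintegral_tsum_mul_le (μ := μ) (k := k)
    (φ := fun m x => ‖h.block a (D.cellCube (k + m) x) x‖₊)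
    (ψ := fun m x => ‖h.block b (D.cellCube (k + m) x) x‖₊)
    (fun m => (h.adapted_block_cellCube a (k + m)).comp _)
    (fun m => ((h.adapted_block_cellCube b (k + m)).comp _).measurable)
    (B := B * (2 ^ n * C + 1)) (by positivity) fun i Q hQ => by
      simpa only [Nat.cast_add, add_assoc] using hb.lintegral_tail_le hC (k := k + i) hQ
  refine Eq.trans_le (lintegral_congr fun x => ?_) (fefferman.trans_eq ?_)
  · exact D.tsum_eq_tsum_cellCube_nat x k (fun Q hQ => by simp [h.block_eq_zero a hQ])
      fun Q hQ => by simp [ha Q hQ]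
  · congr 1
    refine lintegral_congr fun x => ?_
    rw [D.tsum_eq_tsum_cellCube_nat x k (fun Q hQ => by simp [h.block_eq_zero a hQ])
      fun Q hQ => by simp [ha Q hQ]]
    rfl

theorem Carleson.pairing_le (hb : h.Carleson b B) (hB : 0 < B) (hC : h.MassBound C)
    (a : D.HaarIndex → ℝ) (G : Finset D.cubes) :
    ENNReal.ofReal (∑ Q ∈ G, ∑ j, a (Q, j) * b (Q, j)) ≤
      2 * (B * (2 ^ n * C + 1) : ℝ≥0) * h.hardyNorm (restrictCubes G a) := by
  classical
  obtain ⟨k, hk⟩ := (G.image D.level).bddBelow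
  have block_eq_zero_of_level : ∀ Q, D.level Q < k → h.block (restrictCubes G a) Q = 0 :=
    fun Q hQ => h.block_restrictCubes_of_notMem a fun hG =>
      hQ.not_ge (hk (Finset.mem_coe.2 (Finset.mem_image_of_mem _ hG)))
  calc ENNReal.ofReal (∑ Q ∈ G, ∑ j, a (Q, j) * b (Q, j))
    _ ≤ ∑ Q ∈ G, ENNReal.ofReal (∑ j, a (Q, j) * b (Q, j)) :=
        Finset.le_sum_of_subadditive _ ENNReal.ofReal_zero.le (fun _ _ => ENNReal.ofReal_add_le) _ _
    _ ≤ ∑ Q ∈ G, ∫⁻ x, ‖h.block (restrictCubes G a) Q x‖ₑ * ‖h.block b Q x‖ₑ ∂μ :=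
        Finset.sum_le_sum fun Q hQ => by
          rw [h.block_restrictCubes_of_mem a (Finset.mem_coe.2 hQ)]
          exact h.ofReal_sum_mul_le a b Q
    _ = ∫⁻ x, ∑ Q ∈ G, ‖h.block (restrictCubes G a) Q x‖ₑ * ‖h.block b Q x‖ₑ ∂μ :=
        (lintegral_finsetSum _ fun Q _ =>
          (h.measurable_block _ Q).enorm.mul (h.measurable_block b Q).enorm).symm
    _ ≤ ∫⁻ x, ∑' Q, ‖h.block (restrictCubes G a) Q x‖ₑ * ‖h.block b Q x‖ₑ ∂μ :=
        lintegral_mono fun x => ENNReal.sum_le_tsum _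
    _ ≤ 2 * (B * (2 ^ n * C + 1) : ℝ≥0) * h.hardyNorm (restrictCubes G a) :=
        hb.lintegral_tsum_block_mul_le hB hC _ block_eq_zero_of_level

end Duality

section Bounded

theorem abs_le_one_of_tsum_sq_le {ι : Type*} {a : ι → ℝ} (ha : ∑' i, ‖a i‖ₑ ^ 2 ≤ 1) (i : ι) :
    |a i| ≤ 1 := by
  have enorm_sq_le := (ENNReal.le_tsum (f := fun i => ‖a i‖ₑ ^ 2) i).trans ha
  rwa [pow_le_one_iff two_ne_zero, Real.enorm_eq_ofReal_abs, ENNReal.ofReal_le_one] at enorm_sq_le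

variable {v : (Fin n → ℝ) → ℝ} [D.PosFinite μ]

theorem memLp_restrict_of_abs_le_one (hv : Measurable v) (hv_le : ∀ x, |v x| ≤ 1) (q : ℝ≥0∞)
    (Q : D.cubes) : MemLp v q (μ.restrict Q.1) := by
  have : IsFiniteMeasure (μ.restrict Q.1) :=
    isFiniteMeasure_restrict.2 (D.measure_lt_top_of_gen (D.mem_gen_level Q)).ne
  exact MemLp.of_bound hv.aestronglyMeasurable 1 (Eventually.of_forall hv_le)

theorem integrableOn_of_abs_le_one (hv : Measurable v) (hv_le : ∀ x, |v x| ≤ 1) (Q : D.cubes) :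
    IntegrableOn v Q.1 μ :=
  memLp_one_iff_integrable.1 (memLp_restrict_of_abs_le_one hv hv_le 1 Q)

theorem tsum_indicator_below_coef_sq_le (h : HaarSystem D μ) (hv : Measurable v)
    (hv_le : ∀ x, |v x| ≤ 1) (Q : D.cubes) :
    ∑' p, (D.below Q.1).indicator (fun p => ‖h.coef v p‖ₑ ^ 2) p ≤
      ∫⁻ x in Q.1, ‖v x‖ₑ ^ 2 ∂μ := by
  have measurableSet_Q := D.measurableSet_of_gen (D.mem_gen_level Q)
  have memLp_indicator : MemLp (Q.1.indicator v) 2 μ :=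
    (memLp_indicator_iff_restrict measurableSet_Q).2 (memLp_restrict_of_abs_le_one hv hv_le 2 Q)
  calc ∑' p, (D.below Q.1).indicator (fun p => ‖h.coef v p‖ₑ ^ 2) p
    _ ≤ ∑' p, ‖h.coef (Q.1.indicator v) p‖ₑ ^ 2 := by
        refine ENNReal.tsum_le_tsum fun p => ?_
        by_cases hp : p ∈ D.below Q.1
        · rw [indicator_of_mem hp, h.coef_congr_restrict (f := v) (g := Q.1.indicator v)]
          filter_upwards [ae_restrict_mem (D.measurableSet_of_gen (D.mem_gen_level p.1))]
            with x hx
          rw [indicator_of_mem (hp hx)]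
        · rw [indicator_of_notMem hp]
          exact zero_le
    _ = ∫⁻ x in Q.1, ‖v x‖ₑ ^ 2 ∂μ := by
        rw [h.tsum_coef_sq memLp_indicator, ← lintegral_indicator measurableSet_Q]
        refine lintegral_congr fun x => ?_
        by_cases hx : x ∈ Q.1 <;> simp [hx]

theorem sum_coef_sq_le (h : HaarSystem D μ) (hv : Measurable v) (hv_le : ∀ x, |v x| ≤ 1)
    (Q : D.cubes) : ∑ j, ‖h.coef v (Q, j)‖ₑ ^ 2 ≤ ∫⁻ x in Q.1, ‖v x‖ₑ ^ 2 ∂μ := by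
  refine le_trans ?_ (h.tsum_indicator_below_coef_sq_le hv hv_le Q)
  rw [ENNReal.tsum_prod']
  refine le_of_eq_of_le ?_ (ENNReal.le_tsum Q)
  rw [tsum_fintype]
  exact Finset.sum_congr rfl fun j _ =>
    (indicator_of_mem (f := fun p => ‖h.coef v p‖ₑ ^ 2)
      (show (Q, j) ∈ D.below Q.1 from Subset.rfl)).symm

variable [NeZero n]

theorem abs_coef_le (h : HaarSystem D μ) (hv : Measurable v) (hv_le : ∀ x, |v x| ≤ 1)
    (p : D.HaarIndex) : |h.coef v p| ≤ h.mass p := by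
  refine (abs_integral_le_integral_abs (f := fun x => v x * h.haar p x)).trans ?_
  refine integral_mono (h.integrable_mul_haar (integrableOn_of_abs_le_one hv hv_le p.1)).abs
    (h.integrable_haar p).abs fun x => ?_
  simp only [abs_mul]
  exact mul_le_of_le_one_left (abs_nonneg _) (hv_le x)

theorem carleson_coef (h : HaarSystem D μ) (hv : Measurable v) (hv_le : ∀ x, |v x| ≤ 1) :
    h.Carleson (h.coef v) 1 where
  abs_le p := by simpa using h.abs_coef_le hv hv_le p
  tsum_le Q := by
    refine (h.tsum_indicator_below_coef_sq_le hv hv_le Q).trans ?_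
    rw [ENNReal.coe_one, one_pow, one_mul, ← setLIntegral_one]
    refine lintegral_mono fun x => pow_le_one₀ zero_le ?_
    rw [Real.enorm_eq_ofReal_abs, ENNReal.ofReal_le_one]
    exact hv_le x

theorem carleson_coef_of_tsum_sq_le (h : HaarSystem D μ) {u : D.cubes → (Fin n → ℝ) → ℝ}
    (hu : ∀ Q, Measurable (u Q)) (hu_sq : ∀ x, ∑' Q, ‖u Q x‖ₑ ^ 2 ≤ 1) :
    h.Carleson (fun p => h.coef (u p.1) p) 1 := by
  have abs_u_le : ∀ Q x, |u Q x| ≤ 1 := fun Q x =>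
    abs_le_one_of_tsum_sq_le (hu_sq x) Q
  refine ⟨fun p => by simpa using h.abs_coef_le (hu p.1) (abs_u_le p.1) p, fun Q => ?_⟩
  rw [ENNReal.tsum_prod', ENNReal.coe_one, one_pow, one_mul]
  calc ∑' S, ∑' j, (D.below Q.1).indicator (fun p => ‖h.coef (u p.1) p‖ₑ ^ 2) (S, j)
    _ ≤ ∑' S, ∫⁻ x in Q.1, ‖u S x‖ₑ ^ 2 ∂μ := by
        refine ENNReal.tsum_le_tsum fun S => ?_
        by_cases hS : S.1 ⊆ Q.1
        · refine le_trans (le_of_eq ?_) ((h.sum_coef_sq_le (hu S) (abs_u_le S) S).trans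
            (lintegral_mono_set hS))
          rw [tsum_fintype]
          exact Finset.sum_congr rfl fun j _ =>
            indicator_of_mem (show (S, j) ∈ D.below Q.1 from hS) _
        · refine le_of_eq_of_le ?_ zero_le
          rw [ENNReal.tsum_eq_zero]
          exact fun j => indicator_of_notMem (show (S, j) ∉ D.below Q.1 from hS) _
    _ = ∫⁻ x in Q.1, ∑' S, ‖u S x‖ₑ ^ 2 ∂μ :=
        (lintegral_tsum fun S => ((hu S).enorm.pow_const 2).aemeasurable).symm
    _ ≤ ∫⁻ _ in Q.1, 1 ∂μ := lintegral_mono hu_sq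
    _ = μ Q.1 := setLIntegral_one _

/-- Davis' inequality for finite Haar sums, obtained by pairing the sum with its sign. -/
theorem lintegral_sum_block_le (h : HaarSystem D μ) {C : ℝ≥0} (hC : h.MassBound C)
    (c : D.HaarIndex → ℝ) (G : Finset D.cubes) :
    ∫⁻ x, ‖∑ Q ∈ G, h.block c Q x‖ₑ ∂μ ≤
      2 * (2 ^ n * C + 1 : ℝ≥0) * h.hardyNorm (restrictCubes G c) := by
  set u : (Fin n → ℝ) → ℝ := fun x => ∑ Q ∈ G, h.block c Q x
  have measurable_u : Measurable u :=
    Finset.measurable_fun_sum _ fun Q _ => h.measurable_block c Q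
  have integrable_u : Integrable u μ := integrable_finsetSum _ fun Q _ => h.integrable_block c Q
  set v : (Fin n → ℝ) → ℝ := fun x => if 0 ≤ u x then 1 else -1 with v_def
  have measurable_v : Measurable v :=
    Measurable.ite (measurableSet_le measurable_const measurable_u) measurable_const
      measurable_const
  have abs_v_le : ∀ x, |v x| ≤ 1 := fun x => by
    simp only [v_def]
    split_ifs <;> simp
  have v_mul_u : ∀ x, v x * u x = |u x| := fun x => by
    simp only [v_def]
    split_ifs with hx
    · rw [abs_of_nonneg hx, one_mul]
    · rw [abs_of_neg (not_le.1 hx), neg_one_mul]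
  have integrableOn_v := integrableOn_of_abs_le_one (D := D) (μ := μ) measurable_v abs_v_le
  have pairing_eq : ∑ Q ∈ G, ∑ j, c (Q, j) * h.coef v (Q, j) = ∫ x, |u x| ∂μ := by
    simp only [← v_mul_u, u, Finset.mul_sum]
    rw [integral_finsetSum _ fun Q _ => h.integrable_mul_block c Q (integrableOn_v Q)]
    exact Finset.sum_congr rfl fun Q _ => (h.integral_mul_block c Q (integrableOn_v Q)).symm
  have pairing_le := (h.carleson_coef measurable_v abs_v_le).pairing_le one_pos hC c G
  rw [one_mul, pairing_eq] at pairing_le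
  rwa [← ofReal_integral_norm_eq_lintegral_enorm integrable_u]

end Bounded

section Normalized

theorem tsum_block_restrictCubes (h : HaarSystem D μ) (c : D.HaarIndex → ℝ) (G : Finset D.cubes)
    (x : Fin n → ℝ) :
    ∑' Q, ‖h.block (restrictCubes G c) Q x‖ₑ ^ 2 = ∑ Q ∈ G, ‖h.block c Q x‖ₑ ^ 2 := by
  rw [tsum_eq_sum (s := G)]
  · exact Finset.sum_congr rfl fun Q hQ => by
      rw [h.block_restrictCubes_of_mem c (Finset.mem_coe.2 hQ)]
  · intro Q hQ
    simp [h.block_restrictCubes_of_notMem c (mt Finset.mem_coe.1 hQ)]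

/-- The square function of the part of the Haar series with coefficients `c` that belongs to
finitely many cubes. -/
noncomputable def finsetSquareFn (h : HaarSystem D μ) (c : D.HaarIndex → ℝ) (G : Finset D.cubes)
    (x : Fin n → ℝ) : ℝ :=
  √(∑ Q ∈ G, h.block c Q x ^ 2)

/-- The blocks of a finite Haar series divided by its square function; `0` where the latter
vanishes. -/
noncomputable def normalizedBlock (h : HaarSystem D μ) (c : D.HaarIndex → ℝ) (G : Finset D.cubes)
    (Q : D.cubes) (x : Fin n → ℝ) : ℝ :=
  h.block (restrictCubes G c) Q x / h.finsetSquareFn c G x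

variable (h : HaarSystem D μ) (c : D.HaarIndex → ℝ) (G : Finset D.cubes)

theorem finsetSquareFn_nonneg (x : Fin n → ℝ) : 0 ≤ h.finsetSquareFn c G x :=
  Real.sqrt_nonneg _

theorem finsetSquareFn_sq (x : Fin n → ℝ) :
    h.finsetSquareFn c G x ^ 2 = ∑ Q ∈ G, h.block c Q x ^ 2 :=
  Real.sq_sqrt (Finset.sum_nonneg fun Q _ => sq_nonneg (h.block c Q x))

theorem tsum_block_restrictCubes_eq_ofReal (x : Fin n → ℝ) :
    ∑' Q, ‖h.block (restrictCubes G c) Q x‖ₑ ^ 2 =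
      ENNReal.ofReal (h.finsetSquareFn c G x ^ 2) := by
  rw [h.tsum_block_restrictCubes, finsetSquareFn_sq,
    ENNReal.ofReal_sum_of_nonneg fun _ _ => sq_nonneg _]
  exact Finset.sum_congr rfl fun Q _ => by
    rw [← enorm_pow, Real.enorm_of_nonneg (sq_nonneg _)]

theorem hardyNorm_restrictCubes_eq :
    h.hardyNorm (restrictCubes G c) = ∫⁻ x, ENNReal.ofReal (h.finsetSquareFn c G x) ∂μ := by
  refine lintegral_congr fun x => ?_
  rw [tsum_block_restrictCubes_eq_ofReal, ENNReal.ofReal_rpow_of_nonneg (sq_nonneg _) (by norm_num),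
    ← Real.sqrt_eq_rpow, Real.sqrt_sq (h.finsetSquareFn_nonneg c G x)]

theorem tsum_normalizedBlock_sq_le (x : Fin n → ℝ) :
    ∑' Q, ‖h.normalizedBlock c G Q x‖ₑ ^ 2 ≤ 1 := by
  have enorm_sq : ∀ Q, ‖h.normalizedBlock c G Q x‖ₑ ^ 2 =
      ‖h.block (restrictCubes G c) Q x‖ₑ ^ 2 * ENNReal.ofReal ((h.finsetSquareFn c G x)⁻¹ ^ 2) :=
    fun Q => by
      rw [normalizedBlock, div_eq_mul_inv, enorm_mul, mul_pow, ← enorm_pow _⁻¹,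
        Real.enorm_of_nonneg (sq_nonneg _)]
  simp only [enorm_sq]
  rw [ENNReal.tsum_mul_right, tsum_block_restrictCubes_eq_ofReal,
    ← ENNReal.ofReal_mul (sq_nonneg _), ENNReal.ofReal_le_one, inv_pow]
  exact mul_inv_le_one

theorem sum_normalizedBlock_mul_block (x : Fin n → ℝ) :
    ∑ Q ∈ G, h.normalizedBlock c G Q x * h.block c Q x = h.finsetSquareFn c G x := by
  calc ∑ Q ∈ G, h.normalizedBlock c G Q x * h.block c Q x
    _ = ∑ Q ∈ G, h.block c Q x ^ 2 / h.finsetSquareFn c G x :=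
        Finset.sum_congr rfl fun Q hQ => by
          rw [normalizedBlock, h.block_restrictCubes_of_mem c (Finset.mem_coe.2 hQ)]
          ring
    _ = h.finsetSquareFn c G x := by
        rw [← Finset.sum_div, ← finsetSquareFn_sq, sq, mul_self_div_self]

variable [NeZero n]

theorem measurable_normalizedBlock (Q : D.cubes) : Measurable (h.normalizedBlock c G Q) :=
  (h.measurable_block _ Q).div
    (Finset.measurable_fun_sum _ fun Q _ => (h.measurable_block c Q).pow_const 2).sqrt

theorem exists_carleson_pairing [D.PosFinite μ] :
    ∃ b, h.Carleson b 1 ∧ (∀ p, p.1 ∉ G → b p = 0) ∧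
      h.hardyNorm (restrictCubes G c) = ENNReal.ofReal (∑ Q ∈ G, ∑ j, c (Q, j) * b (Q, j)) := by
  set u := h.normalizedBlock c G
  have integrableOn_u : ∀ Q : D.cubes, IntegrableOn (u Q) Q.1 μ := fun Q =>
    integrableOn_of_abs_le_one (h.measurable_normalizedBlock c G Q) (fun x =>
      abs_le_one_of_tsum_sq_le (h.tsum_normalizedBlock_sq_le c G x) Q) Q
  refine ⟨fun p => h.coef (u p.1) p, h.carleson_coef_of_tsum_sq_le
    (h.measurable_normalizedBlock c G) (h.tsum_normalizedBlock_sq_le c G), fun p hp => ?_, ?_⟩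
  · have u_eq_zero : u p.1 = fun _ => 0 := funext fun x => by
      simp [u, normalizedBlock, h.block_restrictCubes_of_notMem c (mt Finset.mem_coe.1 hp)]
    simp only [u_eq_zero]
    exact h.coef_const 0 p
  · have integrable_term : ∀ Q ∈ G, Integrable (fun x => u Q x * h.block c Q x) μ := fun Q _ =>
      h.integrable_mul_block c Q (integrableOn_u Q)
    have integrable_squareFn : Integrable (h.finsetSquareFn c G) μ :=
      (integrable_finsetSum _ integrable_term).congr
        (Eventually.of_forall (h.sum_normalizedBlock_mul_block c G))
    have pairing_eq : ∑ Q ∈ G, ∑ j, c (Q, j) * h.coef (u Q) (Q, j) =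
        ∫ x, h.finsetSquareFn c G x ∂μ := by
      rw [← funext (h.sum_normalizedBlock_mul_block c G), integral_finsetSum _ integrable_term]
      exact Finset.sum_congr rfl fun Q _ => (h.integral_mul_block c Q (integrableOn_u Q)).symm
    rw [pairing_eq, h.hardyNorm_restrictCubes_eq, ofReal_integral_eq_lintegral_ofReal
      integrable_squareFn (Eventually.of_forall (h.finsetSquareFn_nonneg c G))]

theorem hardyNorm_le_of_forall_restrictCubes_le {A : ℝ≥0∞}
    (hA : ∀ G : Finset D.cubes, h.hardyNorm (restrictCubes G c) ≤ A) : h.hardyNorm c ≤ A := by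
  have squareFn_eq_iSup : ∀ x, (∑' Q, ‖h.block c Q x‖ₑ ^ 2) ^ (1 / 2 : ℝ) =
      ⨆ G : Finset D.cubes,
        (∑' Q, ‖h.block (restrictCubes G c) Q x‖ₑ ^ 2) ^ (1 / 2 : ℝ) := fun x => by
    simp only [h.tsum_block_restrictCubes]
    rw [ENNReal.tsum_eq_iSup_sum]
    exact (ENNReal.orderIsoRpow (1 / 2) (by norm_num)).map_iSup _
  rw [hardyNorm, lintegral_congr squareFn_eq_iSup, lintegral_iSup_directed]
  · exact iSup_le hA
  · exact fun G => (h.measurable_tsum_block _).aemeasurable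
  · refine Monotone.directed_le fun G G' hG x => ?_
    simp only [h.tsum_block_restrictCubes]
    exact ENNReal.rpow_le_rpow (Finset.sum_le_sum_of_subset hG) (by norm_num)

end Normalized

end HaarSystem

namespace DyadicSystem

variable {n : ℕ} {D : DyadicSystem n} {r s : ℕ}

/-- The cubes `R` and `S` are descendants, of the `r`-th and of the `s`-th generation, of the same
cube. -/
def Near (r s : ℕ) (R S : D.cubes) : Prop :=
  ∃ Q : D.cubes, R.1 ∈ D.desc r Q.1 ∧ S.1 ∈ D.desc s Q.1

theorem Near.symm {R S : D.cubes} : Near r s R S → Near s r S R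
  | ⟨Q, hR, hS⟩ => ⟨Q, hS, hR⟩

variable [NeZero n]

theorem near_iff {R S : D.cubes} {x : Fin n → ℝ} (hx : x ∈ S.1) :
    Near r s R S ↔ R.1 ∈ D.desc r (D.cell (D.level S - s) x) := by
  constructor
  · rintro ⟨Q, hR, k, hQ, hS, hSQ⟩
    have level_sub : D.level S - s = k := by
      rw [D.level_eq hS, add_sub_cancel_right]
    rwa [level_sub, D.cell_eq hQ (hSQ hx)]
  · intro hR
    refine ⟨D.cellCube (D.level S - s) x, hR, ?_⟩
    have cell_mem_desc := D.cell_mem_desc (D.level S - s) s x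
    rwa [sub_add_cancel, D.cell_eq (D.mem_gen_level S) hx] at cell_mem_desc

theorem Near.subset {R S : D.cubes} (hRS : Near r s R S) {k : ℤ} {Q : Set (Fin n → ℝ)}
    (hQ : Q ∈ D.gen k) (hSQ : S.1 ⊆ Q) (hk : k + s ≤ D.level S) : R.1 ⊆ Q := by
  obtain ⟨x, hx⟩ := D.nonempty_of_gen (D.mem_gen_level S)
  obtain ⟨l, -, -, hR⟩ := (near_iff hx).1 hRS
  exact hR.trans (D.cell_subset_of_mem_gen (by omega) hQ (hSQ hx))

theorem encard_setOf_near_le (r s : ℕ) (S : D.cubes) :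
    {R | Near r s R S}.encard ≤ (2 ^ (n * r) : ℕ) := by
  obtain ⟨x, hx⟩ := D.nonempty_of_gen (D.mem_gen_level S)
  rw [← Subtype.val_injective.encard_image]
  refine (encard_le_encard ?_).trans (D.encard_desc_le r (D.cell (D.level S - s) x))
  rintro _ ⟨R, hR, rfl⟩
  exact (near_iff hx).1 hR

theorem finite_setOf_near (r s : ℕ) (S : D.cubes) : {R | Near r s R S}.Finite :=
  finite_of_encard_le_coe (encard_setOf_near_le r s S)

/-- The finite set of the cubes `R` such that `Near r s R S`. -/
noncomputable def nearCubes (r s : ℕ) (S : D.cubes) : Finset D.cubes :=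
  (finite_setOf_near r s S).toFinset

theorem mem_nearCubes {R S : D.cubes} : R ∈ nearCubes r s S ↔ Near r s R S :=
  (finite_setOf_near r s S).mem_toFinset

theorem card_nearCubes_le (r s : ℕ) (S : D.cubes) : (nearCubes r s S).card ≤ 2 ^ (n * r) := by
  have encard_le := encard_setOf_near_le r s S
  rw [(finite_setOf_near r s S).encard_eq_coe_toFinset_card] at encard_le
  exact_mod_cast encard_le

/-- The cubes contained in `Q` of fewer than `s` generations below `k`, the generation of `Q`. -/
def topCubes (D : DyadicSystem n) (k : ℤ) (s : ℕ) (Q : Set (Fin n → ℝ)) : Set D.cubes :=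
  {S | S.1 ⊆ Q ∧ D.level S < k + s}

theorem tsum_indicator_topCubes_le {k : ℤ} {Q : Set (Fin n → ℝ)} (hQ : Q ∈ D.gen k) (s : ℕ)
    (x : Fin n → ℝ) :
    ∑' S, (D.topCubes k s Q).indicator (fun S => S.1.indicator (1 : (Fin n → ℝ) → ℝ≥0∞) x) S ≤
      Q.indicator (fun _ => (s : ℝ≥0∞)) x := by
  rw [D.tsum_eq_tsum_cellCube_nat x k
    (F := (D.topCubes k s Q).indicator fun S => S.1.indicator 1 x)
    (fun S hS => indicator_apply_eq_zero.2 fun _ => indicator_of_notMem hS _)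
    fun S hS => indicator_of_notMem (fun hS' =>
      hS.not_ge (D.le_of_gen_subset hQ (D.mem_gen_level S) hS'.1)) _]
  by_cases hx : x ∈ Q
  · rw [indicator_of_mem hx, tsum_eq_sum (s := Finset.range s)]
    · refine (Finset.sum_le_card_nsmul _ _ 1 fun m _ => ?_).trans (by simp)
      exact (indicator_le_self' (fun _ _ => bot_le) _).trans
        (indicator_le_self' (fun _ _ => bot_le) _)
    · intro m hm
      refine indicator_of_notMem (fun hS => hm (Finset.mem_range.2 ?_)) _
      simpa [D.level_cellCube] using hS.2
  · refine le_of_eq_of_le (ENNReal.tsum_eq_zero.2 fun m => ?_) zero_le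
    exact indicator_of_notMem (fun hS => hx (hS.1 (D.mem_cell _ x))) _

theorem tsum_measure_topCubes_le {μ : Measure (Fin n → ℝ)} {k : ℤ} {Q : Set (Fin n → ℝ)}
    (hQ : Q ∈ D.gen k) (s : ℕ) :
    ∑' S, (D.topCubes k s Q).indicator (fun S => μ S.1) S ≤ s * μ Q := by
  have measurableSet_cube : ∀ S : D.cubes, MeasurableSet S.1 := fun S =>
    D.measurableSet_of_gen (D.mem_gen_level S)
  have lintegral_eq : ∀ S, (D.topCubes k s Q).indicator (fun S => μ S.1) S =
      ∫⁻ x, (D.topCubes k s Q).indicator (fun S => S.1.indicator 1 x) S ∂μ := fun S => by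
    by_cases hS : S ∈ D.topCubes k s Q
    · simp only [indicator_of_mem hS]
      exact (lintegral_indicator_one (measurableSet_cube S)).symm
    · simp [hS]
  have measurable_term : ∀ S, Measurable fun x => (D.topCubes k s Q).indicator
      (fun S => S.1.indicator (1 : (Fin n → ℝ) → ℝ≥0∞) x) S := fun S => by
    by_cases hS : S ∈ D.topCubes k s Q
    · simp only [indicator_of_mem hS]
      exact measurable_one.indicator (measurableSet_cube S)
    · simp only [indicator_of_notMem hS, measurable_const]
  rw [tsum_congr lintegral_eq, ← lintegral_tsum fun S => (measurable_term S).aemeasurable]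
  exact (lintegral_mono (tsum_indicator_topCubes_le hQ s)).trans_eq
    (lintegral_indicator_const (D.measurableSet_of_gen hQ) _)

end DyadicSystem

namespace HaarSystem

open DyadicSystem

variable {n : ℕ} {D : DyadicSystem n} {μ : Measure (Fin n → ℝ)} {r s : ℕ}
  {T : Lp ℝ 2 μ →L[ℝ] Lp ℝ 2 μ}

section Act

/-- The matrix in the Haar basis of an operator on `L²(μ)`. -/
noncomputable def matrix (h : HaarSystem D μ) (T : Lp ℝ 2 μ →L[ℝ] Lp ℝ 2 μ)
    (p q : D.HaarIndex) : ℝ :=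
  inner ℝ (h.vec p.1 p.2) (T (h.vec q.1 q.2))

/-- The action on sequences of Haar coefficients of an operator on `L²(μ)`, with the junk value `0`
where the series diverges. -/
noncomputable def act (h : HaarSystem D μ) (T : Lp ℝ 2 μ →L[ℝ] Lp ℝ 2 μ) (a : D.HaarIndex → ℝ)
    (p : D.HaarIndex) : ℝ :=
  ∑' q, h.matrix T p q * a q

/-- The property of Haar shifts that is used for their boundedness: the matrix vanishes off the
pairs of cubes that are near. -/
def IsShift (h : HaarSystem D μ) (r s : ℕ) (T : Lp ℝ 2 μ →L[ℝ] Lp ℝ 2 μ) : Prop :=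
  ∀ p q, h.matrix T p q ≠ 0 → Near r s q.1 p.1

variable (h : HaarSystem D μ)

theorem matrix_adjoint (T : Lp ℝ 2 μ →L[ℝ] Lp ℝ 2 μ) (p q : D.HaarIndex) :
    h.matrix (ContinuousLinearMap.adjoint T) p q = h.matrix T q p := by
  rw [matrix, matrix, ContinuousLinearMap.adjoint_inner_right, real_inner_comm]

theorem abs_matrix_le (T : Lp ℝ 2 μ →L[ℝ] Lp ℝ 2 μ) (p q : D.HaarIndex) :
    |h.matrix T p q| ≤ ‖T‖ := by
  have norm_vec : ∀ p : D.HaarIndex, ‖h.vec p.1 p.2‖ = 1 := h.orthonormal.norm_eq_one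
  calc |h.matrix T p q| ≤ ‖h.vec p.1 p.2‖ * ‖T (h.vec q.1 q.2)‖ := abs_real_inner_le_norm _ _
    _ ≤ ‖h.vec p.1 p.2‖ * (‖T‖ * ‖h.vec q.1 q.2‖) := by
        gcongr
        exact T.le_opNorm _
    _ = ‖T‖ := by rw [norm_vec, norm_vec, one_mul, mul_one]

theorem coef_apply (T : Lp ℝ 2 μ →L[ℝ] Lp ℝ 2 μ) (F : Lp ℝ 2 μ) :
    h.coef (T F) = h.act T (h.coef F) := by
  funext p
  rw [← h.inner_vec, ← ContinuousLinearMap.adjoint_inner_left, ← h.basis.tsum_inner_mul_inner]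
  refine tsum_congr fun q => ?_
  rw [ContinuousLinearMap.adjoint_inner_left, h.basis_apply, h.inner_vec q, matrix]

theorem act_smul (T : Lp ℝ 2 μ →L[ℝ] Lp ℝ 2 μ) (c : ℝ) (a : D.HaarIndex → ℝ) :
    h.act T (c • a) = c • h.act T a := by
  funext p
  simp only [act, Pi.smul_apply, smul_eq_mul, ← tsum_mul_left, mul_left_comm]

theorem act_eq_sum_of_support (T : Lp ℝ 2 μ →L[ℝ] Lp ℝ 2 μ) {a : D.HaarIndex → ℝ}
    (p : D.HaarIndex) {G : Finset D.cubes} (hG : ∀ q, q.1 ∉ G → a q = 0) :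
    h.act T a p = ∑ q ∈ G ×ˢ Finset.univ, h.matrix T p q * a q :=
  tsum_eq_sum fun q hq => by
    rw [hG q fun hq' => hq (Finset.mem_product.2 ⟨hq', Finset.mem_univ _⟩), mul_zero]

variable {h}

theorem IsHaarShift.isShift (hT : h.IsHaarShift r s T) : h.IsShift r s T := by
  classical
  obtain ⟨α, hα⟩ := hT
  intro p q hpq
  by_contra hnear
  have inner_vec_vec : ∀ p q : D.HaarIndex,
      inner ℝ (h.vec p.1 p.2) (h.vec q.1 q.2) = if p = q then (1 : ℝ) else 0 :=
    orthonormal_iff_ite.1 h.orthonormal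
  refine hpq (((hα (h.vec q.1 q.2)).mapL (innerSL ℝ (h.vec p.1 p.2))).unique
    (HasSum.congr_fun hasSum_zero fun t => ?_))
  rw [innerSL_apply_apply, real_inner_smul_right, inner_vec_vec (t.1.1.2.1, t.2.1) q,
    inner_vec_vec p (t.1.1.2.2, t.2.2)]
  split_ifs with hR hS
  · refine absurd ⟨t.1.1.1, ?_⟩ hnear
    rw [← hR, hS]
    exact t.1.2
  all_goals simp

theorem IsShift.adjoint (hT : h.IsShift r s T) :
    h.IsShift s r (ContinuousLinearMap.adjoint T) := fun p q hpq =>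
  (hT q p (h.matrix_adjoint T p q ▸ hpq)).symm

theorem IsShift.act_congr (hT : h.IsShift r s T) {a b : D.HaarIndex → ℝ} {p : D.HaarIndex}
    (hab : ∀ q : D.HaarIndex, Near r s q.1 p.1 → a q = b q) : h.act T a p = h.act T b p := by
  refine tsum_congr fun q => ?_
  by_cases matrix_eq_zero : h.matrix T p q = 0
  · simp [matrix_eq_zero]
  · rw [hab q (hT p q matrix_eq_zero)]

variable [NeZero n]

theorem IsShift.act_eq_sum (hT : h.IsShift r s T) (a : D.HaarIndex → ℝ) (p : D.HaarIndex)
    {G : Finset D.cubes} (hG : nearCubes r s p.1 ⊆ G) :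
    h.act T a p = ∑ q ∈ G ×ˢ Finset.univ, h.matrix T p q * a q := by
  refine tsum_eq_sum fun q hq => ?_
  by_contra mul_ne_zero
  exact hq (Finset.mem_product.2
    ⟨hG (mem_nearCubes.2 (hT p q (left_ne_zero_of_mul mul_ne_zero))), Finset.mem_univ _⟩)

theorem IsShift.act_add (hT : h.IsShift r s T) (a b : D.HaarIndex → ℝ) :
    h.act T (a + b) = h.act T a + h.act T b := by
  funext p
  simp only [Pi.add_apply, hT.act_eq_sum _ p subset_rfl, mul_add, Finset.sum_add_distrib]

theorem IsShift.sum_act_mul [DecidableEq D.cubes] (hT : h.IsShift r s T) (a : D.HaarIndex → ℝ)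
    {b : D.HaarIndex → ℝ} {G : Finset D.cubes} (hb : ∀ p, p.1 ∉ G → b p = 0) :
    ∑ Q ∈ G, ∑ j, h.act T a (Q, j) * b (Q, j) =
      ∑ R ∈ G.biUnion (nearCubes r s), ∑ i,
        a (R, i) * h.act (ContinuousLinearMap.adjoint T) b (R, i) := by
  rw [← Finset.sum_product' (f := fun Q j => h.act T a (Q, j) * b (Q, j)),
    ← Finset.sum_product' (f := fun R i => a (R, i) *
      h.act (ContinuousLinearMap.adjoint T) b (R, i))]
  have act_mul : ∀ p ∈ G ×ˢ (Finset.univ : Finset (Fin (2 ^ n - 1))), h.act T a p * b p =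
      ∑ q ∈ G.biUnion (nearCubes r s) ×ˢ Finset.univ, h.matrix T p q * a q * b p :=
    fun p hp => by
      rw [hT.act_eq_sum a p (Finset.subset_biUnion_of_mem (nearCubes r s)
        (Finset.mem_product.1 hp).1), Finset.sum_mul]
  have mul_act : ∀ q, a q * h.act (ContinuousLinearMap.adjoint T) b q =
      ∑ p ∈ G ×ˢ Finset.univ, h.matrix T p q * a q * b p := fun q => by
    rw [h.act_eq_sum_of_support _ q hb, Finset.mul_sum]
    refine Finset.sum_congr rfl fun p _ => ?_
    rw [matrix_adjoint]
    ring
  rw [Finset.sum_congr rfl act_mul, Finset.sum_comm]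
  exact Finset.sum_congr rfl fun q _ => (mul_act q).symm

theorem MassBound.mass_le_of_near {C : ℝ≥0} (hC : h.MassBound C) {p q : D.HaarIndex}
    (hpq : Near r s q.1 p.1) : h.mass q ≤ C ^ (r + s + 4) * h.mass p := by
  obtain ⟨Q, hq, hp⟩ := hpq
  calc h.mass q ≤ C ^ (r + 2) * h.mass (Q, q.2) := (hC.mass_le_of_mem_desc r (Q, q.2) q hq).2
    _ ≤ C ^ (r + 2) * (C ^ (s + 2) * h.mass p) := by
        gcongr
        exact (hC.mass_le_of_mem_desc s (Q, q.2) p hp).1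
    _ = C ^ (r + s + 4) * h.mass p := by ring

/-- The constant in the coefficientwise bound for the action of a shift. -/
noncomputable def actConst (n : ℕ) (C : ℝ≥0) (r s : ℕ) (T : Lp ℝ 2 μ →L[ℝ] Lp ℝ 2 μ) : ℝ≥0 :=
  2 ^ (n * r) * 2 ^ n * (‖T‖₊ * C ^ (r + s + 4))

theorem IsShift.abs_act_le (hT : h.IsShift r s T) {C B : ℝ≥0} (hC : h.MassBound C)
    {b : D.HaarIndex → ℝ} (hb : ∀ p, |b p| ≤ B * h.mass p) (p : D.HaarIndex) :
    |h.act T b p| ≤ (actConst n C r s T * B : ℝ≥0) * h.mass p := by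
  have mass_nonneg := h.mass_nonneg p
  have term_le : ∀ q ∈ nearCubes r s p.1 ×ˢ (Finset.univ : Finset (Fin (2 ^ n - 1))),
      |h.matrix T p q * b q| ≤ ‖T‖ * (B * (C ^ (r + s + 4) * h.mass p)) := by
    intro q hq
    rw [abs_mul]
    gcongr
    · exact h.abs_matrix_le T p q
    · refine (hb q).trans ?_
      gcongr
      exact hC.mass_le_of_near (mem_nearCubes.1 (Finset.mem_product.1 hq).1)
  have card_le : ((nearCubes r s p.1 ×ˢ (Finset.univ : Finset (Fin (2 ^ n - 1)))).card : ℝ) ≤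
      2 ^ (n * r) * 2 ^ n := by
    rw [Finset.card_product, Finset.card_univ, Fintype.card_fin]
    exact_mod_cast Nat.mul_le_mul (card_nearCubes_le r s p.1) (Nat.sub_le _ _)
  rw [hT.act_eq_sum b p subset_rfl]
  calc |∑ q ∈ nearCubes r s p.1 ×ˢ Finset.univ, h.matrix T p q * b q|
    _ ≤ ∑ q ∈ nearCubes r s p.1 ×ˢ Finset.univ, |h.matrix T p q * b q| :=
        Finset.abs_sum_le_sum_abs _ _
    _ ≤ (2 ^ (n * r) * 2 ^ n) * (‖T‖ * (B * (C ^ (r + s + 4) * h.mass p))) := by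
        refine (Finset.sum_le_card_nsmul _ _ _ term_le).trans ?_
        rw [nsmul_eq_mul]
        gcongr
    _ = (actConst n C r s T * B : ℝ≥0) * h.mass p := by
        simp only [actConst]
        push_cast
        ring

end Act

section Bounds

variable (h : HaarSystem D μ)

theorem tsum_coef_sq_eq_enorm (F : Lp ℝ 2 μ) : ∑' p, ‖h.coef F p‖ₑ ^ 2 = ‖F‖ₑ ^ 2 := by
  rw [h.tsum_coef_sq (Lp.memLp F), Lp.enorm_def,
    eLpNorm_eq_lintegral_rpow_enorm_toReal two_ne_zero ENNReal.ofNat_ne_top]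
  simp only [ENNReal.toReal_ofNat, ENNReal.rpow_ofNat]
  rw [← ENNReal.rpow_natCast _ 2, ← ENNReal.rpow_mul]
  norm_num

/-- The Riesz–Fischer theorem for the Haar basis. -/
theorem exists_coef_eq {a : D.HaarIndex → ℝ} (ha : ∑' p, ‖a p‖ₑ ^ 2 ≠ ∞) :
    ∃ F : Lp ℝ 2 μ, h.coef F = a := by
  have summable_sq : Summable fun p => ‖a p‖ ^ 2 := by
    simpa using ENNReal.summable_toReal ha
  have memℓp : Memℓp a 2 := memℓp_gen (by simpa using summable_sq)
  refine ⟨h.basis.repr.symm ⟨a, memℓp⟩, funext fun p => ?_⟩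
  rw [← h.inner_vec, ← h.basis_apply, ← h.basis.repr_apply_apply,
    LinearIsometryEquiv.apply_symm_apply]

theorem exists_coef_eq_indicator_below {a : D.HaarIndex → ℝ} {Q : Set (Fin n → ℝ)}
    (ha : ∑' p, (D.below Q).indicator (fun p => ‖a p‖ₑ ^ 2) p ≠ ∞) :
    ∃ F : Lp ℝ 2 μ, h.coef F = (D.below Q).indicator a := by
  refine h.exists_coef_eq ?_
  convert ha using 3 with p
  by_cases hp : p ∈ D.below Q <;> simp [hp]

variable {h} {b : D.HaarIndex → ℝ} {B C : ℝ≥0}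

theorem Carleson.mono {B' : ℝ≥0} (hb : h.Carleson b B) (hB : B ≤ B') : h.Carleson b B' where
  abs_le p := (hb.abs_le p).trans (mul_le_mul_of_nonneg_right hB (h.mass_nonneg p))
  tsum_le Q := (hb.tsum_le Q).trans (by gcongr)

theorem Carleson.tsum_ne_top [D.PosFinite μ] (hb : h.Carleson b B) (Q : D.cubes) :
    ∑' p, (D.below Q.1).indicator (fun p => ‖b p‖ₑ ^ 2) p ≠ ∞ :=
  ((hb.tsum_le Q).trans_lt (ENNReal.mul_lt_top (by simp)
    (D.measure_lt_top_of_gen (D.mem_gen_level Q)))).ne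

theorem Carleson.exists_coef_eq_indicator_below [D.PosFinite μ] (hb : h.Carleson b B)
    (Q : D.cubes) :
    ∃ F : Lp ℝ 2 μ, h.coef F = (D.below Q.1).indicator b ∧
      ‖F‖ₑ ^ 2 ≤ (B : ℝ≥0∞) ^ 2 * μ Q.1 := by
  obtain ⟨F, hF⟩ := h.exists_coef_eq_indicator_below (hb.tsum_ne_top Q)
  refine ⟨F, hF, ?_⟩
  rw [← h.tsum_coef_sq_eq_enorm, hF]
  refine le_of_eq_of_le (tsum_congr fun p => ?_) (hb.tsum_le Q)
  by_cases hp : p ∈ D.below Q.1 <;> simp [hp]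

variable [NeZero n]

theorem tsum_indicator_topCubes_fst_le {k : ℤ} {Q : Set (Fin n → ℝ)} (hQ : Q ∈ D.gen k) (s : ℕ) :
    ∑' p : D.HaarIndex, (D.topCubes k s Q).indicator (fun S => μ S.1) p.1 ≤
      2 ^ n * (s * μ Q) := by
  rw [ENNReal.tsum_prod']
  simp only [tsum_fintype, Finset.sum_const, Finset.card_univ, Fintype.card_fin, nsmul_eq_mul,
    ENNReal.tsum_mul_left]
  gcongr
  · exact_mod_cast Nat.sub_le _ _
  · exact tsum_measure_topCubes_le hQ s

variable [D.PosFinite μ]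

/-- Below the first `s` generations the action of the shift is local, while on these generations
the bound on the individual coefficients suffices. -/
theorem IsShift.indicator_below_act_sq_le (hT : h.IsShift r s T) {A : ℝ≥0} {Q : D.cubes}
    (hA : ∀ p, |h.act T b p| ≤ A * h.mass p) {F : Lp ℝ 2 μ}
    (hF : h.coef F = (D.below Q.1).indicator b) (p : D.HaarIndex) :
    (D.below Q.1).indicator (fun p => ‖h.act T b p‖ₑ ^ 2) p ≤ ‖h.coef (T F) p‖ₑ ^ 2 +
      (A : ℝ≥0∞) ^ 2 * (D.topCubes (D.level Q) s Q.1).indicator (fun S => μ S.1) p.1 := by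
  by_cases hp : p ∈ D.below Q.1
  swap
  · simp [hp]
  rw [indicator_of_mem hp]
  by_cases hp_top : D.level p.1 < D.level Q + s
  · refine le_trans ?_ le_add_self
    rw [indicator_of_mem (show p.1 ∈ D.topCubes (D.level Q) s Q.1 from ⟨hp, hp_top⟩)]
    calc ‖h.act T b p‖ₑ ^ 2 ≤ ((A : ℝ≥0∞) * ENNReal.ofReal (h.mass p)) ^ 2 := by
          gcongr
          rw [← ofReal_norm, ← ENNReal.ofReal_coe_nnreal, ← ENNReal.ofReal_mul A.coe_nonneg]
          exact ENNReal.ofReal_le_ofReal (hA p)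
      _ = (A : ℝ≥0∞) ^ 2 * ENNReal.ofReal (h.mass p) ^ 2 := mul_pow _ _ _
      _ ≤ (A : ℝ≥0∞) ^ 2 * μ p.1.1 := by
          gcongr
          exact h.ofReal_mass_sq_le p
  · refine le_trans (le_of_eq ?_) le_self_add
    rw [h.coef_apply, hF, hT.act_congr fun q hq => ?_]
    exact (indicator_of_mem (show q ∈ D.below Q.1 from
      hq.subset (D.mem_gen_level Q) hp (not_lt.1 hp_top)) _).symm

theorem sq_add_sq_mul_le (t A B N : ℝ≥0) :
    (t * B) ^ 2 + (A * B) ^ 2 * N ≤ ((t + (N + 1) * A) * B) ^ 2 :=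
  calc (t * B) ^ 2 + (A * B) ^ 2 * N
    _ ≤ (t * B) ^ 2 + (A * B) ^ 2 * N +
        (2 * t * (N + 1) * A + (N ^ 2 + N + 1) * A ^ 2) * B ^ 2 := le_self_add
    _ = ((t + (N + 1) * A) * B) ^ 2 := by ring

theorem IsShift.carleson_act (hT : h.IsShift r s T) (hC : h.MassBound C) (hb : h.Carleson b B) :
    h.Carleson (h.act T b) ((‖T‖₊ + (2 ^ n * s + 1) * actConst n C r s T) * B) := by
  set A := actConst n C r s T
  have abs_act_le := hT.abs_act_le hC hb.abs_le
  have const_le : A * B ≤ (‖T‖₊ + (2 ^ n * s + 1) * A) * B := by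
    gcongr
    exact (le_mul_of_one_le_left zero_le le_add_self).trans le_add_self
  refine ⟨fun p => (abs_act_le p).trans
    (mul_le_mul_of_nonneg_right const_le (h.mass_nonneg p)), fun Q => ?_⟩
  obtain ⟨F, coef_F, enorm_F_le⟩ := hb.exists_coef_eq_indicator_below Q
  have tsum_coef_le : ∑' p, ‖h.coef (T F) p‖ₑ ^ 2 ≤ ((‖T‖₊ * B : ℝ≥0) : ℝ≥0∞) ^ 2 * μ Q.1 := by
    calc ∑' p, ‖h.coef (T F) p‖ₑ ^ 2 = ‖T F‖ₑ ^ 2 := h.tsum_coef_sq_eq_enorm _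
      _ ≤ (‖T‖ₑ * ‖F‖ₑ) ^ 2 := by
          gcongr
          exact T.le_opENorm F
      _ = ‖T‖ₑ ^ 2 * ‖F‖ₑ ^ 2 := mul_pow _ _ _
      _ ≤ ‖T‖ₑ ^ 2 * ((B : ℝ≥0∞) ^ 2 * μ Q.1) := by gcongr
      _ = ((‖T‖₊ * B : ℝ≥0) : ℝ≥0∞) ^ 2 * μ Q.1 := by
          rw [ENNReal.coe_mul, mul_pow, mul_assoc]
          rfl
  calc ∑' p, (D.below Q.1).indicator (fun p => ‖h.act T b p‖ₑ ^ 2) p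
    _ ≤ ∑' p : D.HaarIndex, (‖h.coef (T F) p‖ₑ ^ 2 + ((A * B : ℝ≥0) : ℝ≥0∞) ^ 2 *
          (D.topCubes (D.level Q) s Q.1).indicator (fun S => μ S.1) p.1) :=
        ENNReal.tsum_le_tsum (hT.indicator_below_act_sq_le abs_act_le coef_F)
    _ ≤ ((‖T‖₊ * B : ℝ≥0) : ℝ≥0∞) ^ 2 * μ Q.1 +
          ((A * B : ℝ≥0) : ℝ≥0∞) ^ 2 * (2 ^ n * (s * μ Q.1)) := by
        rw [ENNReal.tsum_add, ENNReal.tsum_mul_left]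
        gcongr
        exact tsum_indicator_topCubes_fst_le (D.mem_gen_level Q) s
    _ = (((‖T‖₊ * B) ^ 2 + (A * B) ^ 2 * (2 ^ n * s) : ℝ≥0) : ℝ≥0∞) * μ Q.1 := by
        push_cast
        ring
    _ ≤ (((‖T‖₊ + (2 ^ n * s + 1) * A) * B : ℝ≥0) : ℝ≥0∞) ^ 2 * μ Q.1 := by
        gcongr
        exact_mod_cast sq_add_sq_mul_le ‖T‖₊ A B (2 ^ n * s)

/-- By duality with the action of the adjoint on Carleson sequences. -/
theorem IsShift.exists_hardyNorm_act_le (hT : h.IsShift r s T) (hC : h.MassBound C) :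
    ∃ K : ℝ≥0, ∀ a, h.hardyNorm (h.act T a) ≤ K * h.hardyNorm a := by
  classical
  set T' := ContinuousLinearMap.adjoint T
  set B : ℝ≥0 := (‖T'‖₊ + (2 ^ n * r + 1) * actConst n C s r T') * 1 + 1
  refine ⟨2 * (B * (2 ^ n * C + 1)), fun a =>
    h.hardyNorm_le_of_forall_restrictCubes_le _ fun G => ?_⟩
  obtain ⟨b, carleson_b, b_support, hardyNorm_eq⟩ := h.exists_carleson_pairing (h.act T a) G
  have carleson_act : h.Carleson (h.act T' b) B :=
    (hT.adjoint.carleson_act hC carleson_b).mono le_self_add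
  rw [hardyNorm_eq, hT.sum_act_mul a b_support]
  refine (carleson_act.pairing_le (by positivity) hC a _).trans ?_
  push_cast
  gcongr
  exact h.hardyNorm_restrictCubes_le _ _

end Bounds

end HaarSystem

theorem lintegral_le_mul_of_lintegral_sq_le {α : Type*} [MeasurableSpace α] {ν : Measure α}
    {u : α → ℝ≥0∞} (hu : AEMeasurable u ν) {B : ℝ≥0∞}
    (hB : ∫⁻ x, u x ^ 2 ∂ν ≤ B ^ 2 * ν univ) : ∫⁻ x, u x ∂ν ≤ B * ν univ := by
  have hölder := ENNReal.lintegral_mul_le_Lp_mul_Lq ν Real.HolderConjugate.two_two hu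
    (aemeasurable_const (b := (1 : ℝ≥0∞)))
  simp only [Pi.mul_apply, mul_one, ENNReal.rpow_ofNat, one_pow, lintegral_one] at hölder
  calc ∫⁻ x, u x ∂ν ≤ (∫⁻ x, u x ^ 2 ∂ν) ^ (1 / 2 : ℝ) * ν univ ^ (1 / 2 : ℝ) := hölder
    _ ≤ (B ^ 2 * ν univ) ^ (1 / 2 : ℝ) * ν univ ^ (1 / 2 : ℝ) := by gcongr
    _ = B * ν univ := by
        rw [ENNReal.mul_rpow_of_nonneg _ _ (by norm_num), mul_assoc,
          ← ENNReal.rpow_add_of_nonneg _ _ (by norm_num) (by norm_num),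
          ← ENNReal.rpow_natCast, ← ENNReal.rpow_mul]
        norm_num

namespace DyadicSystem

open Filter

variable {n : ℕ} {D : DyadicSystem n} {μ : Measure (Fin n → ℝ)} [D.PosFinite μ]

theorem Adapted.le_essSup {k : ℤ} {θ : (Fin n → ℝ) → ℝ≥0∞} (hθ : D.Adapted k θ)
    (x : Fin n → ℝ) : θ x ≤ essSup θ μ := by
  by_contra hlt
  have cell_subset : D.cell k x ⊆ {y | ¬θ y ≤ essSup θ μ} := fun y hy => by
    rwa [mem_ofPred_eq, hθ x y hy]
  exact (D.measure_pos_of_gen (D.cell_mem k x)).ne'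
    (measure_mono_null cell_subset (ENNReal.ae_le_essSup θ))

theorem setLIntegral_osc_le_bmoNorm (f : (Fin n → ℝ) → ℝ) (k : ℤ) (x : Fin n → ℝ) :
    ∫⁻ y in D.cell (k + 1) x, ‖f y - D.expect μ k f y‖ₑ ∂μ ≤
      D.bmoNorm μ f * μ (D.cell (k + 1) x) := by
  have hx := D.cell_mem (k + 1) x
  let osc : (Fin n → ℝ) → ℝ≥0∞ := fun x =>
    ⨍⁻ y in D.cell (k + 1) x, ‖f y - D.expect μ (k + 1 - 1) f y‖ₑ ∂μ
  have adapted_osc : D.Adapted (k + 1) osc := fun x y hy => by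
    simp only [osc, D.cell_eq_of_mem hy]
  have osc_le : osc x ≤ D.bmoNorm μ f := (adapted_osc.le_essSup x).trans
    (le_iSup (fun k : ℤ => essSup (fun x => ⨍⁻ y in D.cell k x,
      ‖f y - D.expect μ (k - 1) f y‖ₑ ∂μ) μ) (k + 1))
  simp only [osc, setLAverage_eq, add_sub_cancel_right] at osc_le
  rwa [ENNReal.div_le_iff (D.measure_pos_of_gen hx).ne' (D.measure_lt_top_of_gen hx).ne] at osc_le

theorem bmoNorm_le_of_setLIntegral_osc_le {f : (Fin n → ℝ) → ℝ} {b : ℝ≥0∞}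
    (hf : ∀ k x, ∫⁻ y in D.cell (k + 1) x, ‖f y - D.expect μ k f y‖ₑ ∂μ ≤
      b * μ (D.cell (k + 1) x)) : D.bmoNorm μ f ≤ b := by
  refine iSup_le fun k => essSup_le_of_ae_le _ (Eventually.of_forall fun x => ?_)
  have hx := D.cell_mem k x
  simp only [setLAverage_eq]
  rw [ENNReal.div_le_iff (D.measure_pos_of_gen hx).ne' (D.measure_lt_top_of_gen hx).ne]
  simpa only [sub_add_cancel] using hf (k - 1) x

theorem meanOscLE_of_bmoNorm_lt_top [NeZero n] {f : (Fin n → ℝ) → ℝ}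
    (hf : ∀ Q ∈ D.cubes, IntegrableOn f Q μ) (hb : D.bmoNorm μ f < ∞) :
    D.MeanOscLE μ f (D.bmoNorm μ f).toReal where
  integrableOn := hf
  osc_le k x := by
    have hx := D.cell_mem (k + 1) x
    have integrableOn_osc : IntegrableOn (fun y => f y - D.expect μ k f y) (D.cell (k + 1) x) μ :=
      (hf _ (D.cell_mem_cubes _ x)).sub ((D.adapted_expect μ k f).integrableOn hx)
    have osc_le := D.setLIntegral_osc_le_bmoNorm (μ := μ) f k x
    rw [← ofReal_integral_norm_eq_lintegral_enorm integrableOn_osc] at osc_le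
    have toReal_le := ENNReal.toReal_mono
      (ENNReal.mul_lt_top hb (D.measure_lt_top_of_gen hx)).ne osc_le
    rwa [ENNReal.toReal_ofReal (integral_nonneg fun _ => norm_nonneg _),
      ENNReal.toReal_mul] at toReal_le

theorem integrableOn_of_memLp {f : (Fin n → ℝ) → ℝ} (hf : MemLp f 2 μ) {Q : Set (Fin n → ℝ)}
    (hQ : Q ∈ D.cubes) : IntegrableOn f Q μ := by
  have : IsFiniteMeasure (μ.restrict Q) := ⟨by simpa using PosFinite.measure_lt_top Q hQ⟩
  exact (hf.mono_measure Measure.restrict_le_self).integrable one_le_two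

end DyadicSystem

namespace HaarSystem

open DyadicSystem

variable {n : ℕ} [NeZero n] {D : DyadicSystem n} {μ : Measure (Fin n → ℝ)} [D.PosFinite μ]
  (h : HaarSystem D μ)

theorem coef_eq_setIntegral_sub_expect_mul {f : (Fin n → ℝ) → ℝ} {p : D.HaarIndex}
    (hf : IntegrableOn f p.1.1 μ) :
    h.coef f p = ∫ x in p.1.1, (f x - D.expect μ (D.level p.1) f x) * h.haar p x ∂μ := by
  have hp := D.mem_gen_level p.1
  obtain ⟨x₀, hx₀⟩ := D.nonempty_of_gen hp
  rw [← sub_zero (h.coef f p), ← h.coef_const (D.expect μ (D.level p.1) f x₀) p,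
    ← h.coef_sub hf (integrableOn_const (D.measure_lt_top_of_gen hp).ne), h.coef_eq_setIntegral]
  refine setIntegral_congr_fun (D.measurableSet_of_gen hp) fun x hx => ?_
  simp only [Pi.sub_apply, D.expect_eq_of_mem μ hp f hx₀, D.expect_eq_of_mem μ hp f hx]

theorem abs_coef_le_mul_mass {f : (Fin n → ℝ) → ℝ} {b : ℝ} (hf : D.MeanOscLE μ f b)
    (p : D.HaarIndex) : |h.coef f p| ≤ b * h.mass p := by
  have setIntegral_abs_haar : ∫ x in p.1.1, |h.haar p x| ∂μ = h.mass p :=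
    setIntegral_eq_integral_of_forall_compl_eq_zero fun x hx => by
      rw [h.haar_eq_zero hx, abs_zero]
  rw [h.coef_eq_setIntegral_sub_expect_mul (hf.integrableOn p.1.1 p.1.2), ← setIntegral_abs_haar]
  calc |∫ x in p.1.1, (f x - D.expect μ (D.level p.1) f x) * h.haar p x ∂μ|
      ≤ ∫ x in p.1.1, |(f x - D.expect μ (D.level p.1) f x) * h.haar p x| ∂μ :=
        abs_integral_le_integral_abs
    _ = ∫ x in p.1.1, |h.haar p x| * |f x - D.expect μ (D.level p.1) f x| ∂μ := by
        simp only [abs_mul, mul_comm]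
    _ ≤ b * ∫ x in p.1.1, |h.haar p x| ∂μ :=
        hf.setIntegral_mul_le (by omega) (D.mem_gen_level p.1)
          ((h.adapted_haar p).comp fun t => |t|) fun x => abs_nonneg _

theorem carleson_coef_of_meanOscLE {f : (Fin n → ℝ) → ℝ} {b : ℝ≥0} (hf : D.MeanOscLE μ f b) :
    h.Carleson (h.coef f) (16 * b) where
  abs_le p := by
    have mass_nonneg := h.mass_nonneg p
    refine (h.abs_coef_le_mul_mass hf p).trans ?_
    gcongr
    exact le_mul_of_one_le_left zero_le (by norm_num)
  tsum_le Q := by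
    have hQ := D.mem_gen_level Q
    rw [h.tsum_indicator_below_coef_sq hQ (hf.integrableOn _ Q.2)
      (hf.memLp_indicator_sub_setAverage hQ)]
    refine (hf.setLIntegral_sq_sub_setAverage_le hQ).trans_eq ?_
    rw [← ENNReal.ofReal_coe_nnreal, ← ENNReal.ofReal_pow (NNReal.coe_nonneg _)]
    push_cast
    ring_nf

theorem exists_ae_eq_add_const {Q : Set (Fin n → ℝ)} (hQ : Q ∈ D.cubes)
    {f g : (Fin n → ℝ) → ℝ} (hf : IntegrableOn f Q μ) (hg : IntegrableOn g Q μ)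
    (hfg : ∀ p ∈ D.below Q, h.coef f p = h.coef g p) :
    ∃ c : ℝ, ∀ᵐ x ∂μ.restrict Q, f x = g x + c := by
  obtain ⟨k, hQ⟩ := hQ
  have sub_ae_eq := h.ae_eq_setAverage_of_coef_eq_zero hQ (hf.sub hg) fun p hp => by
    rw [h.coef_sub (hf.mono_set hp) (hg.mono_set hp), hfg p hp, sub_self]
  refine ⟨⨍ y in Q, (f - g) y ∂μ, sub_ae_eq.mono fun x hx => ?_⟩
  rw [← hx, Pi.sub_apply]
  ring

theorem memLp_indicator_sub_setAverage {Q : Set (Fin n → ℝ)} (hQ : Q ∈ D.cubes)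
    {g : (Fin n → ℝ) → ℝ} (hg : IntegrableOn g Q μ)
    (hg_coef : ∑' p, (D.below Q).indicator (fun p => ‖h.coef g p‖ₑ ^ 2) p ≠ ∞) :
    MemLp (Q.indicator fun y => g y - ⨍ z in Q, g z ∂μ) 2 μ := by
  obtain ⟨F, hF⟩ := h.exists_coef_eq_indicator_below hg_coef
  obtain ⟨c, hc⟩ := h.exists_ae_eq_add_const hQ hg (integrableOn_of_memLp (Lp.memLp F) hQ)
    fun p hp => by rw [hF, indicator_of_mem hp]
  have : IsFiniteMeasure (μ.restrict Q) := ⟨by simpa using PosFinite.measure_lt_top Q hQ⟩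
  have memLp_translate : MemLp (fun y => (F y + c) - ⨍ z in Q, g z ∂μ) 2 (μ.restrict Q) :=
    (((Lp.memLp F).mono_measure Measure.restrict_le_self).add (memLp_const c)).sub (memLp_const _)
  obtain ⟨k, hQ⟩ := hQ
  rw [memLp_indicator_iff_restrict (D.measurableSet_of_gen hQ)]
  exact memLp_translate.ae_eq (hc.mono fun y hy => by simp only [hy])

variable {h}

theorem Carleson.setLIntegral_sub_setAverage_le {g : (Fin n → ℝ) → ℝ} {B : ℝ≥0}
    (hb : h.Carleson (h.coef g) B) {k : ℤ} {Q : Set (Fin n → ℝ)} (hQ : Q ∈ D.gen k)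
    (hg : IntegrableOn g Q μ) :
    ∫⁻ y in Q, ‖g y - ⨍ z in Q, g z ∂μ‖ₑ ∂μ ≤ B * μ Q := by
  have aemeasurable_sub : AEMeasurable (fun y => ‖g y - ⨍ z in Q, g z ∂μ‖ₑ) (μ.restrict Q) :=
    (hg.aestronglyMeasurable.aemeasurable.sub_const _).enorm
  simpa using lintegral_le_mul_of_lintegral_sq_le aemeasurable_sub (B := B) (by
    rw [← h.tsum_indicator_below_coef_sq hQ hg
      (h.memLp_indicator_sub_setAverage ⟨k, hQ⟩ hg (hb.tsum_ne_top ⟨Q, k, hQ⟩))]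
    simpa using hb.tsum_le ⟨Q, k, hQ⟩)

theorem Carleson.enorm_expect_sub_le {g : (Fin n → ℝ) → ℝ} {B C : ℝ≥0}
    (hb : h.Carleson (h.coef g) B) (hC : h.MassBound C) {k : ℤ} {x : Fin n → ℝ}
    (hg : IntegrableOn g (D.cell k x) μ) :
    ‖D.expect μ (k + 1) g x - D.expect μ k g x‖ₑ ≤ (B * (2 ^ n * C) : ℝ≥0) := by
  rw [h.expect_add_one_sub_expect k x hg]
  change (‖h.block (h.coef g) (D.cellCube k x) x‖₊ : ℝ≥0∞) ≤ _
  rw [ENNReal.coe_le_coe, ← NNReal.coe_le_coe]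
  exact_mod_cast hb.abs_block_le hC _ x

theorem Carleson.bmoNorm_le {g : (Fin n → ℝ) → ℝ} {B C : ℝ≥0}
    (hb : h.Carleson (h.coef g) B) (hC : h.MassBound C)
    (hg : ∀ Q ∈ D.cubes, IntegrableOn g Q μ) :
    D.bmoNorm μ g ≤ (B * (2 ^ n * C + 1) : ℝ≥0) := by
  refine bmoNorm_le_of_setLIntegral_osc_le fun k x => ?_
  have hQ : D.cell (k + 1) x ∈ D.gen (k + 1) := D.cell_mem _ x
  set Q := D.cell (k + 1) x
  have jump_le : ∀ y ∈ Q, ‖(⨍ z in Q, g z ∂μ) - D.expect μ k g y‖ₑ ≤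
      (B * (2 ^ n * C) : ℝ≥0) := fun y hy => by
    rw [← D.expect_eq_of_mem μ hQ g hy]
    exact hb.enorm_expect_sub_le hC (hg _ (D.cell_mem_cubes k y))
  calc ∫⁻ y in Q, ‖g y - D.expect μ k g y‖ₑ ∂μ
      ≤ ∫⁻ y in Q, (‖g y - ⨍ z in Q, g z ∂μ‖ₑ + (B * (2 ^ n * C) : ℝ≥0)) ∂μ := by
        refine setLIntegral_mono' (D.measurableSet_of_gen hQ) fun y hy => ?_
        rw [← sub_add_sub_cancel (g y) (⨍ z in Q, g z ∂μ)]
        exact (enorm_add_le _ _).trans (add_le_add_right (jump_le y hy) _)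
    _ = (∫⁻ y in Q, ‖g y - ⨍ z in Q, g z ∂μ‖ₑ ∂μ) + (B * (2 ^ n * C) : ℝ≥0) * μ Q := by
        rw [lintegral_add_right _ measurable_const, setLIntegral_const]
    _ ≤ B * μ Q + (B * (2 ^ n * C) : ℝ≥0) * μ Q := by
        gcongr
        exact hb.setLIntegral_sub_setAverage_le hQ (hg Q ⟨_, hQ⟩)
    _ = (B * (2 ^ n * C + 1) : ℝ≥0) * μ Q := by
        push_cast
        ring

end HaarSystem

namespace DyadicSystem

open Filter

variable {n : ℕ} {D : DyadicSystem n}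

theorem subset_or_subset_of_subset {Q A B : D.cubes} (hA : Q.1 ⊆ A.1) (hB : Q.1 ⊆ B.1) :
    A.1 ⊆ B.1 ∨ B.1 ⊆ A.1 :=
  (D.nested _ _ _ (D.mem_gen_level A) _ (D.mem_gen_level B)).resolve_left fun hAB =>
    let ⟨_, hx⟩ := D.nonempty_of_gen (D.mem_gen_level Q)
    disjoint_left.1 hAB (hA hx) (hB hx)

theorem iUnion_cubes (D : DyadicSystem n) : ⋃ Q : D.cubes, Q.1 = univ :=
  eq_univ_of_forall fun x => mem_iUnion.2 ⟨D.cellCube 0 x, D.mem_cell 0 x⟩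

/-- Two cubes are equivalent if they lie in the same quadrant, that is, in a common cube. -/
def quadrantSetoid (D : DyadicSystem n) : Setoid D.cubes where
  r R S := ∃ A : D.cubes, R.1 ⊆ A.1 ∧ S.1 ⊆ A.1
  iseqv := by
    refine ⟨fun R => ⟨R, subset_rfl, subset_rfl⟩, fun ⟨A, hR, hS⟩ => ⟨A, hS, hR⟩, ?_⟩
    rintro R S S' ⟨A, hRA, hSA⟩ ⟨B, hSB, hSB'⟩
    rcases subset_or_subset_of_subset hSA hSB with hAB | hBA
    · exact ⟨B, hRA.trans hAB, hSB'⟩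
    · exact ⟨A, hRA, hSB'.trans hBA⟩

theorem exists_baseCube (D : DyadicSystem n) :
    ∃ base : D.cubes → D.cubes, (∀ Q, ∃ A : D.cubes, Q.1 ⊆ A.1 ∧ (base Q).1 ⊆ A.1) ∧
      ∀ Q R : D.cubes, R.1 ⊆ Q.1 → base R = base Q := by
  refine ⟨fun Q => (Quotient.mk D.quadrantSetoid Q).out, fun Q => ?_, fun Q R hRQ => ?_⟩
  · obtain ⟨A, hbase, hQ⟩ := Quotient.mk_out (s := D.quadrantSetoid) Q
    exact ⟨A, hQ, hbase⟩
  · have mk_eq : Quotient.mk D.quadrantSetoid R = Quotient.mk D.quadrantSetoid Q :=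
      Quotient.sound ⟨Q, hRQ, subset_rfl⟩
    simp only [mk_eq]

variable {μ : Measure (Fin n → ℝ)}

theorem ae_sub_setAverage_eq [D.PosFinite μ] {u v : (Fin n → ℝ) → ℝ} {c : ℝ} {B : D.cubes}
    {M : Set (Fin n → ℝ)} (huv : ∀ᵐ x ∂μ.restrict M, u x = v x + c) (hBM : B.1 ⊆ M)
    (hv : IntegrableOn v B.1 μ) :
    ∀ᵐ x ∂μ.restrict M, u x - ⨍ y in B.1, u y ∂μ = v x - ⨍ y in B.1, v y ∂μ := by
  have measure_pos := PosFinite.measure_pos (μ := μ) B.1 B.2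
  have measure_lt_top := PosFinite.measure_lt_top (μ := μ) B.1 B.2
  have measureReal_ne_zero : μ.real B.1 ≠ 0 :=
    (ENNReal.toReal_pos measure_pos.ne' measure_lt_top.ne).ne'
  have average_eq : ⨍ y in B.1, u y ∂μ = (⨍ y in B.1, v y ∂μ) + c := by
    rw [setAverage_eq, setAverage_eq,
      integral_congr_ae (ae_restrict_of_ae_restrict_of_subset hBM huv),
      integral_add hv (integrableOn_const measure_lt_top.ne), setIntegral_const, smul_add,
      smul_smul, inv_mul_cancel₀ measureReal_ne_zero, one_smul]
  filter_upwards [huv] with x hx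
  rw [hx, average_eq, add_sub_add_right_eq_sub]

theorem exists_forall_ae_eq {F : D.cubes → (Fin n → ℝ) → ℝ}
    (hF : ∀ A B : D.cubes, B.1 ⊆ A.1 → F A =ᵐ[μ.restrict B.1] F B) :
    ∃ g : (Fin n → ℝ) → ℝ, ∀ Q : D.cubes, g =ᵐ[μ.restrict Q.1] F Q := by
  refine ⟨fun x => F (D.cellCube 0 x) x, fun Q => ?_⟩
  have ae_eq_on : ∀ A B : D.cubes, B.1 ⊆ A.1 → ∀ᵐ x ∂μ, x ∈ B.1 → F A x = F B x := fun A B hBA =>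
    (ae_restrict_iff' (D.measurableSet_of_gen (D.mem_gen_level B))).1 (hF A B hBA)
  have ae_eq_on_inter : ∀ᵐ x ∂μ, ∀ S : D.cubes, x ∈ S.1 → x ∈ Q.1 → F S x = F Q x := by
    refine ae_all_iff.2 fun S => ?_
    rcases D.nested _ _ _ (D.mem_gen_level S) _ (D.mem_gen_level Q) with hd | hle | hle
    · exact Eventually.of_forall fun x hxS hxQ => absurd hxQ (disjoint_left.1 hd hxS)
    · exact (ae_eq_on Q S hle).mono fun x hx hxS _ => (hx hxS).symm
    · exact (ae_eq_on S Q hle).mono fun x hx _ hxQ => hx hxQ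
  refine (ae_restrict_iff' (D.measurableSet_of_gen (D.mem_gen_level Q))).2 ?_
  exact ae_eq_on_inter.mono fun x hx => hx _ (D.mem_cell 0 x)

theorem exists_forall_ae_eq_add_const [D.PosFinite μ] {F : D.cubes → (Fin n → ℝ) → ℝ}
    (hF : ∀ A, IntegrableOn (F A) A.1 μ)
    (hF_compat : ∀ A B : D.cubes, B.1 ⊆ A.1 → ∃ c : ℝ, ∀ᵐ x ∂μ.restrict B.1, F A x = F B x + c) :
    ∃ g : (Fin n → ℝ) → ℝ, ∀ Q : D.cubes, ∃ c : ℝ, ∀ᵐ x ∂μ.restrict Q.1, g x = F Q x + c := by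
  obtain ⟨base, exists_top, base_eq⟩ := D.exists_baseCube
  choose top subset_top base_subset_top using exists_top
  -- The ambiguity of the constants is removed by giving all functions mean zero on one fixed cube
  -- of each quadrant.
  let normalized : D.cubes → (Fin n → ℝ) → ℝ := fun Q x =>
    F (top Q) x - ⨍ y in (base Q).1, F (top Q) y ∂μ
  have normalized_eq : ∀ A B : D.cubes, B.1 ⊆ A.1 →
      normalized A =ᵐ[μ.restrict B.1] normalized B := by
    intro A B hBA
    have sub_average_eq : ∀ M M' : D.cubes, (base A).1 ⊆ M.1 → M.1 ⊆ M'.1 →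
        ∀ᵐ x ∂μ.restrict M.1, F M' x - ⨍ y in (base A).1, F M' y ∂μ =
          F M x - ⨍ y in (base A).1, F M y ∂μ := fun M M' hM hMM' =>
      let ⟨_, hc⟩ := hF_compat M' M hMM'
      ae_sub_setAverage_eq hc hM ((hF M).mono_set hM)
    have base_subset_top_B := base_subset_top B
    simp only [normalized]
    rw [base_eq A B hBA] at base_subset_top_B ⊢
    rcases subset_or_subset_of_subset (base_subset_top A) base_subset_top_B with hle | hle
    · exact ae_restrict_of_ae_restrict_of_subset (hBA.trans (subset_top A))
        ((sub_average_eq _ _ (base_subset_top A) hle).mono fun x hx => hx.symm)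
    · exact ae_restrict_of_ae_restrict_of_subset (subset_top B)
        (sub_average_eq _ _ base_subset_top_B hle)
  obtain ⟨g, hg⟩ := exists_forall_ae_eq normalized_eq
  refine ⟨g, fun Q => ?_⟩
  obtain ⟨c, hc⟩ := hF_compat (top Q) Q (subset_top Q)
  refine ⟨c - ⨍ y in (base Q).1, F (top Q) y ∂μ, ?_⟩
  filter_upwards [hc, hg Q] with x hx hx_eq
  rw [hx_eq, ← add_sub_assoc, ← hx]

theorem ae_eq_of_forall_cubes {u v : (Fin n → ℝ) → ℝ}
    (huv : ∀ Q ∈ D.cubes, u =ᵐ[μ.restrict Q] v) : u =ᵐ[μ] v := by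
  rw [← Measure.restrict_univ (μ := μ), ← D.iUnion_cubes, ae_eq_restrict_iUnion_iff]
  exact fun Q => huv Q.1 Q.2

end DyadicSystem

theorem measure_lt_top_of_ae_eq_add_const {α : Type*} [MeasurableSpace α] {μ : Measure α}
    {u v : α → ℝ} {p q : ℝ≥0∞} (hu : MemLp u p μ) (hp : p ≠ 0) (hp_top : p ≠ ∞)
    (hv : MemLp v q μ) (hq : q ≠ 0) (hq_top : q ≠ ∞) {c : ℝ} (hc : c ≠ 0) {E : Set α}
    (huv : ∀ᵐ x ∂μ, x ∈ E → u x = v x + c) : μ E < ∞ := by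
  have half_pos : 0 < |c| / 2 := by positivity
  let ε : ℝ≥0 := ⟨|c| / 2, half_pos.le⟩
  have ε_ne_zero : ε ≠ 0 := fun hε => half_pos.ne' (congrArg NNReal.toReal hε)
  have ae_subset : E ≤ᵐ[μ] ({x | ε ≤ ‖u x‖₊} ∪ {x | ε ≤ ‖v x‖₊} : Set α) := by
    filter_upwards [huv] with x hx hxE
    have triangle : |c| ≤ |u x| + |v x| := by
      rw [← sub_eq_of_eq_add' (hx hxE)]
      exact abs_sub _ _
    rcases le_total (|c| / 2) |u x| with hle | hle
    · exact Or.inl hle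
    · exact Or.inr (show |c| / 2 ≤ |v x| by linarith)
  exact (measure_mono_ae ae_subset).trans_lt (measure_union_lt_top
    (hu.meas_ge_lt_top hp hp_top ε_ne_zero) (hv.meas_ge_lt_top hq hq_top ε_ne_zero))

namespace HaarSystem

open Filter Topology DyadicSystem

variable {n : ℕ} {D : DyadicSystem n} {μ : Measure (Fin n → ℝ)} (h : HaarSystem D μ)

theorem coef_aeEqFun_smul (c : ℝ) (f : (Fin n → ℝ) →ₘ[μ] ℝ) :
    h.coef ↑(c • f) = c • h.coef f := by
  funext p
  rw [h.coef_congr (AEEqFun.coeFn_smul c f), h.coef_smul, Pi.smul_apply, smul_eq_mul]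

theorem coef_L1_smul (c : ℝ) (f : Lp ℝ 1 μ) : h.coef ↑(c • f) = c • h.coef f :=
  h.coef_aeEqFun_smul c f.1

theorem hardyNorm_restrictCubes_mono {G G' : Set D.cubes} (hG : G ⊆ G') (a : D.HaarIndex → ℝ) :
    h.hardyNorm (restrictCubes G a) ≤ h.hardyNorm (restrictCubes G' a) := by
  have restrict_restrict : restrictCubes G a = restrictCubes G (restrictCubes G' a) := by
    simp only [restrictCubes, indicator_indicator, ← preimage_inter, inter_eq_left.2 hG]
  rw [restrict_restrict]
  exact h.hardyNorm_restrictCubes_le _ _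

variable [NeZero n]

theorem coef_aeEqFun_add {f g : (Fin n → ℝ) →ₘ[μ] ℝ} (hf : ∀ Q ∈ D.cubes, IntegrableOn f Q μ)
    (hg : ∀ Q ∈ D.cubes, IntegrableOn g Q μ) : h.coef ↑(f + g) = h.coef f + h.coef g := by
  funext p
  rw [h.coef_congr (AEEqFun.coeFn_add f g), h.coef_add (hf _ p.1.2) (hg _ p.1.2), Pi.add_apply]

theorem coef_aeEqFun_sub {f g : (Fin n → ℝ) →ₘ[μ] ℝ} (hf : ∀ Q ∈ D.cubes, IntegrableOn f Q μ)
    (hg : ∀ Q ∈ D.cubes, IntegrableOn g Q μ) : h.coef ↑(f - g) = h.coef f - h.coef g := by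
  funext p
  rw [h.coef_congr (AEEqFun.coeFn_sub f g), h.coef_sub (hf _ p.1.2) (hg _ p.1.2), Pi.sub_apply]

theorem coef_L1_add (f g : Lp ℝ 1 μ) : h.coef ↑(f + g) = h.coef f + h.coef g :=
  h.coef_aeEqFun_add (fun _ _ => (L1.integrable_coeFn f).integrableOn)
    fun _ _ => (L1.integrable_coeFn g).integrableOn

/-- The Haar coefficient of index `p` as a bounded functional on `L¹(μ)`. -/
noncomputable def coefCLM (p : D.HaarIndex) : Lp ℝ 1 μ →L[ℝ] ℝ :=
  LinearMap.mkContinuousOfExistsBound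
    { toFun := fun f => h.coef f p
      map_add' := fun f g => congrFun (h.coef_L1_add f g) p
      map_smul' := fun c f => congrFun (h.coef_L1_smul c f) p } <| by
    obtain ⟨C, hC⟩ := h.exists_norm_haar_le p
    refine ⟨C, fun f => ?_⟩
    have integrable_f := L1.integrable_coeFn f
    rw [L1.norm_eq_integral_norm, ← integral_const_mul]
    refine (norm_integral_le_integral_norm _).trans (integral_mono
      (h.integrable_mul_haar integrable_f.integrableOn).norm (integrable_f.norm.const_mul C)
      fun x => ?_)
    simp only [norm_mul]
    rw [mul_comm]
    gcongr
    exact hC x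

theorem coefCLM_apply (p : D.HaarIndex) (f : Lp ℝ 1 μ) : h.coefCLM p f = h.coef f p := rfl

theorem tendsto_hardyNorm_restrictCubes_compl {c : D.HaarIndex → ℝ} (hc : h.hardyNorm c ≠ ∞) :
    Tendsto (fun t : Finset D.cubes => h.hardyNorm (restrictCubes (t : Set D.cubes)ᶜ c)) atTop
      (𝓝 0) := by
  have enorm_block : ∀ (t : Finset D.cubes) (Q : D.cubes) (x : Fin n → ℝ),
      ‖h.block (restrictCubes (t : Set D.cubes)ᶜ c) Q x‖ₑ ^ 2 =
        (t : Set D.cubes)ᶜ.indicator (fun Q => ‖h.block c Q x‖ₑ ^ 2) Q := fun t Q x => by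
    by_cases hQ : Q ∈ (t : Set D.cubes)ᶜ
    · rw [indicator_of_mem hQ, h.block_restrictCubes_of_mem c hQ]
    · simp [indicator_of_notMem hQ, h.block_restrictCubes_of_notMem c hQ]
  rw [← lintegral_zero (μ := μ)]
  refine tendsto_lintegral_filter_of_dominated_convergence
    (fun x => (∑' Q, ‖h.block c Q x‖ₑ ^ 2) ^ (1 / 2 : ℝ))
    (Eventually.of_forall fun t => h.measurable_tsum_block _)
    (Eventually.of_forall fun t => Eventually.of_forall fun x => ?_) hc ?_
  · refine ENNReal.rpow_le_rpow (ENNReal.tsum_le_tsum fun Q => ?_) (by norm_num)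
    rw [enorm_block]
    exact indicator_le_self _ _ _
  · filter_upwards [ae_lt_top (h.measurable_tsum_block c) hc] with x hx
    have tsum_ne_top : ∑' Q, ‖h.block c Q x‖ₑ ^ 2 ≠ ∞ := fun h_top => by
      simp [h_top] at hx
    have tail_tendsto := (ENNReal.tendsto_tsum_compl_atTop_zero tsum_ne_top).ennrpow_const
      (1 / 2 : ℝ)
    rw [ENNReal.zero_rpow_of_pos (by norm_num)] at tail_tendsto
    refine tail_tendsto.congr fun t => ?_
    simp only [enorm_block]
    rw [← tsum_subtype]
    rfl

variable [D.PosFinite μ]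

theorem exists_integrableOn_coef_eq {c : D.HaarIndex → ℝ}
    (hc : ∀ Q ∈ D.cubes, ∑' p, (D.below Q).indicator (fun p => ‖c p‖ₑ ^ 2) p ≠ ∞) :
    ∃ g : (Fin n → ℝ) → ℝ, AEStronglyMeasurable g μ ∧ (∀ Q ∈ D.cubes, IntegrableOn g Q μ) ∧
      h.coef g = c := by
  choose F hF using fun Q : D.cubes => h.exists_coef_eq_indicator_below (hc Q.1 Q.2)
  have integrableOn_F : ∀ A Q : D.cubes, IntegrableOn (F A) Q.1 μ := fun A Q =>
    integrableOn_of_memLp (Lp.memLp (F A)) Q.2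
  obtain ⟨g, hg⟩ := exists_forall_ae_eq_add_const (fun A => integrableOn_F A A) fun A B hBA =>
    h.exists_ae_eq_add_const B.2 (integrableOn_F A B) (integrableOn_F B B) fun p hp => by
      rw [hF, hF, indicator_of_mem (show p ∈ D.below A.1 from hp.trans hBA), indicator_of_mem hp]
  have integrableOn_g : ∀ Q : D.cubes, IntegrableOn g Q.1 μ := fun Q => by
    obtain ⟨d, hd⟩ := hg Q
    exact ((integrableOn_F Q Q).add
      (integrableOn_const (PosFinite.measure_lt_top Q.1 Q.2).ne)).congr
        (hd.mono fun x hx => hx.symm)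
  refine ⟨g, ?_, fun Q hQ => integrableOn_g ⟨Q, hQ⟩, funext fun p => ?_⟩
  · rw [← Measure.restrict_univ (μ := μ), ← D.iUnion_cubes]
    exact AEStronglyMeasurable.iUnion fun Q => (integrableOn_g Q).aestronglyMeasurable
  · obtain ⟨d, hd⟩ := hg p.1
    have ae_eq_add : g =ᵐ[μ.restrict p.1.1] (F p.1 : (Fin n → ℝ) → ℝ) + fun _ => d := hd
    rw [h.coef_congr_restrict ae_eq_add, h.coef_add (integrableOn_F p.1 p.1)
      (integrableOn_const (PosFinite.measure_lt_top p.1.1 p.1.2).ne), h.coef_const, add_zero, hF,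
      indicator_of_mem (show p ∈ D.below p.1.1 from Subset.rfl)]

theorem exists_ae_eq_add_const_on_quadrant {u v : (Fin n → ℝ) → ℝ}
    (hu : ∀ Q ∈ D.cubes, IntegrableOn u Q μ) (hv : ∀ Q ∈ D.cubes, IntegrableOn v Q μ)
    (huv : h.coef u = h.coef v) {Q : Set (Fin n → ℝ)} (hQ : Q ∈ D.cubes) :
    ∃ c : ℝ, ∀ᵐ x ∂μ, x ∈ D.quadrant Q → u x = v x + c := by
  have exists_const : ∀ R ∈ D.cubes, ∃ c : ℝ, ∀ᵐ x ∂μ.restrict R, u x = v x + c := fun R hR =>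
    h.exists_ae_eq_add_const hR (hu R hR) (hv R hR) fun p _ => by rw [huv]
  obtain ⟨c, hc⟩ := exists_const Q hQ
  have : NeZero (μ.restrict Q) := ⟨by simpa using (PosFinite.measure_pos Q hQ).ne'⟩
  have ae_eq_on_cubes : ∀ R ∈ {R | R ∈ D.cubes ∧ Q ⊆ R}, ∀ᵐ x ∂μ, x ∈ R → u x = v x + c := by
    rintro R ⟨hR, hQR⟩
    obtain ⟨c', hc'⟩ := exists_const R hR
    obtain ⟨x, hx, hx'⟩ := (hc.and (ae_restrict_of_ae_restrict_of_subset hQR hc')).exists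
    obtain ⟨k, hk⟩ := hR
    rwa [show c' = c by linarith, ae_restrict_iff' (D.measurableSet_of_gen hk)] at hc'
  refine ⟨c, ?_⟩
  filter_upwards [(ae_ball_iff (D.countable_cubes.mono fun R hR => hR.1)).2 ae_eq_on_cubes]
    with x hx ⟨R, hR, hxR⟩
  exact hx R hR hxR

theorem ae_eq_of_coef_eq (hquad : ∀ Q ∈ D.cubes, μ (D.quadrant Q) = ∞)
    {u v : (Fin n → ℝ) → ℝ} (hu : Integrable u μ) (hv : MemLp v 2 μ)
    (huv : h.coef u = h.coef v) : u =ᵐ[μ] v := by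
  refine ae_eq_of_forall_cubes (D := D) fun Q hQ => ?_
  obtain ⟨c, hc⟩ := h.exists_ae_eq_add_const_on_quadrant (fun _ _ => hu.integrableOn)
    (fun _ hR => integrableOn_of_memLp hv hR) huv hQ
  obtain rfl : c = 0 := by
    by_contra hc0
    exact (measure_lt_top_of_ae_eq_add_const (memLp_one_iff_integrable.2 hu) one_ne_zero
      ENNReal.one_ne_top hv two_ne_zero ENNReal.ofNat_ne_top hc0 hc).ne (hquad Q hQ)
  have subset_quadrant : Q ⊆ D.quadrant Q := subset_sUnion_of_mem ⟨hQ, subset_rfl⟩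
  obtain ⟨k, hQ⟩ := hQ
  refine (ae_restrict_iff' (D.measurableSet_of_gen hQ)).2 (hc.mono fun x hx hxQ => ?_)
  simpa using hx (subset_quadrant hxQ)

/-- The blocks of a sequence of coefficients as elements of `L¹(μ)`. -/
noncomputable def blockL1 (a : D.HaarIndex → ℝ) (Q : D.cubes) : Lp ℝ 1 μ :=
  (h.integrable_block a Q).toL1 (h.block a Q)

theorem coeFn_blockL1 (a : D.HaarIndex → ℝ) (Q : D.cubes) :
    h.blockL1 a Q =ᵐ[μ] h.block a Q :=
  Integrable.coeFn_toL1 _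

theorem enorm_sum_blockL1 (a : D.HaarIndex → ℝ) (t : Finset D.cubes) :
    ‖∑ Q ∈ t, h.blockL1 a Q‖ₑ = ∫⁻ x, ‖∑ Q ∈ t, h.block a Q x‖ₑ ∂μ := by
  have coeFn_sum : ∀ᵐ x ∂μ, (∑ Q ∈ t, h.blockL1 a Q : Lp ℝ 1 μ) x = ∑ Q ∈ t, h.block a Q x := by
    filter_upwards [Lp.coeFn_finsetSum t (h.blockL1 a),
      (ae_ball_iff t.countable_toSet).2 fun Q _ => h.coeFn_blockL1 a Q] with x hx hx_block
    rw [hx, Finset.sum_apply]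
    exact Finset.sum_congr rfl hx_block
  rw [Lp.enorm_def, eLpNorm_one_eq_lintegral_enorm]
  exact lintegral_congr_ae (EventuallyEq.fun_comp coeFn_sum fun y => ‖y‖ₑ)

theorem summable_blockL1 {C : ℝ≥0} (hC : h.MassBound C) {c : D.HaarIndex → ℝ}
    (hc : h.hardyNorm c ≠ ∞) : Summable (h.blockL1 c) := by
  rw [summable_iff_vanishing_norm]
  intro ε hε
  have tail_tendsto := ENNReal.Tendsto.const_mul (a := 2 * (2 ^ n * C + 1 : ℝ≥0))
    (h.tendsto_hardyNorm_restrictCubes_compl hc)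
    (Or.inr (ENNReal.mul_ne_top ENNReal.ofNat_ne_top ENNReal.coe_ne_top))
  rw [mul_zero] at tail_tendsto
  obtain ⟨t, ht⟩ := (tail_tendsto.eventually (gt_mem_nhds (ENNReal.ofReal_pos.2 hε))).exists
  refine ⟨t, fun t' ht' => ?_⟩
  have subset_compl : (t' : Set D.cubes) ⊆ (t : Set D.cubes)ᶜ := fun Q hQ =>
    Finset.disjoint_left.1 ht' hQ
  rw [← ENNReal.ofReal_lt_ofReal_iff hε, ofReal_norm, h.enorm_sum_blockL1]
  refine lt_of_le_of_lt ((h.lintegral_sum_block_le hC c t').trans ?_) ht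
  gcongr
  exact h.hardyNorm_restrictCubes_mono subset_compl c

theorem exists_L1_coef_eq {C : ℝ≥0} (hC : h.MassBound C) {c : D.HaarIndex → ℝ}
    (hc : h.hardyNorm c ≠ ∞) : ∃ g : Lp ℝ 1 μ, h.coef g = c := by
  classical
  have coefCLM_block : ∀ p Q, h.coefCLM p (h.blockL1 c Q) = if p.1 = Q then c p else 0 :=
    fun p Q => by rw [coefCLM_apply, h.coef_congr (h.coeFn_blockL1 c Q), h.coef_block]
  refine ⟨∑' Q, h.blockL1 c Q, funext fun p => ?_⟩
  rw [← coefCLM_apply, (h.coefCLM p).map_tsum (h.summable_blockL1 hC hc)]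
  simp only [coefCLM_block, tsum_ite_eq']

end HaarSystem

namespace HaarSystem

open Filter DyadicSystem

variable {n : ℕ} [NeZero n] {D : DyadicSystem n} {μ : Measure (Fin n → ℝ)} [D.PosFinite μ]

section HardyExtension

variable (h : HaarSystem D μ)

theorem h1Norm_eq_hardyNorm_coef (f : Lp ℝ 1 μ) : D.h1Norm μ f = h.hardyNorm (h.coef f) :=
  h.h1Norm_eq_hardyNorm fun _ _ => (L1.integrable_coeFn f).integrableOn

theorem coef_L1_injective (hquad : ∀ Q ∈ D.cubes, μ (D.quadrant Q) = ∞) :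
    Function.Injective fun f : Lp ℝ 1 μ => h.coef f := by
  intro f g hfg
  have coef_sub_eq : h.coef ↑(f - g) = h.coef (0 : (Fin n → ℝ) → ℝ) := by
    rw [AddSubgroupClass.coe_sub, h.coef_aeEqFun_sub
      (fun _ _ => (L1.integrable_coeFn f).integrableOn)
      (fun _ _ => (L1.integrable_coeFn g).integrableOn), sub_eq_zero.2 hfg]
    exact (funext fun p => h.coef_const 0 p).symm
  have ae_eq_zero := h.ae_eq_of_coef_eq hquad (L1.integrable_coeFn _) MemLp.zero coef_sub_eq
  exact sub_eq_zero.1 (Lp.ext (ae_eq_zero.trans (Lp.coeFn_zero ℝ 1 μ).symm))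

variable {h} {r s : ℕ} {T : Lp ℝ 2 μ →L[ℝ] Lp ℝ 2 μ} {C : ℝ≥0}

theorem IsShift.exists_H1_coef_eq (hT : h.IsShift r s T) (hC : h.MassBound C) (f : D.H1 μ) :
    ∃ g : D.H1 μ, h.coef g.1 = h.act T (h.coef f.1) := by
  obtain ⟨K, hK⟩ := hT.exists_hardyNorm_act_le hC
  have hardyNorm_lt_top : h.hardyNorm (h.act T (h.coef f.1)) < ∞ := by
    refine (hK _).trans_lt (ENNReal.mul_lt_top ENNReal.coe_lt_top ?_)
    rw [← h1Norm_eq_hardyNorm_coef]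
    exact f.2
  obtain ⟨g, hg⟩ := h.exists_L1_coef_eq hC hardyNorm_lt_top.ne
  refine ⟨⟨g, ?_⟩, hg⟩
  change D.h1Norm μ g < ∞
  rwa [h1Norm_eq_hardyNorm_coef, hg]

theorem IsShift.exists_extension_H1 (hT : h.IsShift r s T)
    (hquad : ∀ Q ∈ D.cubes, μ (D.quadrant Q) = ∞) (hC : h.MassBound C) :
    ∃ T₁ : D.H1 μ →ₗ[ℝ] D.H1 μ,
      (∃ C : ℝ≥0, ∀ f : D.H1 μ, D.h1Norm μ (T₁ f).1 ≤ C * D.h1Norm μ f.1) ∧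
      (∀ (f : D.H1 μ) (F : Lp ℝ 2 μ), f.1 =ᵐ[μ] F → (T₁ f).1 =ᵐ[μ] T F) := by
  have injective := h.coef_L1_injective hquad
  choose G hG using hT.exists_H1_coef_eq hC
  refine ⟨{ toFun := G, map_add' := fun f g => ?_, map_smul' := fun c f => ?_ }, ?_,
    fun f F hfF => ?_⟩
  · refine Subtype.ext (injective ?_)
    simp only [Submodule.coe_add, coef_L1_add, hG, hT.act_add]
  · refine Subtype.ext (injective ?_)
    simp only [RingHom.id_apply, Submodule.coe_smul, coef_L1_smul, hG, act_smul]
  · obtain ⟨K, hK⟩ := hT.exists_hardyNorm_act_le hC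
    refine ⟨K, fun f => ?_⟩
    simp only [LinearMap.coe_mk, AddHom.coe_mk, h.h1Norm_eq_hardyNorm_coef, hG]
    exact hK _
  · refine h.ae_eq_of_coef_eq hquad (L1.integrable_coeFn _) (Lp.memLp _) ?_
    rw [h.coef_apply, ← h.coef_congr hfF]
    exact hG f

end HardyExtension

section BMOExtension

theorem carleson_coef_BMO (h : HaarSystem D μ) (f : D.BMO μ) :
    h.Carleson (h.coef f.1) (16 * (D.bmoNorm μ f.1).toNNReal) :=
  h.carleson_coef_of_meanOscLE (meanOscLE_of_bmoNorm_lt_top f.2.1 f.2.2)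

variable {h : HaarSystem D μ} {r s : ℕ} {T : Lp ℝ 2 μ →L[ℝ] Lp ℝ 2 μ} {C : ℝ≥0}

theorem MassBound.bmoNorm_eq_zero_iff (hC : h.MassBound C) (f : D.BMO μ) :
    D.bmoNorm μ f.1 = 0 ↔ h.coef f.1 = 0 := by
  constructor
  · intro hf
    funext p
    have abs_coef_le := (h.carleson_coef_BMO f).abs_le p
    simpa [hf] using abs_coef_le
  · intro hf
    have carleson_zero : h.Carleson (h.coef f.1) 0 := by
      rw [hf]
      exact ⟨fun p => by simp, fun Q => by simp⟩
    simpa using carleson_zero.bmoNorm_le hC f.2.1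

theorem MassBound.toBMO_eq_iff (hC : h.MassBound C) (f g : D.BMO μ) :
    D.toBMO μ f = D.toBMO μ g ↔ h.coef f.1 = h.coef g.1 := by
  rw [toBMO, toBMO, Submodule.mkQ_apply, Submodule.mkQ_apply, Submodule.Quotient.eq,
    ← sub_eq_zero (a := h.coef f.1), ← h.coef_aeEqFun_sub f.2.1 g.2.1]
  exact hC.bmoNorm_eq_zero_iff (f - g)

theorem IsShift.exists_bmoNorm_le (hT : h.IsShift r s T) (hC : h.MassBound C) :
    ∃ K : ℝ≥0, ∀ (f : D.BMO μ) (g : (Fin n → ℝ) → ℝ), (∀ Q ∈ D.cubes, IntegrableOn g Q μ) →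
      h.coef g = h.act T (h.coef f.1) → D.bmoNorm μ g ≤ K * D.bmoNorm μ f.1 := by
  refine ⟨(‖T‖₊ + (2 ^ n * s + 1) * actConst n C r s T) * 16 * (2 ^ n * C + 1),
    fun f g hg hfg => ?_⟩
  have carleson_g := hT.carleson_act hC (h.carleson_coef_BMO f)
  rw [← hfg] at carleson_g
  refine (carleson_g.bmoNorm_le hC hg).trans_eq ?_
  rw [← ENNReal.coe_toNNReal f.2.2.ne, ← ENNReal.coe_mul, ENNReal.toNNReal_coe]
  ring_nf

theorem IsShift.exists_BMO_coef_eq (hT : h.IsShift r s T) (hC : h.MassBound C) (f : D.BMO μ) :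
    ∃ g : D.BMO μ, h.coef g.1 = h.act T (h.coef f.1) := by
  obtain ⟨g, aestronglyMeasurable_g, integrableOn_g, coef_g⟩ := h.exists_integrableOn_coef_eq
    fun Q hQ => (hT.carleson_act hC (h.carleson_coef_BMO f)).tsum_ne_top ⟨Q, hQ⟩
  have coeFn_mk := AEEqFun.coeFn_mk g aestronglyMeasurable_g
  obtain ⟨K, hK⟩ := hT.exists_bmoNorm_le hC
  refine ⟨⟨AEEqFun.mk g aestronglyMeasurable_g, fun Q hQ =>
    (integrableOn_g Q hQ).congr (ae_restrict_of_ae coeFn_mk.symm), ?_⟩,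
    (h.coef_congr coeFn_mk).trans coef_g⟩
  rw [D.bmoNorm_congr coeFn_mk]
  exact (hK f g integrableOn_g coef_g).trans_lt (ENNReal.mul_lt_top ENNReal.coe_lt_top f.2.2)

theorem IsShift.exists_BMOSpace_map (hT : h.IsShift r s T) (hC : h.MassBound C) :
    ∃ T₂ : D.BMOSpace μ →ₗ[ℝ] D.BMOSpace μ, ∀ f g : D.BMO μ,
      T₂ (D.toBMO μ f) = D.toBMO μ g ↔ h.coef g.1 = h.act T (h.coef f.1) := by
  choose G hG using hT.exists_BMO_coef_eq hC
  have coef_add_BMO : ∀ f g : D.BMO μ, h.coef (f + g).1 = h.coef f.1 + h.coef g.1 := fun f g =>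
    h.coef_aeEqFun_add f.2.1 g.2.1
  have coef_smul_BMO : ∀ (c : ℝ) (f : D.BMO μ), h.coef (c • f).1 = c • h.coef f.1 := fun c f =>
    h.coef_aeEqFun_smul c f.1
  let L : D.BMO μ →ₗ[ℝ] D.BMOSpace μ :=
    { toFun := fun f => D.toBMO μ (G f)
      map_add' := fun f g => by
        rw [← map_add, hC.toBMO_eq_iff]
        simp only [coef_add_BMO, hG, hT.act_add]
      map_smul' := fun c f => by
        rw [RingHom.id_apply, ← map_smul, hC.toBMO_eq_iff]
        simp only [coef_smul_BMO, hG, act_smul] }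
  have null_le_ker : D.BMONull μ ≤ LinearMap.ker L := fun f hf => by
    have coef_f : h.coef f.1 = 0 := (hC.bmoNorm_eq_zero_iff f).1 hf
    have act_zero : h.act T 0 = 0 := by simpa using h.act_smul T 0 0
    refine (Submodule.Quotient.mk_eq_zero _).2 ((hC.bmoNorm_eq_zero_iff (G f)).2 ?_)
    rw [hG, coef_f, act_zero]
  refine ⟨(D.BMONull μ).liftQ L null_le_ker, fun f g => ?_⟩
  rw [toBMO, Submodule.mkQ_apply, Submodule.liftQ_apply, ← hG]
  exact (hC.toBMO_eq_iff (G f) g).trans eq_comm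

theorem memLp_indicator_BMO (f : D.BMO μ) {P : Set (Fin n → ℝ)} (hP : P ∈ D.cubes) :
    MemLp (P.indicator f.1) 2 μ :=
  (meanOscLE_of_bmoNorm_lt_top f.2.1 f.2.2).memLp_indicator hP

/-- The coefficients of `T f` below `Q` depend only on those of `f` below the cube `P`, which lies
`r + s` generations above `Q`. -/
theorem IsShift.exists_ae_eq_apply_indicator_add_const (hT : h.IsShift r s T)
    {f g : (Fin n → ℝ) → ℝ} (hg : ∀ Q ∈ D.cubes, IntegrableOn g Q μ)
    (hfg : h.coef g = h.act T (h.coef f)) {P Q : Set (Fin n → ℝ)} (hQ : Q ∈ D.desc (r + s) P)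
    (hF : MemLp (P.indicator f) 2 μ) :
    ∃ c : ℝ, ∀ᵐ x ∂μ.restrict Q, g x = T (hF.toLp (P.indicator f)) x + c := by
  obtain ⟨k, hPk, hQk, hQP⟩ := hQ
  have hQ : Q ∈ D.cubes := ⟨_, hQk⟩
  refine h.exists_ae_eq_add_const hQ (hg Q hQ) (integrableOn_of_memLp (Lp.memLp _) hQ)
    fun p (hpQ : p.1.1 ⊆ Q) => ?_
  rw [hfg, h.coef_apply, h.coef_congr hF.coeFn_toLp]
  refine hT.act_congr fun q hqp => h.coef_congr_restrict ?_
  have level_le := D.le_of_gen_subset hQk (D.mem_gen_level p.1) hpQ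
  have hqP : q.1.1 ⊆ P := hqp.subset hPk (hpQ.trans hQP) (by push_cast at level_le; omega)
  filter_upwards [ae_restrict_mem (D.measurableSet_of_gen (D.mem_gen_level q.1))] with x hx
  exact (indicator_of_mem (hqP hx) _).symm

theorem IsShift.exists_extension_BMO (hT : h.IsShift r s T) (hC : h.MassBound C) :
    ∃ T₂ : D.BMOSpace μ →ₗ[ℝ] D.BMOSpace μ,
      (∃ C : ℝ≥0, ∀ f g : D.BMO μ, T₂ (D.toBMO μ f) = D.toBMO μ g →
        D.bmoNorm μ g.1 ≤ C * D.bmoNorm μ f.1) ∧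
      (∀ (f : D.BMO μ) (F : Lp ℝ 2 μ), f.1 =ᵐ[μ] F →
        ∃ g : D.BMO μ, g.1 =ᵐ[μ] T F ∧ T₂ (D.toBMO μ f) = D.toBMO μ g) ∧
      (∀ f g : D.BMO μ, T₂ (D.toBMO μ f) = D.toBMO μ g →
        ∀ P ∈ D.cubes, ∀ Q ∈ D.desc (r + s) P,
          ∃ hF : MemLp (P.indicator f.1) 2 μ, ∃ c : ℝ,
            ∀ᵐ x ∂μ.restrict Q, g.1 x = T (hF.toLp (P.indicator f.1)) x + c) := by
  obtain ⟨T₂, hT₂⟩ := hT.exists_BMOSpace_map hC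
  obtain ⟨K, hK⟩ := hT.exists_bmoNorm_le hC
  refine ⟨T₂, ⟨K, fun f g hfg => hK f g.1 g.2.1 ((hT₂ f g).1 hfg)⟩, fun f F hfF => ?_,
    fun f g hfg P hP Q hQ => ?_⟩
  · have coef_TF : h.coef (T F) = h.act T (h.coef f.1) := by
      rw [h.coef_apply, h.coef_congr hfF]
    have integrableOn_TF : ∀ Q ∈ D.cubes, IntegrableOn (T F) Q μ := fun Q hQ =>
      integrableOn_of_memLp (Lp.memLp _) hQ
    have bmoNorm_lt_top : D.bmoNorm μ (T F) < ∞ :=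
      (hK f _ integrableOn_TF coef_TF).trans_lt (ENNReal.mul_lt_top ENNReal.coe_lt_top f.2.2)
    exact ⟨⟨(T F).1, integrableOn_TF, bmoNorm_lt_top⟩, EventuallyEq.rfl, (hT₂ _ _).2 coef_TF⟩
  · have hF := memLp_indicator_BMO f hP
    exact ⟨hF, hT.exists_ae_eq_apply_indicator_add_const g.2.1 ((hT₂ f g).1 hfg) hQ hF⟩

end BMOExtension

end HaarSystem

theorem theoremA {n : ℕ} (hn : 1 ≤ n) (D : DyadicSystem n) (μ : Measure (Fin n → ℝ))
    (hμ : ∀ Q ∈ D.cubes, 0 < μ Q ∧ μ Q < ∞)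
    (hquad : ∀ Q ∈ D.cubes, μ (D.quadrant Q) = ∞)
    (h : HaarSystem D μ) (hbal : h.Balanced)
    (r s : ℕ) (T : Lp ℝ 2 μ →L[ℝ] Lp ℝ 2 μ) (hT : h.IsHaarShift r s T) :
    -- (i) `T` extends to a bounded operator on the martingale Hardy space
    (∃ T₁ : D.H1 μ →ₗ[ℝ] D.H1 μ,
      (∃ C : ℝ≥0, ∀ f : D.H1 μ, D.h1Norm μ (T₁ f).1 ≤ C * D.h1Norm μ f.1) ∧
      (∀ (f : D.H1 μ) (F : Lp ℝ 2 μ), f.1 =ᵐ[μ] F → (T₁ f).1 =ᵐ[μ] T F)) ∧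
    -- (ii) `T` extends to a bounded operator on martingale BMO
    (∃ T₂ : D.BMOSpace μ →ₗ[ℝ] D.BMOSpace μ,
      (∃ C : ℝ≥0, ∀ f g : D.BMO μ, T₂ (D.toBMO μ f) = D.toBMO μ g →
        D.bmoNorm μ g.1 ≤ C * D.bmoNorm μ f.1) ∧
      -- it agrees with `T` on `L² ∩ BMO`
      (∀ (f : D.BMO μ) (F : Lp ℝ 2 μ), f.1 =ᵐ[μ] F →
        ∃ g : D.BMO μ, g.1 =ᵐ[μ] T F ∧ T₂ (D.toBMO μ f) = D.toBMO μ g) ∧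
      -- on each cube `Q` it is, up to an additive constant, `T (f 1_P)`, where `P` is the
      -- `(r + s)`-th dyadic ancestor of `Q`
      (∀ f g : D.BMO μ, T₂ (D.toBMO μ f) = D.toBMO μ g →
        ∀ P ∈ D.cubes, ∀ Q ∈ D.desc (r + s) P,
          ∃ hF : MemLp (P.indicator f.1) 2 μ, ∃ c : ℝ,
            ∀ᵐ x ∂μ.restrict Q, g.1 x = T (hF.toLp (P.indicator f.1)) x + c)) := by
  have : NeZero n := ⟨by omega⟩
  have : D.PosFinite μ := ⟨fun Q hQ => (hμ Q hQ).1, fun Q hQ => (hμ Q hQ).2⟩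
  obtain ⟨C, hC⟩ := hbal.exists_massBound
  exact ⟨hT.isShift.exists_extension_H1 hquad hC, hT.isShift.exists_extension_BMO hC⟩
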